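/- Let $k$ be a field of characteristic zero and let $H=\langle x,y \mid [[y,x],x]=[[y,x],y]=0\rangle$ be the Heisenberg Lie $k$-algebra, with $z=[y,x]$. Let $U(H)$ be its universal enveloping algebra (an Ore domain) and $\mathfrak D(H)$ the Ore division ring of fractions of $U(H)$. Put $V=\tfrac12(xy+yx)$. The elements $z$, $V\pm\tfrac13z$, $z\pm y^2$, $z^2\pm y^3$ of $\mathfrak D(H)$ are nonzero, and we set $$S=(V-\tfrac13z)(V+\tfrac13z)^{-1},\qquad T=(z+y^2)^{-1}(z-y^2)\,S\,(z+y^2)(z-y^2)^{-1},$$ $$S_1=z^{-1}\Big((V-\tfrac13z)(V+\tfrac13z)^{-1}+(V-\tfrac13z)^{-1}(V+\tfrac13z)\Big)z^{-1},$$ $$S_2=z\Big((V-\tfrac13z)(V+\tfrac13z)^{-1}+(V-\tfrac13z)^{-1}(V+\tfrac13z)\Big)z,$$ $$T_1=(z+y^2)^{-1}(z-y^2)\,S_1\,(z+y^2)(z-y^2)^{-1},\qquad T_2=(z^2+y^3)^{-1}(z^2-y^3)\,S_1\,(z^2+y^3)(z^2-y^3)^{-1},$$ $$T_3=(z+y^2)^{-1}(z-y^2)\,S_2\,(z+y^2)(z-y^2)^{-1},\qquad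 T_4=(z^2+y^3)^{-1}(z^2-y^3)\,S_2\,(z^2+y^3)(z^2-y^3)^{-1}.$$ A $k$-involution of a Lie $k$-algebra is a $k$-linear map $*$ with $[a,b]^*=[b^*,a^*]$ and $a^{**}=a$. Consider the following $k$-involutions of $H$: $\eta_1\colon x\mapsto x,\ y\mapsto -y,\ z\mapsto z$; $\ \eta_2\colon x\mapsto x,\ y\mapsto y,\ z\mapsto -z$; and $\eta_3\colon x\mapsto -x,\ y\mapsto -y,\ z\mapsto -z$. Each $\eta_i$ extends uniquely to a $k$-involution (a $k$-linear anti-multiplicative map of order at most two) of $U(H)$ and then of $\mathfrak D(H)$; an element is symmetric with respect to $\eta_i$ if the extension fixes it. For two distinct elements $A,B$ of $\mathfrak D(H)$, we say that $\{A,B\}$ generates a free $k$-algebra if the $k$-subalgebra generated by $\{A,B\}$ is the free $k$-algebra on the set $\{A,B\}$, and that $\{A,B\}$ generates a free group $k$-algebra if $A,B$ are nonzero and the $k$-subalgebra generated by $\{A,A^{-1},B,B^{-1}\}$ is the group $k$-algebra of the free group on the set $\{A,B\}$. Then the following hold. 1. $\{S,T\}$ generates a free group $k$-algebra. 2. (a)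 $S_1,S_1^2,T_1,T_1^2$ are symmetric with respect to $\eta_2$ and with respect to $\eta_3$. (b) $\{S_1,T_1\}$ generates a free $k$-algebra. (c) $\{1+S_1,1+T_1\}$ generates a free group $k$-algebra. (d) $\{S_1^2,T_1^2\}$ generates a free $k$-algebra. (e) $\{1+S_1^2,1+T_1^2\}$ generates a free group $k$-algebra. 3. (a) $S_1,S_1^2,T_2,T_2^2$ are symmetric with respect to $\eta_1$. (b) $\{S_1,T_2\}$ generates a free $k$-algebra. (c) $\{1+S_1,1+T_2\}$ generates a free group $k$-algebra. (d) $\{S_1^2,T_2^2\}$ generates a free $k$-algebra. (e) $\{1+S_1^2,1+T_2^2\}$ generates a free group $k$-algebra. 4. (a) $S_2,S_2^2,T_3,T_3^2$ are symmetric with respect to $\eta_2$ and with respect to $\eta_3$. (b) $\{S_2^2,T_3^2\}$ generates a free $k$-algebra. 5. (a) $S_2,S_2^2,T_4,T_4^2$ are symmetric with respect to $\eta_1$. (b) $\{S_2^2,T_4^2\}$ generates a free $k$-algebra. -/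

import Mathlib

noncomputable section

universe u

/-- The ideal of relations `[[y, x], x] = [[y, x], y] = 0` of the free Lie algebra on
`x` (the generator `0`) and `y` (the generator `1`). -/
def heisIdeal (k : Type u) [Field k] : LieIdeal k (FreeLieAlgebra k (Fin 2)) :=
  LieSubmodule.lieSpan k (FreeLieAlgebra k (Fin 2))
    {⁅⁅FreeLieAlgebra.of k (1 : Fin 2), FreeLieAlgebra.of k (0 : Fin 2)⁆,
        FreeLieAlgebra.of k (0 : Fin 2)⁆,
     ⁅⁅FreeLieAlgebra.of k (1 : Fin 2), FreeLieAlgebra.of k (0 : Fin 2)⁆,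
        FreeLieAlgebra.of k (1 : Fin 2)⁆}

/-- The Heisenberg Lie `k`-algebra `H = ⟨x, y ∣ [[y, x], x] = [[y, x], y] = 0⟩`. -/
abbrev Heis (k : Type u) [Field k] : Type u := FreeLieAlgebra k (Fin 2) ⧸ heisIdeal k

namespace Heis

variable (k : Type u) [Field k]

def x : Heis k := LieSubmodule.Quotient.mk (FreeLieAlgebra.of k (0 : Fin 2))
def y : Heis k := LieSubmodule.Quotient.mk (FreeLieAlgebra.of k (1 : Fin 2))
def z : Heis k := ⁅y k, x k⁆

lemma lie_z_x : ⁅z k, x k⁆ = 0 := by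
  rw [z, x, y, ← LieSubmodule.Quotient.mk_bracket, ← LieSubmodule.Quotient.mk_bracket,
    LieSubmodule.Quotient.mk_eq_zero']
  exact LieSubmodule.subset_lieSpan (Or.inl rfl)

lemma lie_z_y : ⁅z k, y k⁆ = 0 := by
  rw [z, x, y, ← LieSubmodule.Quotient.mk_bracket, ← LieSubmodule.Quotient.mk_bracket,
    LieSubmodule.Quotient.mk_eq_zero']
  exact LieSubmodule.subset_lieSpan (Or.inr rfl)

variable {k}
variable {L : Type*} [LieRing L] [LieAlgebra k L]

/-- The universal property of the presentation. -/
def lift (a b : L) (h₁ : ⁅⁅b, a⁆, a⁆ = 0) (h₂ : ⁅⁅b, a⁆, b⁆ = 0) : Heis k →ₗ⁅k⁆ L :=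
  { (heisIdeal k).toSubmodule.liftQ (FreeLieAlgebra.lift k ![a, b] :
      FreeLieAlgebra k (Fin 2) →ₗ[k] L) (by
        have : heisIdeal k ≤ (FreeLieAlgebra.lift k (![a, b] : Fin 2 → L)).ker := by
          rw [heisIdeal, LieSubmodule.lieSpan_le]
          rintro w (rfl | rfl)
          · simp only [SetLike.mem_coe, LieHom.mem_ker, LieHom.map_lie,
              FreeLieAlgebra.lift_of_apply]
            exact h₁
          · simp only [SetLike.mem_coe, LieHom.mem_ker, LieHom.map_lie,
              FreeLieAlgebra.lift_of_apply]
            exact h₂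
        exact fun w hw => this hw) with
    map_lie' := by
      intro p q
      induction p using Submodule.Quotient.induction_on with | _ p
      induction q using Submodule.Quotient.induction_on with | _ q
      exact LieHom.map_lie (FreeLieAlgebra.lift k (![a, b] : Fin 2 → L)) p q }

@[simp] lemma lift_x (a b : L) (h₁ : ⁅⁅b, a⁆, a⁆ = 0) (h₂ : ⁅⁅b, a⁆, b⁆ = 0) :
    lift a b h₁ h₂ (x k) = a := by
  change FreeLieAlgebra.lift k (![a, b] : Fin 2 → L) (FreeLieAlgebra.of k (0 : Fin 2)) = a
  simp [FreeLieAlgebra.lift_of_apply]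

@[simp] lemma lift_y (a b : L) (h₁ : ⁅⁅b, a⁆, a⁆ = 0) (h₂ : ⁅⁅b, a⁆, b⁆ = 0) :
    lift a b h₁ h₂ (y k) = b := by
  change FreeLieAlgebra.lift k (![a, b] : Fin 2 → L) (FreeLieAlgebra.of k (1 : Fin 2)) = b
  simp [FreeLieAlgebra.lift_of_apply]

/-- The quotient map from the free Lie algebra. -/
def mkHom : FreeLieAlgebra k (Fin 2) →ₗ⁅k⁆ Heis k :=
  { (heisIdeal k).toSubmodule.mkQ with
    map_lie' := fun {_ _} => rfl }

lemma hom_ext {f g : Heis k →ₗ⁅k⁆ L} (hx : f (x k) = g (x k)) (hy : f (y k) = g (y k)) :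
    f = g := by
  have : f.comp mkHom = g.comp mkHom := by
    apply FreeLieAlgebra.hom_ext
    intro i
    fin_cases i
    · exact hx
    · exact hy
  ext p
  induction p using Submodule.Quotient.induction_on with | _ p
  exact LieHom.congr_fun this p

end Heis

-- The enveloping algebra `U(H)`; in characteristic zero it is a domain.
section EnvelopingAlgebra

open UniversalEnvelopingAlgebra Polynomial

attribute [local instance 100] LieRing.ofAssociativeRing

/-- The universal enveloping algebra `U(H)`. -/
abbrev UHeis (k : Type u) [Field k] : Type u := UniversalEnvelopingAlgebra k (Heis k)

namespace UHeis

variable (k : Type u) [Field k]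

def x : UHeis k := ι k (Heis.x k)
def y : UHeis k := ι k (Heis.y k)
def z : UHeis k := ι k (Heis.z k)

lemma z_eq : z k = y k * x k - x k * y k := by
  simp only [z, Heis.z, LieHom.map_lie, x, y, LieRing.of_associative_ring_bracket]

lemma comm_zx : Commute (z k) (x k) := by
  have := congrArg (ι k) (Heis.lie_z_x k)
  rw [LieHom.map_lie, LieRing.of_associative_ring_bracket, map_zero, sub_eq_zero] at this
  exact this

lemma comm_zy : Commute (z k) (y k) := by
  have := congrArg (ι k) (Heis.lie_z_y k)
  rw [LieHom.map_lie, LieRing.of_associative_ring_bracket, map_zero, sub_eq_zero] at this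
  exact this

lemma mem_of_gens (S : Subalgebra k (UHeis k)) (hx : x k ∈ S) (hy : y k ∈ S) (w : UHeis k) :
    w ∈ S := by
  let X : S := ⟨x k, hx⟩
  let Y : S := ⟨y k, hy⟩
  have h₁ : ⁅⁅Y, X⁆, X⁆ = 0 := by
    apply Subtype.ext
    have := (comm_zx k).eq
    rw [z_eq] at this
    simpa [X, Y, LieRing.of_associative_ring_bracket, sub_eq_zero] using this
  have h₂ : ⁅⁅Y, X⁆, Y⁆ = 0 := by
    apply Subtype.ext
    have := (comm_zy k).eq
    rw [z_eq] at this
    simpa [X, Y, LieRing.of_associative_ring_bracket, sub_eq_zero] using this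
  let F : UHeis k →ₐ[k] S := UniversalEnvelopingAlgebra.lift k (Heis.lift X Y h₁ h₂)
  have hF : S.val.comp F = AlgHom.id k _ := by
    apply UniversalEnvelopingAlgebra.hom_ext
    apply Heis.hom_ext
    · change ((F (ι k (Heis.x k)) : S) : UHeis k) = ι k (Heis.x k)
      rw [UniversalEnvelopingAlgebra.lift_ι_apply, Heis.lift_x]
      rfl
    · change ((F (ι k (Heis.y k)) : S) : UHeis k) = ι k (Heis.y k)
      rw [UniversalEnvelopingAlgebra.lift_ι_apply, Heis.lift_y]
      rfl
  have := AlgHom.congr_fun hF w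
  rw [AlgHom.id_apply] at this
  rw [← this]
  exact (F w).2

/-- Polynomials in the two commuting elements `x` and `z`. -/
def poly : k[X][X] →+* UHeis k :=
  Polynomial.eval₂RingHom' (Polynomial.aeval (z k)).toRingHom (x k) (by
    intro q
    induction q using Polynomial.induction_on' with
    | add p q hp hq => simpa using hp.add_left hq
    | monomial n c =>
      simpa [Polynomial.aeval_monomial] using
        (Algebra.commute_algebraMap_left c (x k)).mul_left ((comm_zx k).pow_left n))

@[simp] lemma poly_X : poly k X = x k := by simp [poly]
@[simp] lemma poly_C_X : poly k (C X) = z k := by simp [poly]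
@[simp] lemma poly_C_C (c : k) : poly k (C (C c)) = algebraMap k _ c := by simp [poly]

/-- The action on polynomials in which `x`, `z` are multiplications and `y` is `z ∂/∂x`. -/
def rep : UHeis k →ₐ[k] Module.End k k[X][X] :=
  UniversalEnvelopingAlgebra.lift k
    (Heis.lift (LinearMap.mulLeft k X)
      ((LinearMap.mulLeft k (C X)).comp ((Polynomial.derivative : k[X][X] →ₗ[k[X]] k[X][X]).restrictScalars k))
      (by
        ext1 p
        simp [LieRing.of_associative_ring_bracket]
        ring)
      (by
        ext1 p
        simp [LieRing.of_associative_ring_bracket]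
        ring))

lemma rep_poly (p q : k[X][X]) : rep k (poly k p) q = p * q := by
  have hx : rep k (x k) = LinearMap.mulLeft k X := by
    rw [rep, x, UniversalEnvelopingAlgebra.lift_ι_apply, Heis.lift_x]
  have hy : rep k (y k) = (LinearMap.mulLeft k (C X)).comp
      ((Polynomial.derivative : k[X][X] →ₗ[k[X]] k[X][X]).restrictScalars k) := by
    rw [rep, y, UniversalEnvelopingAlgebra.lift_ι_apply, Heis.lift_y]
  have hz : rep k (z k) = LinearMap.mulLeft k (C X) := by
    rw [z_eq, map_sub, map_mul, map_mul, hx, hy]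
    ext1 p
    simp
    ring
  have : (rep k).toRingHom.comp (poly k) = (Algebra.lmul k k[X][X]).toRingHom := by
    apply Polynomial.ringHom_ext'
    · apply Polynomial.ringHom_ext'
      · ext1 c
        ext1 p
        simp [Algebra.smul_def]
      · simp [hz]; rfl
    · simp [hx]; rfl
  exact LinearMap.congr_fun (RingHom.congr_fun this p) q

lemma poly_injective : Function.Injective (poly k) := by
  intro p q h
  have := rep_poly k p 1
  rw [h, rep_poly] at this
  simpa using this.symm

/-- `∑ pᵢ(x, z) yⁱ`. -/
def nf : k[X][X][X] →+ UHeis k := Polynomial.eval₂AddMonoidHom (poly k) (y k)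

lemma nf_monomial (n : ℕ) (p : k[X][X]) : nf k (monomial n p) = poly k p * y k ^ n := by
  simp [nf]

lemma nf_mul_y (f : k[X][X][X]) : nf k f * y k = nf k (f * X) := by
  simp [nf, Polynomial.eval₂_mul_X]

lemma y_pow_mul_x (n : ℕ) :
    y k ^ n * x k = x k * y k ^ n + (n : UHeis k) * (z k * y k ^ (n - 1)) := by
  have hyx : y k * x k = x k * y k + z k := by rw [z_eq]; abel
  induction n with
  | zero => simp
  | succ n ih =>
    have hz : y k * z k = z k * y k := (comm_zy k).eq.symm
    rw [pow_succ', mul_assoc, ih, mul_add, ← mul_assoc, hyx, add_mul, mul_assoc, add_assoc]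
    congr 1
    rw [Nat.add_sub_cancel, Nat.cast_succ, add_mul, one_mul, add_comm]
    congr 1
    rcases n with _ | n
    · simp
    · rw [Nat.add_sub_cancel, ← mul_assoc, ← Nat.cast_comm, mul_assoc, ← mul_assoc (y k), hz,
        mul_assoc, ← pow_succ']

/-- Commutation with `x`. -/
def der : UHeis k →ₗ[k] UHeis k := LinearMap.mulRight k (x k) - LinearMap.mulLeft k (x k)

lemma der_apply (w : UHeis k) : der k w = w * x k - x k * w := rfl

lemma der_mul (a b : UHeis k) : der k (a * b) = der k a * b + a * der k b := by
  simp only [der_apply]; noncomm_ring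

lemma poly_comm_x (p : k[X][X]) : poly k p * x k = x k * poly k p := by
  rw [← poly_X, ← map_mul, ← map_mul, mul_comm]

lemma der_nf (f : k[X][X][X]) : der k (nf k f) = nf k (C (C X) * derivative f) := by
  induction f using Polynomial.induction_on' with
  | add p q hp hq => simp only [map_add, mul_add, hp, hq]
  | monomial n p =>
    rw [derivative_monomial, C_mul_monomial, nf_monomial, nf_monomial, der_mul]
    have : der k (poly k p) = 0 := by rw [der_apply, poly_comm_x, sub_self]
    rw [this, zero_mul, zero_add, der_apply, y_pow_mul_x, add_sub_cancel_left]
    rw [show C X * (p * (n : k[X][X])) = p * ((n : k[X][X]) * C X) by ring, map_mul, map_mul,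
      map_natCast, poly_C_X]
    simp only [mul_assoc]

lemma x_mul_nf (f : k[X][X][X]) : x k * nf k f = nf k (C X * f) := by
  induction f using Polynomial.induction_on' with
  | add p q hp hq => simp only [map_add, mul_add, hp, hq]
  | monomial n p =>
    rw [C_mul_monomial, nf_monomial, nf_monomial, map_mul, poly_X, mul_assoc]

lemma nf_surjective (w : UHeis k) : ∃ f, nf k f = w := by
  let S : Subalgebra k (UHeis k) :=
    { carrier := {u | ∀ f, ∃ g, nf k f * u = nf k g}
      mul_mem' := by
        intro a b ha hb f
        obtain ⟨g, hg⟩ := ha f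
        obtain ⟨h, hh⟩ := hb g
        exact ⟨h, by rw [← mul_assoc, hg, hh]⟩
      add_mem' := by
        intro a b ha hb f
        obtain ⟨g, hg⟩ := ha f
        obtain ⟨h, hh⟩ := hb f
        exact ⟨g + h, by rw [mul_add, hg, hh, map_add]⟩
      algebraMap_mem' := by
        intro c f
        refine ⟨C (C (C c)) * f, ?_⟩
        rw [← Algebra.commutes]
        induction f using Polynomial.induction_on' with
        | add p q hp hq => simp only [map_add, mul_add, hp, hq]
        | monomial n p =>
          rw [C_mul_monomial, nf_monomial, nf_monomial, map_mul, poly_C_C, mul_assoc] }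
  have hS := mem_of_gens k S
    (fun f => ⟨C X * f + C (C X) * derivative f, by
      rw [map_add, ← der_nf, ← x_mul_nf, der_apply]; abel⟩)
    (fun f => ⟨f * X, nf_mul_y k f⟩) w
  obtain ⟨g, hg⟩ := hS 1
  refine ⟨g, ?_⟩
  rw [← hg, ← monomial_zero_one, nf_monomial]
  simp

lemma derivative_C_pow_mul {A : Type*} [CommRing A] (a : A) (n : ℕ) (f : A[X]) :
    derivative (C a ^ n * f) = C a ^ n * derivative f := by
  rw [← C_pow, derivative_C_mul]

lemma der_iterate_nf (n : ℕ) (f : k[X][X][X]) :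
    (der k)^[n] (nf k f) = nf k (C (C X) ^ n * derivative^[n] f) := by
  induction n with
  | zero => simp
  | succ n ih =>
    rw [Function.iterate_succ_apply', ih, der_nf, Function.iterate_succ_apply']
    rw [derivative_C_pow_mul, ← mul_assoc, ← pow_succ']

lemma exists_der_iterate [CharZero k] {w : UHeis k} (hw : w ≠ 0) :
    ∃ n, ∃ p : k[X][X], p ≠ 0 ∧ (der k)^[n] w = poly k p ∧ (der k)^[n + 1] w = 0 := by
  obtain ⟨f, rfl⟩ := nf_surjective k w
  have hf : f ≠ 0 := by rintro rfl; exact hw (map_zero _)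
  have h0 : (der k)^[f.natDegree] (nf k f) =
      poly k (C X ^ f.natDegree * ((f.natDegree.factorial : k[X][X]) * f.leadingCoeff)) := by
    have h1 : derivative^[f.natDegree] f = C ((f.natDegree.factorial : k[X][X]) * f.leadingCoeff) := by
      ext1 i
      rw [coeff_iterate_derivative, coeff_C]
      rcases i with _ | i
      · simp [Nat.descFactorial_self]
      · rw [coeff_eq_zero_of_natDegree_lt (by omega)]; simp
    rw [der_iterate_nf, h1, ← C_pow, ← C_mul, ← monomial_zero_left, nf_monomial]
    simp
  refine ⟨f.natDegree, _, ?_, h0, ?_⟩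
  · have := Nat.factorial_ne_zero f.natDegree
    refine mul_ne_zero (pow_ne_zero _ (by simp)) (mul_ne_zero (by exact_mod_cast this) ?_)
    simpa using hf
  · rw [Function.iterate_succ_apply', h0, der_apply, poly_comm_x, sub_self]

lemma der_iterate_mul (N : ℕ) : ∀ (n m : ℕ) (a b : UHeis k), n + m = N →
    (der k)^[n + 1] a = 0 → (der k)^[m + 1] b = 0 →
    (der k)^[n + m] (a * b) = ((n + m).choose n : UHeis k) * ((der k)^[n] a * (der k)^[m] b) := by
  have hadd : ∀ (n : ℕ) (a b : UHeis k),
      (der k)^[n] (a + b) = (der k)^[n] a + (der k)^[n] b := by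
    intro n a b
    rw [← Module.End.coe_pow, map_add]
  have hz : ∀ (n : ℕ), (der k)^[n] 0 = 0 := by
    intro n
    rw [← Module.End.coe_pow, map_zero]
  induction N with
  | zero =>
    intro n m a b h _ _
    obtain ⟨rfl, rfl⟩ : n = 0 ∧ m = 0 := by omega
    simp
  | succ N ih =>
    intro n m a b h ha hb
    have step : (der k)^[n + m] (a * b) =
        (der k)^[N] (der k a * b) + (der k)^[N] (a * der k b) := by
      rw [h, Function.iterate_succ_apply, der_mul, hadd]
    rw [step]
    rcases n with _ | n <;> rcases m with _ | m
    · omega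
    · have ha' : der k a = 0 := ha
      have e := ih 0 m a (der k b) (by omega) ha (by rwa [← Function.iterate_succ_apply])
      rw [show N = 0 + m by omega, ha', zero_mul, hz, zero_add, e]
      simp
    · have hb' : der k b = 0 := hb
      have e := ih n 0 (der k a) b (by omega) (by rwa [← Function.iterate_succ_apply]) hb
      rw [show N = n + 0 by omega, hb', mul_zero, hz, add_zero, e]
      simp
    · have e1 := ih n (m + 1) (der k a) b (by omega) (by rwa [← Function.iterate_succ_apply]) hb
      have e2 := ih (n + 1) m a (der k b) (by omega) ha (by rwa [← Function.iterate_succ_apply])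
      have hN1 : N = n + (m + 1) := by omega
      have hN2 : N = n + 1 + m := by omega
      rw [← hN1] at e1
      rw [← hN2] at e2
      rw [e1, e2, ← Function.iterate_succ_apply, ← Function.iterate_succ_apply, ← add_mul]
      congr 1
      rw [show n + 1 + (m + 1) = (n + (m + 1)) + 1 by omega, Nat.choose_succ_succ,
        ← hN1]
      push_cast
      rfl

instance : Nontrivial (UHeis k) := (poly_injective k).nontrivial

instance [CharZero k] : NoZeroDivisors (UHeis k) where
  eq_zero_or_eq_zero_of_mul_eq_zero := by
    intro a b hab
    by_contra! hcon
    obtain ⟨n, p, hp, ha, ha'⟩ := exists_der_iterate k hcon.1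
    obtain ⟨m, q, hq, hb, hb'⟩ := exists_der_iterate k hcon.2
    have := der_iterate_mul k _ n m a b rfl ha' hb'
    rw [hab, ha, hb, ← Module.End.coe_pow, map_zero, ← map_natCast (poly k), ← map_mul,
      ← map_mul, eq_comm, map_eq_zero_iff _ (poly_injective k)] at this
    have hc := Nat.choose_pos (Nat.le_add_right n m)
    refine mul_ne_zero ?_ (mul_ne_zero hp hq) this
    exact_mod_cast hc.ne'

end UHeis
end EnvelopingAlgebra

-- `U(H)` satisfies the left Ore condition, by polynomial growth.
section Ore

namespace UHeis

variable (k : Type u) [Field k]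

/-- The span of the words of length at most one in the generators. -/
def gen : Submodule k (UHeis k) := Submodule.span k {1, x k, y k}

/-- The span of the ordered monomials with exponents at most `n`. -/
def mons (n : ℕ) : Submodule k (UHeis k) :=
  Submodule.span k ((fun t : ℕ × ℕ × ℕ => x k ^ t.1 * y k ^ t.2.1 * z k ^ t.2.2) ''
    (Finset.range (n + 1) ×ˢ Finset.range (n + 1) ×ˢ Finset.range (n + 1) : Finset (ℕ × ℕ × ℕ)))

lemma monomial_mem_mons {n a b c : ℕ} (ha : a ≤ n) (hb : b ≤ n) (hc : c ≤ n) :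
    x k ^ a * y k ^ b * z k ^ c ∈ mons k n := by
  refine Submodule.subset_span ⟨(a, b, c), ?_, rfl⟩
  simp only [Finset.coe_product, Set.mem_prod, Finset.coe_range, Set.mem_Iio]
  omega

lemma mons_mul_gen (n : ℕ) : mons k n * gen k ≤ mons k (n + 1) := by
  rw [mons, gen, Submodule.span_mul_span, Submodule.span_le]
  rintro _ ⟨_, ⟨⟨a, b, c⟩, ht, rfl⟩, w, hw, rfl⟩
  simp only [Finset.coe_product, Set.mem_prod, Finset.coe_range, Set.mem_Iio] at ht
  obtain ⟨ha, hb, hc⟩ := ht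
  have hzx : z k ^ c * x k = x k * z k ^ c := ((comm_zx k).pow_left c).eq
  have hzy : z k ^ c * y k = y k * z k ^ c := ((comm_zy k).pow_left c).eq
  change x k ^ a * y k ^ b * z k ^ c * w ∈ mons k (n + 1)
  rcases hw with rfl | rfl | rfl
  · rw [mul_one]
    exact monomial_mem_mons k (by omega) (by omega) (by omega)
  · have : x k ^ a * y k ^ b * z k ^ c * x k = x k ^ (a + 1) * y k ^ b * z k ^ c
        + b • (x k ^ a * y k ^ (b - 1) * z k ^ (c + 1)) := by
      have h2 : z k * y k ^ (b - 1) = y k ^ (b - 1) * z k := ((comm_zy k).pow_right _).eq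
      rw [mul_assoc, hzx, ← mul_assoc, mul_assoc (x k ^ a), y_pow_mul_x, h2, mul_add, add_mul,
        nsmul_eq_mul, pow_succ, pow_succ']
      congr 1
      · simp only [mul_assoc]
      · rw [← mul_assoc (x k ^ a), ← Nat.cast_comm]
        simp only [mul_assoc]
    rw [this]
    exact add_mem (monomial_mem_mons k (by omega) (by omega) (by omega))
      (nsmul_mem (monomial_mem_mons k (by omega) (by omega) (by omega)) _)
  · rw [mul_assoc, hzy, ← mul_assoc, mul_assoc (x k ^ a), ← pow_succ]
    exact monomial_mem_mons k (by omega) (by omega) (by omega)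

lemma gen_pow_le (n : ℕ) : gen k ^ n ≤ mons k n := by
  induction n with
  | zero =>
    rw [pow_zero, Submodule.one_le]
    simpa using monomial_mem_mons k (le_refl 0) (le_refl 0) (le_refl 0)
  | succ n ih =>
    rw [pow_succ]
    exact (mul_le_mul_left ih _).trans (mons_mul_gen k n)

instance (n : ℕ) : FiniteDimensional k (mons k n) :=
  FiniteDimensional.span_of_finite k ((Finset.finite_toSet _).image _)

instance (n : ℕ) : FiniteDimensional k (gen k ^ n : Submodule k (UHeis k)) :=
  Submodule.finiteDimensional_of_le (gen_pow_le k n)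

lemma finrank_gen_pow_le (n : ℕ) :
    Module.finrank k (gen k ^ n : Submodule k (UHeis k)) ≤ (n + 1) ^ 3 := by
  classical
  refine (Submodule.finrank_mono (gen_pow_le k n)).trans ?_
  rw [mons, ← Finset.coe_image]
  refine (finrank_span_finset_le_card _).trans (Finset.card_image_le.trans ?_)
  simp only [Finset.card_product, Finset.card_range]
  exact le_of_eq (by ring)

lemma one_le_gen : (1 : Submodule k (UHeis k)) ≤ gen k := by
  rw [Submodule.one_le]
  exact Submodule.subset_span (by simp)

lemma gen_pow_mono {m n : ℕ} (h : m ≤ n) : gen k ^ m ≤ gen k ^ n :=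
  pow_le_pow_right' (one_le_gen k) h

lemma exists_mem_gen_pow (w : UHeis k) : ∃ n, w ∈ gen k ^ n := by
  let S : Subalgebra k (UHeis k) :=
    { carrier := {u | ∃ n, u ∈ gen k ^ n}
      mul_mem' := by
        rintro a b ⟨n, hn⟩ ⟨m, hm⟩
        exact ⟨n + m, by rw [pow_add]; exact Submodule.mul_mem_mul hn hm⟩
      add_mem' := by
        rintro a b ⟨n, hn⟩ ⟨m, hm⟩
        exact ⟨max n m, add_mem (gen_pow_mono k (le_max_left _ _) hn)
          (gen_pow_mono k (le_max_right _ _) hm)⟩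
      algebraMap_mem' := fun c => ⟨0, by
        rw [pow_zero]; exact Submodule.algebraMap_mem c⟩ }
  exact mem_of_gens k S ⟨1, by rw [pow_one]; exact Submodule.subset_span (by simp)⟩
    ⟨1, by rw [pow_one]; exact Submodule.subset_span (by simp)⟩ w

lemma exists_ore [CharZero k] {a s : UHeis k} (hs : s ≠ 0) :
    ∃ a' s' : UHeis k, s' ≠ 0 ∧ s' * a = a' * s := by
  by_contra! hcon
  have ha : a ≠ 0 := by
    rintro rfl
    exact hcon 0 1 one_ne_zero (by simp)
  obtain ⟨d, had, hsd⟩ : ∃ d, a ∈ gen k ^ d ∧ s ∈ gen k ^ d := by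
    obtain ⟨n, hn⟩ := exists_mem_gen_pow k a
    obtain ⟨m, hm⟩ := exists_mem_gen_pow k s
    exact ⟨max n m, gen_pow_mono k (le_max_left _ _) hn, gen_pow_mono k (le_max_right _ _) hm⟩
  have key : ∀ n, 2 ^ n ≤ Module.finrank k (gen k ^ (d * n) : Submodule k (UHeis k)) := by
    intro n
    induction n with
    | zero =>
      rw [pow_zero, Nat.one_le_iff_ne_zero, ← pos_iff_ne_zero, Module.finrank_pos_iff]
      exact ⟨⟨⟨1, by rw [mul_zero, pow_zero]; exact Submodule.one_le.1 le_rfl⟩, 0,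
        fun h => one_ne_zero (congrArg Subtype.val h)⟩⟩
    | succ n ih =>
      let W := (gen k ^ (d * n) : Submodule k (UHeis k))
      let W' := (gen k ^ (d * (n + 1)) : Submodule k (UHeis k))
      have hW : ∀ u ∈ W, ∀ v ∈ gen k ^ d, u * v ∈ W' := by
        intro u hu v hv
        change _ ∈ gen k ^ (d * (n + 1))
        rw [mul_add, mul_one, pow_add]
        exact Submodule.mul_mem_mul hu hv
      let F : (W × W) →ₗ[k] W' :=
        LinearMap.codRestrict W'
          (((LinearMap.mulRight k a).comp W.subtype).coprod ((LinearMap.mulRight k s).comp W.subtype))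
          (fun p => add_mem (hW _ p.1.2 _ had) (hW _ p.2.2 _ hsd))
      have hF : Function.Injective F := by
        rw [injective_iff_map_eq_zero]
        rintro ⟨p, q⟩ h
        have h' : (p : UHeis k) * a + q * s = 0 := congrArg Subtype.val h
        have hp : (p : UHeis k) = 0 := by
          by_contra hp
          exact hcon (-q) p hp (by rw [neg_mul]; exact eq_neg_of_add_eq_zero_left h')
        rw [hp, zero_mul, zero_add] at h'
        have hq : (q : UHeis k) = 0 := (mul_eq_zero.1 h').resolve_right hs
        exact Prod.ext (Subtype.ext hp) (Subtype.ext hq)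
      have := LinearMap.finrank_le_finrank_of_injective hF
      rw [Module.finrank_prod] at this
      rw [pow_succ]
      change 2 ^ n ≤ Module.finrank k W at ih
      change _ ≤ Module.finrank k W'
      omega
  have h1 : ∀ n : ℕ, (2 : ℝ) ^ n ≤ ((d + 1 : ℕ) : ℝ) ^ 3 * ((n : ℝ) + 1) ^ 3 := by
    intro n
    have := (key n).trans (finrank_gen_pow_le k (d * n))
    have h2 : (d * n + 1) ^ 3 ≤ (d + 1) ^ 3 * (n + 1) ^ 3 := by
      rw [← mul_pow]
      exact Nat.pow_le_pow_left (by nlinarith) 3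
    exact_mod_cast this.trans h2
  have h3 := (isLittleO_pow_const_const_pow_of_one_lt (R := ℝ) 3 (r := 2) (by norm_num))
  have hpos : (0 : ℝ) < (16 * ((d + 1 : ℕ) : ℝ) ^ 3)⁻¹ := by positivity
  obtain ⟨n, hn1, hn⟩ := ((Filter.eventually_ge_atTop 1).and (h3.def hpos)).exists
  have h4 := h1 n
  have hn1' : (1 : ℝ) ≤ n := by exact_mod_cast hn1
  have h5 : ((n : ℝ) + 1) ^ 3 ≤ 8 * (n : ℝ) ^ 3 := by
    calc ((n : ℝ) + 1) ^ 3 ≤ (2 * (n : ℝ)) ^ 3 := by gcongr; linarith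
      _ = _ := by ring
  rw [Real.norm_of_nonneg (by positivity), Real.norm_of_nonneg (by positivity),
    inv_mul_eq_div, le_div_iff₀ (by positivity)] at hn
  have h6 : (0 : ℝ) < 2 ^ n := by positivity
  nlinarith [mul_le_mul_of_nonneg_left h5 (by positivity : (0 : ℝ) ≤ ((d + 1 : ℕ) : ℝ) ^ 3)]

instance [CharZero k] : OreLocalization.OreSet (nonZeroDivisors (UHeis k)) :=
  Classical.choice (OreLocalization.nonempty_oreSet_iff_of_noZeroDivisors.2 fun r s => by
    obtain ⟨a', s', hs', h⟩ := exists_ore k (a := r) (nonZeroDivisors.ne_zero s.2)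
    exact ⟨a', ⟨s', mem_nonZeroDivisors_of_ne_zero hs'⟩, h⟩)

end UHeis
end Ore

section Involutions

attribute [local instance 100] LieRing.ofAssociativeRing

/-- A `k`-involution of a Lie `k`-algebra. -/
structure LieInvolution (k L : Type*) [Field k] [LieRing L] [LieAlgebra k L] extends
    L →ₗ[k] L where
  map_lie' : ∀ a b, toFun ⁅a, b⁆ = ⁅toFun b, toFun a⁆
  involutive' : ∀ a, toFun (toFun a) = a

/-- A `k`-involution of an associative `k`-algebra. -/
structure AlgInvolution (k A : Type*) [Field k] [Ring A] [Algebra k A] extends A →ₗ[k] A where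
  map_mul' : ∀ a b, toFun (a * b) = toFun b * toFun a
  involutive' : ∀ a, toFun (toFun a) = a

instance (k L : Type*) [Field k] [LieRing L] [LieAlgebra k L] :
    CoeFun (LieInvolution k L) (fun _ => L → L) := ⟨fun η => η.toFun⟩

instance (k A : Type*) [Field k] [Ring A] [Algebra k A] :
    CoeFun (AlgInvolution k A) (fun _ => A → A) := ⟨fun τ => τ.toFun⟩

/-- An element is symmetric for an involution if the involution fixes it. -/
def AlgInvolution.IsSymmetric {k A : Type*} [Field k] [Ring A] [Algebra k A]
    (τ : AlgInvolution k A) (a : A) : Prop := τ a = a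

namespace Heis

variable {k : Type u} [Field k]

def negSign (ε δ : k) : Heis k →ₗ⁅k⁆ Heis k :=
  lift (-(ε • x k)) (-(δ • y k))
    (by
      have h := lie_z_x k
      rw [z] at h
      simp only [lie_neg, neg_lie, lie_smul, smul_lie, h, smul_zero, neg_zero])
    (by
      have h := lie_z_y k
      rw [z] at h
      simp only [lie_neg, neg_lie, lie_smul, smul_lie, h, smul_zero, neg_zero])

/-- The involution `x ↦ εx`, `y ↦ δy`, for signs `ε`, `δ`. -/
def signInvolution (ε δ : k) (hε : ε * ε = 1) (hδ : δ * δ = 1) : LieInvolution k (Heis k) where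
  toLinearMap := -(negSign ε δ : Heis k →ₗ[k] Heis k)
  map_lie' a b := by
    change -(negSign ε δ ⁅a, b⁆) = ⁅-negSign ε δ b, -negSign ε δ a⁆
    rw [LieHom.map_lie, neg_lie, lie_neg, neg_neg, lie_skew]
  involutive' a := by
    change -(negSign ε δ (-negSign ε δ a)) = a
    have h : (negSign ε δ).comp (negSign ε δ) = LieHom.id := by
      apply hom_ext
      · simp [negSign, smul_smul, hε]
      · simp [negSign, smul_smul, hδ]
    rw [map_neg, neg_neg]
    exact LieHom.congr_fun h a

lemma signInvolution_x (ε δ : k) (hε : ε * ε = 1) (hδ : δ * δ = 1) :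
    signInvolution ε δ hε hδ (x k) = ε • x k := by
  change -(negSign ε δ (x k)) = _
  simp [negSign]

lemma signInvolution_y (ε δ : k) (hε : ε * ε = 1) (hδ : δ * δ = 1) :
    signInvolution ε δ hε hδ (y k) = δ • y k := by
  change -(negSign ε δ (y k)) = _
  simp [negSign]

variable (k)

/-- The involution `x ↦ x`, `y ↦ -y` (hence `z ↦ z`). -/
def involutionPosNeg : LieInvolution k (Heis k) := signInvolution 1 (-1) (by simp) (by simp)

/-- The involution `x ↦ x`, `y ↦ y` (hence `z ↦ -z`). -/
def involutionPosPos : LieInvolution k (Heis k) := signInvolution 1 1 (by simp) (by simp)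

/-- The principal involution `h ↦ -h`. -/
def involutionNegNeg : LieInvolution k (Heis k) where
  toLinearMap := -LinearMap.id
  map_lie' a b := by
    change -⁅a, b⁆ = ⁅-b, -a⁆
    rw [neg_lie, lie_neg, neg_neg, lie_skew]
  involutive' a := neg_neg a

lemma involutionPosNeg_apply : involutionPosNeg k (x k) = x k ∧
    involutionPosNeg k (y k) = -y k ∧ involutionPosNeg k (z k) = z k := by
  have hx : involutionPosNeg k (x k) = x k := (signInvolution_x _ _ _ _).trans (one_smul _ _)
  have hy : involutionPosNeg k (y k) = -y k :=
    (signInvolution_y _ _ _ _).trans (by rw [neg_smul, one_smul])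
  exact ⟨hx, hy, ((involutionPosNeg k).map_lie' _ _).trans
    (by rw [hx, hy, lie_neg, lie_skew, z])⟩

lemma involutionPosPos_apply : involutionPosPos k (x k) = x k ∧
    involutionPosPos k (y k) = y k ∧ involutionPosPos k (z k) = -z k := by
  have hx : involutionPosPos k (x k) = x k := (signInvolution_x _ _ _ _).trans (one_smul _ _)
  have hy : involutionPosPos k (y k) = y k := (signInvolution_y _ _ _ _).trans (one_smul _ _)
  exact ⟨hx, hy, ((involutionPosPos k).map_lie' _ _).trans
    (by rw [hx, hy, z, lie_skew])⟩

end Heis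

section Extension

variable {k L : Type*} [Field k] [LieRing L] [LieAlgebra k L] (η : LieInvolution k L)

def LieInvolution.opLieHom : L →ₗ⁅k⁆ (UniversalEnvelopingAlgebra k L)ᵐᵒᵖ where
  toFun a := MulOpposite.op (UniversalEnvelopingAlgebra.ι k (η a))
  map_add' a b := congrArg MulOpposite.op
    ((congrArg (UniversalEnvelopingAlgebra.ι k) (η.map_add' a b)).trans (map_add _ _ _))
  map_smul' c a := congrArg MulOpposite.op
    ((congrArg (UniversalEnvelopingAlgebra.ι k) (η.map_smul' c a)).trans (map_smul _ _ _))
  map_lie' := by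
    intro a b
    change MulOpposite.op (UniversalEnvelopingAlgebra.ι k (η ⁅a, b⁆)) =
      ⁅MulOpposite.op (UniversalEnvelopingAlgebra.ι k (η a)),
        MulOpposite.op (UniversalEnvelopingAlgebra.ι k (η b))⁆
    rw [η.map_lie', LieHom.map_lie, LieRing.of_associative_ring_bracket,
      LieRing.of_associative_ring_bracket]
    rfl

def LieInvolution.opAlgHom :
    UniversalEnvelopingAlgebra k L →ₐ[k] (UniversalEnvelopingAlgebra k L)ᵐᵒᵖ :=
  UniversalEnvelopingAlgebra.lift k η.opLieHom

lemma LieInvolution.opAlgHom_ι (a : L) : η.opAlgHom (UniversalEnvelopingAlgebra.ι k a) =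
    MulOpposite.op (UniversalEnvelopingAlgebra.ι k (η a)) :=
  UniversalEnvelopingAlgebra.lift_ι_apply k η.opLieHom a

/-- The extension of a `k`-involution of a Lie `k`-algebra to its universal enveloping algebra. -/
def LieInvolution.toEnveloping : AlgInvolution k (UniversalEnvelopingAlgebra k L) where
  toFun u := (η.opAlgHom u).unop
  map_add' a b := congrArg MulOpposite.unop (map_add η.opAlgHom a b)
  map_smul' c a := congrArg MulOpposite.unop (map_smul η.opAlgHom c a)
  map_mul' a b := congrArg MulOpposite.unop (map_mul η.opAlgHom a b)
  involutive' a := by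
    have h : (AlgHom.opComm η.opAlgHom).comp η.opAlgHom = AlgHom.id k _ := by
      apply UniversalEnvelopingAlgebra.hom_ext
      ext a
      change (AlgHom.opComm η.opAlgHom) (η.opAlgHom (UniversalEnvelopingAlgebra.ι k a)) =
        UniversalEnvelopingAlgebra.ι k a
      rw [η.opAlgHom_ι]
      change (η.opAlgHom (UniversalEnvelopingAlgebra.ι k (η a))).unop = _
      rw [η.opAlgHom_ι, η.involutive']
      rfl
    exact AlgHom.congr_fun h a

lemma LieInvolution.toEnveloping_ι (a : L) :
    η.toEnveloping (UniversalEnvelopingAlgebra.ι k a) = UniversalEnvelopingAlgebra.ι k (η a) :=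
  congrArg MulOpposite.unop (η.opAlgHom_ι a)

open nonZeroDivisors OreLocalization

variable {R : Type*} [Ring R] [Algebra k R] (τ : AlgInvolution k R)

lemma AlgInvolution.map_one' : τ 1 = 1 := by
  have h := τ.map_mul' (τ 1) 1
  rw [mul_one, τ.involutive', mul_one] at h
  exact h.symm

variable [Nontrivial R] [OreSet R⁰]

def AlgInvolution.opRingHom : R →+* (OreLocalization R⁰ R)ᵐᵒᵖ where
  toFun r := MulOpposite.op (numeratorRingHom (τ r))
  map_one' := by rw [τ.map_one', map_one]; rfl
  map_mul' a b := by rw [τ.map_mul', map_mul]; rfl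
  map_zero' := by
    have : τ 0 = 0 := map_zero τ.toLinearMap
    rw [this, map_zero]; rfl
  map_add' a b := by
    have : τ (a + b) = τ a + τ b := map_add τ.toLinearMap a b
    rw [this, map_add]; rfl

lemma AlgInvolution.opRingHom_ne_zero (s : R⁰) : τ.opRingHom s ≠ 0 := by
  intro h
  have h1 : numeratorHom (S := R⁰) (τ (s : R)) = numeratorHom 0 :=
    (congrArg MulOpposite.unop h).trans (map_zero (numeratorRingHom (R := R) (S := R⁰))).symm
  have h2 := numeratorHom_inj (R := R) (S := R⁰) inf_le_left h1
  have h3 : (s : R) = 0 := by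
    rw [← τ.involutive' s, show τ.toFun (s : R) = 0 from h2]
    exact map_zero τ.toLinearMap
  exact nonZeroDivisors.ne_zero s.2 h3

variable [NoZeroDivisors R]

def AlgInvolution.oreRingHom : OreLocalization R⁰ R →+* (OreLocalization R⁰ R)ᵐᵒᵖ :=
  universalHom τ.opRingHom
    { toFun := fun s => Units.mk0 _ (τ.opRingHom_ne_zero s)
      map_one' := Units.ext τ.opRingHom.map_one
      map_mul' := fun a b => Units.ext (τ.opRingHom.map_mul a b) }
    (fun _ => rfl)

lemma AlgInvolution.oreRingHom_numerator (r : R) :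
    τ.oreRingHom (numeratorRingHom r) = MulOpposite.op (numeratorRingHom (τ r)) :=
  universalHom_commutes _ _ _

lemma ore_ringHom_ext {T : Type*} [DivisionRing T] {f g : OreLocalization R⁰ R →+* T}
    (h : ∀ r, f (numeratorRingHom r) = g (numeratorRingHom r)) : f = g := by
  let F : R →+* T := g.comp numeratorRingHom
  have hF : ∀ s : R⁰, F s ≠ 0 := by
    intro s hs
    have h1 : numeratorHom (S := R⁰) (s : R) = numeratorHom 0 :=
      (g.injective (hs.trans (map_zero g).symm)).trans
        (map_zero (numeratorRingHom (R := R) (S := R⁰))).symm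
    exact nonZeroDivisors.ne_zero s.2 (numeratorHom_inj (R := R) (S := R⁰) inf_le_left h1)
  let fS : R⁰ →* Tˣ :=
    { toFun := fun s => Units.mk0 _ (hF s)
      map_one' := Units.ext F.map_one
      map_mul' := fun a b => Units.ext (F.map_mul a b) }
  exact (universalHom_unique F fS (fun _ => rfl) f h).trans
    (universalHom_unique F fS (fun _ => rfl) g (fun _ => rfl)).symm

/-- The extension of a `k`-involution of an Ore domain to its division ring of fractions. -/
def AlgInvolution.toOre : AlgInvolution k (OreLocalization R⁰ R) where
  toFun d := (τ.oreRingHom d).unop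
  map_add' a b := congrArg MulOpposite.unop (map_add τ.oreRingHom a b)
  map_mul' a b := congrArg MulOpposite.unop (map_mul τ.oreRingHom a b)
  map_smul' c a := by
    have h : τ.oreRingHom (algebraMap k _ c) = MulOpposite.op (algebraMap k _ c) := by
      have h1 : τ (algebraMap k R c) = algebraMap k R c := by
        have : τ (c • (1 : R)) = c • τ 1 := map_smul τ.toLinearMap c 1
        rw [Algebra.algebraMap_eq_smul_one, this, τ.map_one']
      have := τ.oreRingHom_numerator (algebraMap k R c)
      rw [h1] at this
      exact this
    rw [Algebra.smul_def, map_mul, h, RingHom.id_apply, Algebra.smul_def, Algebra.commutes]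
    rfl
  involutive' a := by
    let g : OreLocalization R⁰ R →+* OreLocalization R⁰ R :=
      { toFun := fun d => (τ.oreRingHom (τ.oreRingHom d).unop).unop
        map_one' := by simp only [map_one, MulOpposite.unop_one]
        map_zero' := by simp only [map_zero, MulOpposite.unop_zero]
        map_add' := fun c d => by simp only [map_add, MulOpposite.unop_add]
        map_mul' := fun c d => by simp only [map_mul, MulOpposite.unop_mul] }
    have h : g = RingHom.id _ := by
      apply ore_ringHom_ext
      intro r
      change (τ.oreRingHom (τ.oreRingHom (numeratorRingHom r)).unop).unop = _
      rw [τ.oreRingHom_numerator]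
      change (τ.oreRingHom (numeratorRingHom (τ r))).unop = _
      rw [τ.oreRingHom_numerator, τ.involutive']
      rfl
    exact RingHom.congr_fun h a

lemma AlgInvolution.toOre_numerator (r : R) :
    τ.toOre (numeratorRingHom r) = numeratorRingHom (τ r) :=
  congrArg MulOpposite.unop (τ.oreRingHom_numerator r)

end Extension

end Involutions

section Elements

open nonZeroDivisors OreLocalization

/-- The Ore division ring of fractions of the enveloping algebra of the Heisenberg algebra. -/
abbrev DHeis (k : Type u) [Field k] [CharZero k] : Type u :=
  OreLocalization (UHeis k)⁰ (UHeis k)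

/-- The extension of a `k`-involution from `H` to `U(H)` and then to the division ring. -/
def DHeis.extend {k : Type u} [Field k] [CharZero k] (η : LieInvolution k (Heis k)) :
    AlgInvolution k (DHeis k) := η.toEnveloping.toOre

namespace DHeis

variable (k : Type u) [Field k] [CharZero k]

def x : DHeis k := numeratorRingHom (UHeis.x k)
def y : DHeis k := numeratorRingHom (UHeis.y k)
def z : DHeis k := numeratorRingHom (UHeis.z k)

/-- `½(xy + yx)` -/
def V : DHeis k := (1 / 2 : k) • (x k * y k + y k * x k)

/-- `V - z/3` -/
def Vm : DHeis k := V k - (1 / 3 : k) • z k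
/-- `V + z/3` -/
def Vp : DHeis k := V k + (1 / 3 : k) • z k

def S : DHeis k := Vm k * (Vp k)⁻¹

def S₁ : DHeis k := (z k)⁻¹ * (Vm k * (Vp k)⁻¹ + (Vm k)⁻¹ * Vp k) * (z k)⁻¹

def S₂ : DHeis k := z k * (Vm k * (Vp k)⁻¹ + (Vm k)⁻¹ * Vp k) * z k

def T : DHeis k :=
  (z k + y k ^ 2)⁻¹ * (z k - y k ^ 2) * S k * (z k + y k ^ 2) * (z k - y k ^ 2)⁻¹

def T₁ : DHeis k :=
  (z k + y k ^ 2)⁻¹ * (z k - y k ^ 2) * S₁ k * (z k + y k ^ 2) * (z k - y k ^ 2)⁻¹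

def T₂ : DHeis k :=
  (z k ^ 2 + y k ^ 3)⁻¹ * (z k ^ 2 - y k ^ 3) * S₁ k * (z k ^ 2 + y k ^ 3) *
    (z k ^ 2 - y k ^ 3)⁻¹

def T₃ : DHeis k :=
  (z k + y k ^ 2)⁻¹ * (z k - y k ^ 2) * S₂ k * (z k + y k ^ 2) * (z k - y k ^ 2)⁻¹

def T₄ : DHeis k :=
  (z k ^ 2 + y k ^ 3)⁻¹ * (z k ^ 2 - y k ^ 3) * S₂ k * (z k ^ 2 + y k ^ 3) *
    (z k ^ 2 - y k ^ 3)⁻¹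

end DHeis

/-- The `k`-subalgebra generated by `a`, `b` is the free `k`-algebra on `{a, b}`
(with `a`, `b` distinct). -/
def IsFreeAlgebraOn (k : Type*) {D : Type*} [Field k] [Ring D] [Algebra k D] (a b : D) : Prop :=
  ∃ e : FreeAlgebra k (Fin 2) ≃ₐ[k] Algebra.adjoin k ({a, b} : Set D),
    (e (FreeAlgebra.ι k 0) : D) = a ∧ (e (FreeAlgebra.ι k 1) : D) = b

/-- The `k`-subalgebra generated by `a`, `a⁻¹`, `b`, `b⁻¹` is the free group `k`-algebra on
`{a, b}` (with `a`, `b` distinct). -/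
def IsFreeGroupAlgebraOn (k : Type*) {D : Type*} [Field k] [DivisionRing D] [Algebra k D]
    (a b : D) : Prop :=
  ∃ e : MonoidAlgebra k (FreeGroup (Fin 2)) ≃ₐ[k]
      Algebra.adjoin k ({a, a⁻¹, b, b⁻¹} : Set D),
    (e (MonoidAlgebra.of k (FreeGroup (Fin 2)) (FreeGroup.of 0)) : D) = a ∧
    (e (MonoidAlgebra.of k (FreeGroup (Fin 2)) (FreeGroup.of 1)) : D) = b

end Elements

end

/-! Put `t = V z⁻¹`. Then `y t = (t + 1) y`, and `z` and `t` generate a copy of the field `K = k(z,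
t)` in the division ring. For `Z` equal to `z` or `z²`, and `m` equal to 2 or 3, the element `c =
-Z⁻¹ y^m` satisfies `c a = σ(a) c` for `a` in `K`, where `σ` is the shift `t ↦ t + m`. Its Cayley
transform `u = (1 + c)⁻¹ (1 - c)` equals `(Z - y^m)⁻¹ (Z + y^m)`. Hence every pair in the theorem
comes from a pair `f`, `u⁻¹ f u` with `f` in `K`.

An element of the free group maps to a power of `f` times an alternating word `u⁻¹ f^{n₁} u f^{n₂} ⋯
u f^n`, so it suffices to show that such words are independent over `K`; this is done modulo
polynomials in `c`. Clearing the leading denominator, `(1 ± c) u^{±1} = 1 ∓ c`, shortens a word.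
Applied to a relation normalised to have one longest coefficient equal to 1, it removes that word,
so by induction the new relation is trivial. All longest coefficients are then fixed by `σ`, and the
next coefficients say that a combination `w` of powers of `f` with `σ`-fixed coefficients has the
form `p + σ p` (`eq_zero_of_linearCombination_cayleyWord_mem`). Freeness thus reduces to one
condition on `f`: such a `w` involves no nonzero power of `f`.

That condition is about poles. On an orbit of points `t = α + m j`, an element `p + σ p` cannot have
exactly one pole, because poles of `p` propagate along the orbit and `p` has finitely many. So the
condition holds if `f` has a pole alone on an orbit free of zeros, and a zero alone on an orbit free
of poles (`eq_zero_of_sum_zpow_eq_add_map`). For `S` these are `t = -1/3` and `t = 1/3`, whose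
difference `2/3` is not an integer. For `1 + S₁`, `1 + S₁²` and `1 + S₂²` the pole is `t = 1/3` and
the zero is a point transcendental over `k`.

The free algebra statements follow, since `a`, `b` generate a free algebra as soon as `1 + a`, `1 +
b` generate a free group algebra. Symmetry holds because each involution exchanges `V - z/3` with `V
+ z/3`, and the two conjugating factors with each other, up to sign. -/

noncomputable section

/-! ### Alternating words in a Cayley transform, modulo skew polynomials -/

section CayleyWords

variable {K D : Type*} [Field K] [DivisionRing D] [Module K D]

/-- The Cayley transform `(1 + c)⁻¹ (1 - c)`. -/
def cayley (c : D) : D := (1 + c)⁻¹ * (1 - c)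

/-- The alternating product `u^{±1} f^{n₁} u^{∓1} f^{n₂} ⋯` of powers of `f` and of the Cayley
transform `u` of `c`; the rightmost factor is `u f^n`. -/
def cayleyWord (c : D) (f : K) : List ℤ → D
  | [] => 1
  | n :: l => cayley ((-1 : K) ^ l.length • c) * (f ^ n • cayleyWord c f l)

/-- All the entries but the last one are nonzero. -/
def IsReducedList : List ℤ → Prop
  | [] => True
  | [_] => True
  | n :: m :: l => n ≠ 0 ∧ IsReducedList (m :: l)

lemma IsReducedList.tail {n : ℤ} {l : List ℤ} (h : IsReducedList (n :: l)) :
    IsReducedList l := by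
  cases l with
  | nil => trivial
  | cons m l => exact h.2

lemma IsReducedList.of_suffix {l l' : List ℤ} (h : IsReducedList l') (hl : l <:+ l') :
    IsReducedList l := by
  induction l' with
  | nil => rw [List.suffix_nil.1 hl]; trivial
  | cons n l' ih =>
    rcases List.suffix_cons_iff.1 hl with rfl | hl
    · exact h
    · exact ih h.tail hl

/-- The polynomials in `c` with coefficients in `K`. -/
def skewPolys (K : Type*) {D : Type*} [Field K] [DivisionRing D] [Module K D] (c : D) :
    Submodule K D := Submodule.span K (Set.range fun i : ℕ => c ^ i)

lemma pow_mem_skewPolys (c : D) (i : ℕ) : c ^ i ∈ skewPolys K c :=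
  Submodule.subset_span ⟨i, rfl⟩

variable (σ : K →+* K) (c : D) (f : K)

/-- The coefficients of `c * w`, for a word `w`, modulo polynomials in `c`. -/
def mulCoeffs : List ℤ → (List ℤ →₀ K)
  | [] => 0
  | n :: l => Finsupp.single (n :: l) (-(-1) ^ l.length) +
      (if l = [] then 0 else Finsupp.single l ((-1) ^ l.length * f ^ n)) -
      σ (f ^ n) • mulCoeffs l

/-- Each term of the recursion is the word itself or comes from its tail. Left multiplication by `c`
therefore never lengthens a word and, by `IsReducedList.of_suffix`, preserves reducedness. -/
lemma suffix_of_mulCoeffs_ne_zero {l m : List ℤ} (h : mulCoeffs σ f l m ≠ 0) :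
    m <:+ l ∧ m ≠ [] := by
  induction l with
  | nil => simp [mulCoeffs] at h
  | cons n l ih =>
    by_contra hcon
    apply h
    have h1 : mulCoeffs σ f l m = 0 := by
      by_contra h1
      exact hcon ⟨(ih h1).1.trans (List.suffix_cons _ _), (ih h1).2⟩
    have h2 : n :: l ≠ m := by
      rintro rfl
      exact hcon ⟨List.suffix_rfl, by simp⟩
    rw [mulCoeffs, Finsupp.sub_apply, Finsupp.add_apply, Finsupp.smul_apply, h1,
      Finsupp.single_eq_of_ne' h2]
    split_ifs with h3
    · simp
    · have h4 : l ≠ m := by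
        rintro rfl
        exact hcon ⟨List.suffix_cons _ _, h3⟩
      rw [Finsupp.single_eq_of_ne' h4]
      simp

lemma mulCoeffs_self (n : ℤ) (l : List ℤ) :
    mulCoeffs σ f (n :: l) (n :: l) = -(-1) ^ l.length := by
  have h1 : mulCoeffs σ f l (n :: l) = 0 := by
    by_contra h
    simpa using (suffix_of_mulCoeffs_ne_zero σ f h).1.length_le
  rw [mulCoeffs, Finsupp.sub_apply, Finsupp.add_apply, Finsupp.smul_apply, h1]
  split_ifs with h3
  · simp
  · rw [Finsupp.single_eq_same, Finsupp.single_eq_of_ne (by simp)]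
    simp

/-- Two terms meet on the tail: the explicit `f ^ n`, and `σ (f ^ n)` times the diagonal coefficient
of the tail. The diagonal sign alternates with the length, which produces the difference `f ^ n - σ
(f ^ n)`. -/
lemma mulCoeffs_tail (n m : ℤ) (l : List ℤ) :
    mulCoeffs σ f (n :: m :: l) (m :: l) = -(-1) ^ l.length * (f ^ n - σ (f ^ n)) := by
  rw [mulCoeffs, Finsupp.sub_apply, Finsupp.add_apply, Finsupp.smul_apply, mulCoeffs_self,
    Finsupp.single_eq_of_ne (by simp), if_neg (by simp), Finsupp.single_eq_same]
  simp only [List.length_cons, pow_succ, smul_eq_mul]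
  ring

variable {σ c f}
variable (hc : ∀ (a : K) (d : D), c * (a • d) = σ a • (c * d))

include hc in
lemma mul_mem_skewPolys {d : D} (hd : d ∈ skewPolys K c) : c * d ∈ skewPolys K c := by
  induction hd using Submodule.span_induction with
  | mem x hx =>
    obtain ⟨i, rfl⟩ := hx
    exact pow_succ' c i ▸ pow_mem_skewPolys c (i + 1)
  | zero => rw [mul_zero]; exact zero_mem _
  | add x y _ _ hx hy => rw [mul_add]; exact add_mem hx hy
  | smul a x _ hx => rw [hc]; exact Submodule.smul_mem _ _ hx

lemma one_add_smul_mul_cayleyWord (h : ∀ s : K, s * s = 1 → 1 + s • c ≠ 0)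
    (n : ℤ) (l : List ℤ) :
    (1 + (-1 : K) ^ l.length • c) * cayleyWord c f (n :: l) =
      (1 - (-1 : K) ^ l.length • c) * (f ^ n • cayleyWord c f l) := by
  have h1 : 1 + (-1 : K) ^ l.length • c ≠ 0 := h _ (by rw [← mul_pow]; simp)
  rw [cayleyWord, cayley, ← mul_assoc, mul_inv_cancel_left₀ h1]

include hc in
lemma pow_mul_smul (i : ℕ) (a : K) (d : D) : c ^ i * (a • d) = σ^[i] a • (c ^ i * d) := by
  induction i generalizing a with
  | zero => simp
  | succ i ih => rw [pow_succ', mul_assoc, ih, hc, Function.iterate_succ_apply', mul_assoc]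

variable [IsScalarTower K D D]

include hc in
-- With `e = (-1) ^ l.length`, this is `(1 + e c) w = (1 - e c) f ^ n w'` solved for `c w` using `e²
-- = 1`; `σ` appears when `c` moves past `f ^ n`. It is the recursion that `mulCoeffs` encodes.
lemma mul_cayleyWord_cons (h : ∀ s : K, s * s = 1 → 1 + s • c ≠ 0) (n : ℤ) (l : List ℤ) :
    c * cayleyWord c f (n :: l) = (-(-1 : K) ^ l.length) • cayleyWord c f (n :: l) +
      ((-1 : K) ^ l.length * f ^ n) • cayleyWord c f l - σ (f ^ n) • (c * cayleyWord c f l) := by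
  have h1 := one_add_smul_mul_cayleyWord (f := f) h n l
  have h2 : (-1 : K) ^ l.length * (-1) ^ l.length = 1 := by rw [← mul_pow]; simp
  generalize (-1 : K) ^ l.length = e at *
  rw [add_mul, one_mul, sub_mul, one_mul, smul_mul_assoc, smul_mul_assoc, hc] at h1
  have h3 := congrArg (fun d => e • d) h1
  simp only [smul_add, smul_sub, smul_smul, h2, one_smul] at h3
  rw [← mul_assoc, h2, one_mul] at h3
  rw [neg_smul, eq_sub_iff_add_eq'.2 h3]
  abel

include hc in
lemma mul_cayleyWord_sub_mem (h : ∀ s : K, s * s = 1 → 1 + s • c ≠ 0) (l : List ℤ) :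
    c * cayleyWord c f l - Finsupp.linearCombination K (cayleyWord c f) (mulCoeffs σ f l) ∈
      skewPolys K c := by
  induction l with
  | nil => simpa [mulCoeffs, cayleyWord] using pow_mem_skewPolys (K := K) c 1
  | cons n l ih =>
    rw [mul_cayleyWord_cons hc h, mulCoeffs, map_sub, map_add, map_smul,
      Finsupp.linearCombination_single]
    have h1 : ((-1 : K) ^ l.length * f ^ n) • cayleyWord c f l -
        Finsupp.linearCombination K (cayleyWord c f) (if l = [] then 0
          else Finsupp.single l ((-1 : K) ^ l.length * f ^ n)) ∈ skewPolys K c := by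
      split_ifs with hl
      · subst hl
        simpa [cayleyWord] using
          Submodule.smul_mem _ (f ^ n) (pow_mem_skewPolys (K := K) c 0)
      · rw [Finsupp.linearCombination_single, sub_self]
        exact zero_mem _
    convert sub_mem h1 (Submodule.smul_mem _ (σ (f ^ n)) ih) using 1
    rw [smul_sub]
    abel

include hc in
/-- The powers of `c` are linearly independent if `σ` has an infinite orbit. -/
lemma linearIndependent_pow_of_semilinear (h0 : c ≠ 0) {t : K}
    (ht : Function.Injective fun i : ℕ => σ^[i] t) :
    LinearIndependent K fun i : ℕ => c ^ i := by
  have key : ∀ N : ℕ, ∀ a : ℕ → K, ∑ i ∈ Finset.range N, a i • c ^ i = 0 →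
      ∀ i < N, a i = 0 := by
    intro N
    induction N with
    | zero => intro a _ i hi; omega
    | succ N ih =>
      intro a ha
      -- Right multiplication by `t` scales the `i`-th term by `σ^[i] t`; subtracting `σ^[N] t`
      -- times the relation then removes the top term.
      have h1 : ∑ i ∈ Finset.range (N + 1), (a i * σ^[i] t) • c ^ i = 0 := by
        have := congrArg (fun d => d * (t • (1 : D))) ha
        simp only [Finset.sum_mul, smul_mul_assoc, pow_mul_smul hc, mul_one, smul_smul,
          zero_mul] at this
        exact this
      have h2 : ∑ i ∈ Finset.range N, (a i * (σ^[i] t - σ^[N] t)) • c ^ i = 0 := by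
        have h3 := congrArg (fun d => σ^[N] t • d) ha
        simp only [smul_zero, Finset.smul_sum, smul_smul] at h3
        have h4 := sub_eq_zero.2 (h1.trans h3.symm)
        rw [← Finset.sum_sub_distrib, Finset.sum_range_succ, mul_comm (σ^[N] t), sub_self,
          add_zero] at h4
        rw [← h4]
        refine Finset.sum_congr rfl fun i _ => ?_
        rw [← sub_smul]
        congr 1
        ring
      have h5 : ∀ i < N, a i = 0 := by
        intro i hi
        refine (mul_eq_zero.1 (ih _ h2 i hi)).resolve_right ?_
        exact fun h => hi.ne (ht (sub_eq_zero.1 h))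
      intro i hi
      rcases Nat.lt_succ_iff_lt_or_eq.1 hi with hi | rfl
      · exact h5 i hi
      · rw [Finset.sum_range_succ, Finset.sum_eq_zero, zero_add] at ha
        · exact (smul_eq_zero.1 ha).resolve_right (pow_ne_zero _ h0)
        · intro j hj
          rw [h5 j (Finset.mem_range.1 hj), zero_smul]
  rw [linearIndependent_iff']
  intro s a ha i hi
  classical
  obtain ⟨N, hN⟩ : ∃ N, s ⊆ Finset.range N := s.exists_nat_subset_range
  have h1 := key N (fun j => if j ∈ s then a j else 0) (by
    rw [← ha, ← Finset.sum_subset hN]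
    · exact Finset.sum_congr rfl fun j hj => by simp [hj]
    · intro j _ hj
      simp [hj]) i (Finset.mem_range.1 (hN hi))
  simpa [hi] using h1

omit [IsScalarTower K D D] in
include hc in
-- If `d` is a nonzero polynomial in `c`, the coefficient of `(1 + c) d` one degree above the top of
-- `d` is `σ` of the leading coefficient, hence nonzero. A constant product thus forces `d = 0`.
lemma eq_zero_of_one_add_mul_eq_smul_one (h : LinearIndependent K fun i : ℕ => c ^ i) {d : D}
    (hd : d ∈ skewPolys K c) {w : K} (hw : (1 + c) * d = w • (1 : D)) : w = 0 := by
  obtain ⟨a, rfl⟩ := (Finsupp.mem_span_range_iff_exists_finsupp.1 hd)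
  -- The coefficients of `c * d`: those of `d` moved up by one degree, with `σ` applied.
  let b : ℕ →₀ K := (a.mapRange σ (map_zero σ)).embDomain ⟨Nat.succ, Nat.succ_injective⟩
  have h1 : Finsupp.linearCombination K (fun i : ℕ => c ^ i) (a + b) =
      Finsupp.linearCombination K (fun i : ℕ => c ^ i) (Finsupp.single 0 w) := by
    rw [map_add, Finsupp.linearCombination_single, pow_zero, ← hw, add_mul, one_mul]
    congr 1
    rw [Finsupp.linearCombination_embDomain, Finsupp.linearCombination_apply,
      Finsupp.sum_mapRange_index (by simp), Finsupp.sum, Finsupp.sum, Finset.mul_sum]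
    refine Finset.sum_congr rfl fun i _ => ?_
    rw [hc, ← pow_succ']
    rfl
  have h2 : a + b = Finsupp.single 0 w := h h1
  have hb : ∀ i, b (i + 1) = σ (a i) := fun i => by
    change b ((⟨Nat.succ, Nat.succ_injective⟩ : ℕ ↪ ℕ) i) = _
    rw [Finsupp.embDomain_apply_self, Finsupp.mapRange_apply]
  have ha : a = 0 := by
    by_contra ha
    have hs : a.support.Nonempty := Finsupp.support_nonempty_iff.2 ha
    have h3 := DFunLike.congr_fun h2 (a.support.max' hs + 1)
    have h4 : a (a.support.max' hs + 1) = 0 := by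
      by_contra h4
      have := a.support.le_max' _ (Finsupp.mem_support_iff.2 h4)
      omega
    rw [Finsupp.add_apply, h4, hb, zero_add, Finsupp.single_eq_of_ne (by omega),
      map_eq_zero] at h3
    exact Finsupp.mem_support_iff.1 (a.support.max'_mem hs) h3
  rw [ha] at hw
  rw [Finsupp.sum_zero_index, mul_zero, eq_comm] at hw
  exact (smul_eq_zero.1 hw).resolve_right one_ne_zero

omit [IsScalarTower K D D] in
include hc in
-- If `u w` is a polynomial in `c`, so is `d = u w + w`, and `(1 + c) d = (1 - c) w + (1 + c) w = 2
-- w` is constant.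
lemma eq_zero_of_cayley_mul_mem (h2 : (2 : K) ≠ 0) (hc1 : 1 + c ≠ 0)
    (h : LinearIndependent K fun i : ℕ => c ^ i) {w : K}
    (hw : cayley c * (w • (1 : D)) ∈ skewPolys K c) : w = 0 := by
  have h3 := eq_zero_of_one_add_mul_eq_smul_one hc h
    (add_mem hw (Submodule.smul_mem _ w (pow_mem_skewPolys (K := K) c 0))) (w := 2 * w) (by
      rw [mul_add, ← mul_assoc, cayley, mul_inv_cancel_left₀ hc1, pow_zero, two_mul, add_smul,
        sub_mul, add_mul, one_mul]
      abel)
  exact (mul_eq_zero.1 h3).resolve_left h2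

end CayleyWords

end

noncomputable section

/-! ### Linear independence of the reduced words -/

section CayleyIndependence

variable {K D : Type*} [Field K] [DivisionRing D] [Module K D] [IsScalarTower K D D]
  {σ : K →+* K} {c : D} {f : K}

omit [IsScalarTower K D D] in
lemma one_add_smul_ne_zero_of_linearIndependent (h : LinearIndependent K fun i : ℕ => c ^ i)
    (s : K) : 1 + s • c ≠ 0 := by
  intro h0
  have h1 : Finsupp.linearCombination K (fun i : ℕ => c ^ i)
      (Finsupp.single 0 1 + Finsupp.single 1 s) = 0 := by
    simpa using h0
  have h2 := DFunLike.congr_fun (linearIndependent_iff.1 h _ h1) 0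
  simp at h2

lemma List.cons_left_injective {α : Type*} (l : List α) :
    Function.Injective fun n => n :: l :=
  fun _ _ h => (List.cons.inj h).1

/-- Serves to collect the words with a common tail, whose contributions form a single combination of
powers of `f`. -/
lemma sum_eq_sum_comapDomain_cons {α R M : Type*} [Zero R] [AddCommMonoid M]
    (b : List α →₀ R) (l : List α) (F : List α → R → M)
    (hF : ∀ l' ∈ b.support, (∀ n, l' ≠ n :: l) → F l' (b l') = 0) :
    b.sum F = (b.comapDomain (fun n => n :: l) (List.cons_left_injective _).injOn).sum
      fun n x => F (n :: l) x := by
  rw [Finsupp.sum, Finsupp.sum, Finsupp.comapDomain_support]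
  refine (Finset.sum_preimage (fun n => n :: l) b.support _ (fun l' => F l' (b l')) ?_).symm
  intro l' h1 h2
  exact hF l' h1 fun n hn => h2 ⟨n, hn.symm⟩

variable (hc : ∀ (a : K) (d : D), c * (a • d) = σ a • (c * d))

omit [IsScalarTower K D D] in
include hc in
lemma cayley_mul_smul (hc1 : 1 + c ≠ 0) {a : K} (ha : σ a = a) (d : D) :
    cayley c * (a • d) = a • (cayley c * d) := by
  have h1 : ∀ d : D, (1 + c) * (a • d) = a • ((1 + c) * d) := fun d => by
    rw [add_mul, add_mul, hc, ha, one_mul, one_mul, smul_add]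
  have h2 : ∀ d : D, (1 - c) * (a • d) = a • ((1 - c) * d) := fun d => by
    rw [sub_mul, sub_mul, hc, ha, one_mul, one_mul, smul_sub]
  apply mul_left_cancel₀ hc1
  rw [h1, cayley, mul_assoc, mul_inv_cancel_left₀ hc1, mul_assoc, mul_inv_cancel_left₀ hc1, h2]

/-- The coefficients of `(1 + e c) b` on the words, modulo polynomials in `c`. -/
def leftMulCoeffs (σ : K →+* K) (f e : K) (b : List ℤ →₀ K) : List ℤ →₀ K :=
  b + e • b.sum fun l x => σ x • mulCoeffs σ f l

lemma leftMulCoeffs_apply (e : K) (b : List ℤ →₀ K) (m : List ℤ) :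
    leftMulCoeffs σ f e b m = b m + e * b.sum fun l x => σ x * mulCoeffs σ f l m := by
  rw [leftMulCoeffs, Finsupp.add_apply, Finsupp.smul_apply, Finsupp.sum, Finsupp.finsetSum_apply]
  rfl

include hc in
-- The new combination is `(1 + e c)` times the old one up to polynomials in `c`, and these are
-- stable under left multiplication by `c`.
lemma linearCombination_leftMulCoeffs_mem (h : ∀ s : K, s * s = 1 → 1 + s • c ≠ 0) (e : K)
    {b : List ℤ →₀ K} (hb : Finsupp.linearCombination K (cayleyWord c f) b ∈ skewPolys K c) :
    Finsupp.linearCombination K (cayleyWord c f) (leftMulCoeffs σ f e b) ∈ skewPolys K c := by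
  rw [leftMulCoeffs, map_add, map_smul]
  refine add_mem hb (Submodule.smul_mem _ e ?_)
  have h1 : c * Finsupp.linearCombination K (cayleyWord c f) b -
      Finsupp.linearCombination K (cayleyWord c f) (b.sum fun l x => σ x • mulCoeffs σ f l) ∈
        skewPolys K c := by
    rw [Finsupp.linearCombination_apply K b, Finsupp.sum, Finset.mul_sum, Finsupp.sum, map_sum,
      ← Finset.sum_sub_distrib]
    refine sum_mem fun l _ => ?_
    rw [hc, map_smul, ← smul_sub]
    exact Submodule.smul_mem _ _ (mul_cayleyWord_sub_mem hc h l)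
  have h2 := sub_mem (mul_mem_skewPolys hc hb) h1
  rwa [sub_sub_cancel] at h2

lemma exists_suffix_of_leftMulCoeffs_ne_zero {e : K} {b : List ℤ →₀ K} {m : List ℤ}
    (hb : ∀ l ∈ b.support, l ≠ []) (h : leftMulCoeffs σ f e b m ≠ 0) :
    m ≠ [] ∧ ∃ l ∈ b.support, m <:+ l := by
  rw [leftMulCoeffs_apply] at h
  by_cases h1 : b m = 0
  · rw [h1, zero_add] at h
    obtain ⟨l, hl, h2⟩ := Finset.exists_ne_zero_of_sum_ne_zero (right_ne_zero_of_mul h)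
    have h3 := suffix_of_mulCoeffs_ne_zero σ f (right_ne_zero_of_mul h2)
    exact ⟨h3.2, l, hl, h3.1⟩
  · have h2 : m ∈ b.support := Finsupp.mem_support_iff.2 h1
    exact ⟨hb m h2, m, h2, List.suffix_rfl⟩

/-- A word of maximal length is a suffix of no other word of the support, so only its own diagonal
entry `-(-1) ^ r` contributes. The sign `(-1) ^ r` turns that entry into `-1`. -/
lemma leftMulCoeffs_of_length_eq {r : ℕ} {b : List ℤ →₀ K} {m : List ℤ}
    (hb : ∀ l ∈ b.support, l.length ≤ r + 1) (hm : m.length = r + 1) :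
    leftMulCoeffs σ f ((-1) ^ r) b m = b m - σ (b m) := by
  rw [leftMulCoeffs_apply, Finsupp.sum, Finset.sum_eq_single m]
  · obtain ⟨n, l, rfl⟩ := List.exists_cons_of_length_eq_add_one hm
    have h1 : l.length = r := by simpa using hm
    have h2 : (-1 : K) ^ r * (-1) ^ r = 1 := by rw [← mul_pow]; simp
    rw [mulCoeffs_self, h1]
    linear_combination (-σ (b (n :: l))) * h2
  · intro l hl hne
    by_contra h1
    have h2 := (suffix_of_mulCoeffs_ne_zero σ f (right_ne_zero_of_mul h1)).1
    exact hne (h2.eq_of_length (le_antisymm h2.length_le (hm ▸ hb l hl))).symm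
  · intro h1
    rw [Finsupp.notMem_support_iff.1 h1, map_zero, zero_mul]

/-- A word one letter short of the maximal length receives contributions only from itself and from
its one-letter extensions. Its own enters with a plus sign, as the multiplier is adapted to the
parity of the longer words. -/
lemma leftMulCoeffs_tail {m : ℤ} {l : List ℤ} {b : List ℤ →₀ K}
    (hb : ∀ l' ∈ b.support, l'.length ≤ l.length + 2) :
    ∃ β : ℤ →₀ K, (∀ n, β n = b (n :: m :: l)) ∧
      leftMulCoeffs σ f ((-1) ^ (l.length + 1)) b (m :: l) = b (m :: l) + σ (b (m :: l)) +
        β.sum fun n x => σ x * (f ^ n - σ (f ^ n)) := by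
  refine ⟨(b.erase (m :: l)).comapDomain (fun n => n :: m :: l)
    (List.cons_left_injective _).injOn, ?_, ?_⟩
  · intro n
    rw [Finsupp.comapDomain_apply, Finsupp.erase_ne (by simp)]
  · have h2 : (-1 : K) ^ l.length * (-1) ^ l.length = 1 := by rw [← mul_pow]; simp
    rw [leftMulCoeffs_apply, ← Finsupp.add_sum_erase' b (m :: l) _ (by simp), mulCoeffs_self,
      sum_eq_sum_comapDomain_cons _ (m :: l)]
    · simp only [mulCoeffs_tail, mul_add, pow_succ, Finsupp.mul_sum]
      rw [add_assoc]
      congr 2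
      · linear_combination (σ (b (m :: l))) * h2
      · refine Finset.sum_congr rfl fun n _ => ?_
        dsimp only
        generalize σ (f ^ n) = x
        linear_combination (σ _ * (f ^ n - x)) * h2
    · intro l' h1 h3
      by_contra h4
      have h5 := (suffix_of_mulCoeffs_ne_zero σ f (right_ne_zero_of_mul h4)).1
      rw [Finsupp.support_erase, Finset.mem_erase] at h1
      obtain ⟨t, rfl⟩ := h5
      have h6 := hb _ h1.2
      simp only [List.length_append, List.length_cons] at h6
      rcases t with _ | ⟨n, _ | ⟨n', t⟩⟩
      · exact h1.1 rfl
      · exact h3 n rfl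
      · simp only [List.length_cons] at h6
        omega

include hc in
/-- The nonempty reduced words are independent modulo the polynomials in `c`. -/
theorem eq_zero_of_linearCombination_cayleyWord_mem (h2 : (2 : K) ≠ 0)
    (hpow : LinearIndependent K fun i : ℕ => c ^ i)
    (hf : ∀ a : ℤ →₀ K, (∀ n, σ (a n) = a n) → ∀ p,
      (a.sum fun n x => x * f ^ n) = p + σ p → ∀ n ≠ 0, a n = 0)
    {a : List ℤ →₀ K} (ha : ∀ l ∈ a.support, l ≠ [] ∧ IsReducedList l)
    (hC : Finsupp.linearCombination K (cayleyWord c f) a ∈ skewPolys K c) : a = 0 := by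
  have h1c := fun s (_ : s * s = 1) => one_add_smul_ne_zero_of_linearIndependent hpow s
  have hc1 : 1 + c ≠ 0 := by simpa using h1c 1 (by simp)
  -- Double induction: on a bound `r` for the length, then on a bound `N` for the number of words of
  -- length exactly `r`.
  suffices key : ∀ r N : ℕ, ∀ a : List ℤ →₀ K, (∀ l ∈ a.support, l ≠ [] ∧ IsReducedList l) →
      (∀ l ∈ a.support, l.length ≤ r) → (a.support.filter fun l => l.length = r).card ≤ N →
      Finsupp.linearCombination K (cayleyWord c f) a ∈ skewPolys K c → a = 0 from
    key (a.support.sup List.length) _ a ha (fun l hl => Finset.le_sup hl) le_rfl hC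
  intro r
  induction r with
  | zero =>
    intro N a ha hr _ _
    rw [← Finsupp.support_eq_empty, Finset.eq_empty_iff_forall_notMem]
    intro l hl
    exact (ha l hl).1 (List.eq_nil_of_length_eq_zero (Nat.le_zero.1 (hr l hl)))
  | succ r ihr =>
    intro N
    induction N with
    | zero =>
      intro a ha hr hN hC
      refine ihr _ a ha (fun l hl => ?_) le_rfl hC
      have h3 := Finset.card_eq_zero.1 (Nat.le_zero.1 hN)
      have h4 := hr l hl
      by_contra h5
      exact Finset.notMem_empty l (h3 ▸ Finset.mem_filter.2 ⟨hl, by omega⟩)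
    | succ N ihN =>
      intro a ha hr hN hC
      by_cases htop : ∃ l ∈ a.support, l.length = r + 1
      swap
      · push Not at htop
        exact ihr _ a ha (fun l hl => Nat.le_of_lt_succ ((hr l hl).lt_of_ne (htop l hl))) le_rfl hC
      obtain ⟨l₀, hl₀, hlen⟩ := htop
      exfalso
      have hal₀ := Finsupp.mem_support_iff.1 hl₀
      -- The coefficient of `l₀` is made 1, hence fixed by `σ`, so that multiplication by `1 + (-1)
      -- ^ r c` removes `l₀`.
      obtain ⟨b, hb⟩ : ∃ b, b = (a l₀)⁻¹ • a := ⟨_, rfl⟩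
      have hb1 : b l₀ = 1 := by
        rw [hb, Finsupp.smul_apply, smul_eq_mul, inv_mul_cancel₀ hal₀]
      have hsupp : b.support = a.support := by
        rw [hb]; exact Finsupp.support_smul_eq (inv_ne_zero hal₀)
      rw [← hsupp] at ha hr hN
      have hbC : Finsupp.linearCombination K (cayleyWord c f) b ∈ skewPolys K c := by
        rw [hb, map_smul]; exact Submodule.smul_mem _ _ hC
      -- The product has fewer words of length `r + 1`: none is created, and `l₀` gets the
      -- coefficient `1 - σ 1 = 0`.
      have hb' : leftMulCoeffs σ f ((-1) ^ r) b = 0 := by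
        apply ihN
        · intro m hm
          obtain ⟨h3, l, hl, h4⟩ := exists_suffix_of_leftMulCoeffs_ne_zero
            (fun l hl => (ha l hl).1) (Finsupp.mem_support_iff.1 hm)
          exact ⟨h3, (ha l hl).2.of_suffix h4⟩
        · intro m hm
          obtain ⟨h3, l, hl, h4⟩ := exists_suffix_of_leftMulCoeffs_ne_zero
            (fun l hl => (ha l hl).1) (Finsupp.mem_support_iff.1 hm)
          exact h4.length_le.trans (hr l hl)
        · refine Nat.le_of_lt_succ ((Finset.card_lt_card ?_).trans_le hN)
          rw [Finset.ssubset_iff_of_subset]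
          · refine ⟨l₀, Finset.mem_filter.2 ⟨Finsupp.mem_support_iff.2 (by simp [hb1]), hlen⟩, ?_⟩
            intro h3
            refine Finsupp.mem_support_iff.1 (Finset.mem_filter.1 h3).1 ?_
            rw [leftMulCoeffs_of_length_eq hr hlen, hb1, map_one, sub_self]
          · intro m hm
            obtain ⟨hm1, hm2⟩ := Finset.mem_filter.1 hm
            rw [Finsupp.mem_support_iff, leftMulCoeffs_of_length_eq hr hm2] at hm1
            refine Finset.mem_filter.2 ⟨Finsupp.mem_support_iff.2 fun h3 => hm1 ?_, hm2⟩
            rw [h3, map_zero, sub_self]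
        · exact linearCombination_leftMulCoeffs_mem hc h1c _ hbC
      have hfix : ∀ l : List ℤ, l.length = r + 1 → σ (b l) = b l := by
        intro l hl
        have h3 := leftMulCoeffs_of_length_eq (σ := σ) (f := f) hr hl
        rw [hb', Finsupp.zero_apply] at h3
        exact (sub_eq_zero.1 h3.symm).symm
      obtain ⟨n₀, l, rfl⟩ := List.exists_cons_of_length_eq_add_one hlen
      rcases l with _ | ⟨m, l⟩
      -- Words of length one: the `σ`-fixed coefficients commute with `u`, so the relation says that
      -- `u w` is a polynomial in `c`, where `w = ∑ β n * f ^ n`. Hence `w = 0`, and `hf` applies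
      -- with `p = 0`.
      · obtain rfl : r = 0 := by simpa using hlen.symm
        let β : ℤ →₀ K := b.comapDomain (fun n => [n]) (List.cons_left_injective _).injOn
        have hβ : ∀ n, σ (β n) = β n := fun n => hfix [n] rfl
        have h3 : Finsupp.linearCombination K (cayleyWord c f) b =
            cayley c * ((β.sum fun n x => x * f ^ n) • (1 : D)) := by
          rw [Finsupp.linearCombination_apply, sum_eq_sum_comapDomain_cons b [],
            Finsupp.sum, Finsupp.sum, Finset.sum_smul, Finset.mul_sum]
          · refine Finset.sum_congr rfl fun n _ => ?_
            rw [mul_smul, cayley_mul_smul hc hc1 (hβ n)]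
            simp [cayleyWord, β]
          · intro l' hl' h4
            exfalso
            rcases l' with _ | ⟨n, l'⟩
            · exact (ha _ hl').1 rfl
            · have := hr _ hl'
              refine h4 n ?_
              rw [List.eq_nil_of_length_eq_zero (l := l') (by simpa using this)]
        rw [h3] at hbC
        have h4 := eq_zero_of_cayley_mul_mem hc h2 hc1 hpow hbC
        have h5 := hf β hβ 0 (by rw [h4, map_zero, add_zero])
        have h6 : β 0 = 0 := by
          rw [Finsupp.sum, Finset.sum_subset (Finset.subset_insert 0 _),
            Finset.sum_eq_single 0] at h4
          · simpa using h4
          · intro n _ hn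
            rw [h5 n hn, zero_mul]
          · intro h7
            exact absurd (Finset.mem_insert_self _ _) h7
          · intro n _ hn
            rw [Finsupp.notMem_support_iff.1 hn, zero_mul]
        have h7 : β n₀ = 1 := hb1
        by_cases h8 : n₀ = 0
        · rw [h8, h6] at h7
          exact zero_ne_one h7
        · rw [h5 n₀ h8] at h7
          exact zero_ne_one h7
      -- Longer words: with `b'` the coefficient of `m :: l`, the vanishing of its new coefficient
      -- reads `b' + σ b' + w - σ w = 0`, where `w = ∑ β n * f ^ n`.
      · obtain rfl : r = l.length + 1 := by simpa using hlen.symm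
        obtain ⟨β, hβ, h3⟩ := leftMulCoeffs_tail (σ := σ) (f := f) (m := m) (l := l) hr
        rw [hb', Finsupp.zero_apply] at h3
        have hβfix : ∀ n, σ (β n) = β n := fun n => by rw [hβ]; exact hfix _ rfl
        have h4 : (β.sum fun n x => σ x * (f ^ n - σ (f ^ n))) =
            (β.sum fun n x => x * f ^ n) - σ (β.sum fun n x => x * f ^ n) := by
          rw [Finsupp.sum, Finsupp.sum, map_sum, ← Finset.sum_sub_distrib]
          refine Finset.sum_congr rfl fun n _ => ?_
          rw [hβfix, map_mul, hβfix, mul_sub]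
        generalize hw : (β.sum fun n x => x * f ^ n) = w at h4
        rw [h4] at h3
        -- Since `σ w = w + b' + σ b'`, the element `p = (w - b') / 2` satisfies `p + σ p = w`. The
        -- exponent `n₀` is not the last entry, so it is nonzero by reducedness.
        have h5 := hf β hβfix ((w - b (m :: l)) / 2) (by
          rw [hw, map_div₀, map_sub, map_ofNat]
          field_simp
          linear_combination (-h3)) n₀
            (ha (n₀ :: m :: l) (Finsupp.mem_support_iff.2 (by simp [hb1]))).2.1
        rw [hβ, hb1] at h5
        exact one_ne_zero h5

end CayleyIndependence

end

noncomputable section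

/-! ### Criteria for free algebras and free group algebras -/

section FreeObjects

/-- Positive words are already reduced, so the free monoid embeds in the free group, and hence the
free algebra in the group algebra. -/
lemma injective_lift_freeMonoid_of {k : Type*} [Field k] (α : Type*) :
    Function.Injective (FreeAlgebra.lift k
      (fun i : α => MonoidAlgebra.of k (FreeGroup α) (FreeGroup.of i))) := by
  let j : FreeMonoid α →* FreeGroup α := FreeMonoid.lift FreeGroup.of
  have hj : ∀ l : List α, j (FreeMonoid.ofList l) = FreeGroup.mk (l.map fun i => (i, true)) := by
    intro l
    induction l with
    | nil => rfl
    | cons i l ih =>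
      rw [FreeMonoid.ofList_cons, map_mul, ih, FreeMonoid.lift_eval_of]
      rfl
  have hinj : Function.Injective j := by
    classical
    intro a b hab
    have h1 : ∀ l : List α, (j (FreeMonoid.ofList l)).toWord = l.map fun i => (i, true) := by
      intro l
      rw [hj, FreeGroup.toWord_mk]
      apply FreeGroup.IsReduced.reduce_eq
      rw [FreeGroup.IsReduced, List.isChain_map]
      induction l with
      | nil => exact List.isChain_nil
      | cons i l ih => cases l <;> simp_all
    have h2 := (h1 a.toList).symm.trans ((congrArg FreeGroup.toWord hab).trans (h1 b.toList))
    exact FreeMonoid.toList.injective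
      (List.map_injective_iff.2 (fun _ _ h => (Prod.mk.inj h).1) h2)
  have h1 : FreeAlgebra.lift k (fun i : α => MonoidAlgebra.of k (FreeGroup α) (FreeGroup.of i)) =
      (MonoidAlgebra.mapDomainAlgHom k k j).comp
        (FreeAlgebra.equivMonoidAlgebraFreeMonoid (R := k) (X := α)).toAlgHom := by
    apply FreeAlgebra.hom_ext
    funext i
    simp [FreeAlgebra.equivMonoidAlgebraFreeMonoid, j]
  rw [h1]
  exact (MonoidAlgebra.mapDomain_injective hinj).comp
    (FreeAlgebra.equivMonoidAlgebraFreeMonoid (R := k) (X := α)).injective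

variable {k D : Type*} [Field k]

lemma isFreeAlgebraOn_of_injective [Ring D] [Algebra k D] {a b : D}
    (h : Function.Injective (FreeAlgebra.lift k ![a, b])) : IsFreeAlgebraOn k a b := by
  have h1 : (FreeAlgebra.lift k ![a, b]).range = Algebra.adjoin k {a, b} := by
    rw [← Algebra.map_top, ← FreeAlgebra.adjoin_range_ι, AlgHom.map_adjoin, ← Set.range_comp]
    congr 1
    ext d
    simp [eq_comm, or_comm]
  refine ⟨(AlgEquiv.ofInjective _ h).trans (Subalgebra.equivOfEq _ _ h1), ?_, ?_⟩
  · change FreeAlgebra.lift k ![a, b] (FreeAlgebra.ι k 0) = a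
    simp
  · change FreeAlgebra.lift k ![a, b] (FreeAlgebra.ι k 1) = b
    simp

variable [DivisionRing D] [Algebra k D]

/-- Independence of the images of the group elements is injectivity of the induced map on the group
algebra. -/
lemma isFreeGroupAlgebraOn_of_linearIndependent {a b : D} (θ : FreeGroup (Fin 2) →* D)
    (ha : θ (FreeGroup.of 0) = a) (hb : θ (FreeGroup.of 1) = b)
    (h : LinearIndependent k θ) : IsFreeGroupAlgebraOn k a b := by
  have ha' : θ (FreeGroup.of 0)⁻¹ = a⁻¹ := by
    refine eq_inv_of_mul_eq_one_left ?_
    rw [← ha, ← map_mul, inv_mul_cancel, map_one]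
  have hb' : θ (FreeGroup.of 1)⁻¹ = b⁻¹ := by
    refine eq_inv_of_mul_eq_one_left ?_
    rw [← hb, ← map_mul, inv_mul_cancel, map_one]
  let Φ := MonoidAlgebra.lift k D (FreeGroup (Fin 2)) θ
  have hΦ : ∀ g, Φ (MonoidAlgebra.of k _ g) = θ g := MonoidAlgebra.lift_of θ
  have hinj : Function.Injective Φ := by
    intro p q hpq
    apply MonoidAlgebra.coeff_injective
    apply h
    rw [Finsupp.linearCombination_apply, Finsupp.linearCombination_apply]
    exact (MonoidAlgebra.lift_apply θ p).symm.trans (hpq.trans (MonoidAlgebra.lift_apply θ q))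
  have h1 : Φ.range = Algebra.adjoin k {a, a⁻¹, b, b⁻¹} := by
    apply le_antisymm
    · have hθ : ∀ g, θ g ∈ Algebra.adjoin k {a, a⁻¹, b, b⁻¹} := by
        intro g
        induction g using FreeGroup.induction_on with
        | C1 => rw [map_one]; exact one_mem _
        | of i =>
          apply Algebra.subset_adjoin
          fin_cases i
          · simp [ha]
          · simp [hb]
        | inv_of i _ =>
          apply Algebra.subset_adjoin
          fin_cases i
          · simp [ha']
          · simp [hb']
        | mul x y hx hy => rw [map_mul]; exact mul_mem hx hy
      rintro _ ⟨p, rfl⟩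
      change Φ p ∈ _
      induction p using MonoidAlgebra.induction_on with
      | of g => rw [hΦ]; exact hθ g
      | add p q hp hq => rw [map_add]; exact add_mem hp hq
      | smul r p hp => rw [map_smul]; exact Subalgebra.smul_mem _ hp r
    · refine Algebra.adjoin_le ?_
      rintro d (rfl | rfl | rfl | rfl)
      · exact ⟨_, (hΦ _).trans ha⟩
      · exact ⟨_, (hΦ _).trans ha'⟩
      · exact ⟨_, (hΦ _).trans hb⟩
      · exact ⟨_, (hΦ _).trans hb'⟩
  exact ⟨(AlgEquiv.ofInjective _ hinj).trans (Subalgebra.equivOfEq _ _ h1),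
    (hΦ _).trans ha, (hΦ _).trans hb⟩

/-- If `1 + a`, `1 + b` generate a free group algebra then `a`, `b` generate a free algebra. -/
lemma IsFreeGroupAlgebraOn.isFreeAlgebraOn {a b : D}
    (h : IsFreeGroupAlgebraOn k (1 + a) (1 + b)) : IsFreeAlgebraOn k a b := by
  obtain ⟨e, h0, h1⟩ := h
  apply isFreeAlgebraOn_of_injective
  -- The substitution of `X - 1` for each generator `X` is undone by `s'`. Composing it with the
  -- embedding that sends the generators to `1 + a`, `1 + b` yields the map sending them to `a`,
  -- `b`.
  let s : FreeAlgebra k (Fin 2) →ₐ[k] FreeAlgebra k (Fin 2) :=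
    FreeAlgebra.lift k fun i => FreeAlgebra.ι k i - 1
  let s' : FreeAlgebra k (Fin 2) →ₐ[k] FreeAlgebra k (Fin 2) :=
    FreeAlgebra.lift k fun i => FreeAlgebra.ι k i + 1
  have hs : s'.comp s = AlgHom.id k _ := by
    apply FreeAlgebra.hom_ext
    funext i
    simp [s, s']
  let g : FreeAlgebra k (Fin 2) →ₐ[k] D :=
    ((Algebra.adjoin k {1 + a, (1 + a)⁻¹, 1 + b, (1 + b)⁻¹}).val.comp e.toAlgHom).comp
      (FreeAlgebra.lift k
        (fun i => MonoidAlgebra.of k (FreeGroup (Fin 2)) (FreeGroup.of i)))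
  have hg : FreeAlgebra.lift k ![a, b] = g.comp s := by
    apply FreeAlgebra.hom_ext
    funext i
    change FreeAlgebra.lift k ![a, b] (FreeAlgebra.ι k i) = g (s (FreeAlgebra.ι k i))
    rw [FreeAlgebra.lift_ι_apply, FreeAlgebra.lift_ι_apply, map_sub, map_one, eq_sub_iff_add_eq]
    have : g (FreeAlgebra.ι k i) =
        e (MonoidAlgebra.of k (FreeGroup (Fin 2)) (FreeGroup.of i)) := by
      change ((e (FreeAlgebra.lift k _ (FreeAlgebra.ι k i)) : _) : D) = _
      rw [FreeAlgebra.lift_ι_apply]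
    rw [this]
    fin_cases i
    · exact (add_comm _ _).trans h0.symm
    · exact (add_comm _ _).trans h1.symm
  rw [hg]
  refine Function.Injective.comp (g := g) (f := s) ?_ ?_
  · exact (Subtype.val_injective.comp e.injective).comp (injective_lift_freeMonoid_of _)
  · exact Function.LeftInverse.injective (g := s') (AlgHom.congr_fun hs)

/-- The alternating product of powers of the generators with the given exponents, ending with a
power of the first generator. -/
def alternatingWord : List ℤ → FreeGroup (Fin 2)
  | [] => 1
  | [_] => 1
  | n :: m :: l => FreeGroup.of 1 ^ n * (FreeGroup.of 0 ^ m * alternatingWord l)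

/-- Elements of this form include 1 and are stable under left multiplication by powers of either
generator. Even length pairs each power of the second generator with a following power of the first.
-/
lemma exists_eq_mul_alternatingWord (g : FreeGroup (Fin 2)) :
    ∃ (i : ℤ) (l : List ℤ), IsReducedList l ∧
    Even l.length ∧ g = FreeGroup.of 0 ^ i * alternatingWord l := by
  let P : Set (FreeGroup (Fin 2)) := {h | ∃ (i : ℤ) (l : List ℤ), IsReducedList l ∧
    Even l.length ∧ h = FreeGroup.of 0 ^ i * alternatingWord l}
  have hone : (1 : FreeGroup (Fin 2)) ∈ P :=
    ⟨0, [], trivial, ⟨0, rfl⟩, by simp [alternatingWord]⟩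
  have h0 : ∀ (j : ℤ), ∀ h ∈ P, FreeGroup.of 0 ^ j * h ∈ P := by
    rintro j _ ⟨i, l, hl, he, rfl⟩
    exact ⟨j + i, l, hl, he, by rw [zpow_add, mul_assoc]⟩
  have h1 : ∀ (j : ℤ), ∀ h ∈ P, FreeGroup.of 1 ^ j * h ∈ P := by
    rintro j _ ⟨i, l, hl, he, rfl⟩
    by_cases hj : j = 0
    · subst hj
      exact ⟨i, l, hl, he, by simp⟩
    -- Prepending `j` turns `i` into an entry of the list; it may be zero only if it is the last
    -- one.
    by_cases hi : i ≠ 0 ∨ l = []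
    · refine ⟨0, j :: i :: l, ⟨hj, ?_⟩, ?_, ?_⟩
      · rcases l with _ | ⟨n, l⟩
        · trivial
        · exact ⟨hi.resolve_right (by simp), hl⟩
      · simpa [Nat.even_add_one] using he
      · simp [alternatingWord]
    -- Here `i = 0`, so the new power meets the first power of the same generator and merges with
    -- it. If they cancel, the next exponent `m` becomes the leading power of the first generator.
    · push Not at hi
      obtain ⟨rfl, hne⟩ := hi
      rcases l with _ | ⟨n, _ | ⟨m, l⟩⟩
      · exact absurd rfl hne
      · simp at he
      · have he' : Even l.length := by simpa [Nat.even_add_one] using he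
        by_cases hjn : j + n = 0
        · refine ⟨m, l, hl.2.tail, he', ?_⟩
          simp only [alternatingWord]
          rw [zpow_zero, one_mul, ← mul_assoc, ← zpow_add, hjn, zpow_zero, one_mul]
        · refine ⟨0, (j + n) :: m :: l, ⟨hjn, hl.2⟩, he, ?_⟩
          simp only [alternatingWord]
          rw [zpow_zero, one_mul, one_mul, zpow_add, mul_assoc]
  have hgen : ∀ (i : Fin 2) (j : ℤ), ∀ h ∈ P, FreeGroup.of i ^ j * h ∈ P := by
    intro i
    fin_cases i
    · exact h0
    · exact h1
  suffices key : ∀ h ∈ P, g * h ∈ P by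
    have := key 1 hone
    rwa [mul_one] at this
  induction g using FreeGroup.induction_on with
  | C1 => intro h hh; simpa using hh
  | of i => intro h hh; simpa using hgen i 1 h hh
  | inv_of i _ => intro h hh; simpa using hgen i (-1) h hh
  | mul x y hx hy => intro h hh; rw [mul_assoc]; exact hx _ (hy _ hh)

end FreeObjects

/-! ### The free group algebra on `f` and its conjugate by a Cayley transform -/

section CayleyFree

variable {k K D : Type*} [Field k] [Field K] [DivisionRing D] [Algebra k K] [Algebra k D]
  [Module K D] [IsScalarTower k K D] [IsScalarTower K D D] {σ : K →+* K} {c : D} {f : K}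

lemma cayley_neg (c : D) : cayley (-c) = (cayley c)⁻¹ := by
  rw [cayley, cayley, mul_inv_rev, inv_inv, sub_neg_eq_add, ← sub_eq_add_neg]

/-- With `u = cayley c`, the product `(u⁻¹ f u)^n f^m` is `u⁻¹ f^n u f^m`, so a group element maps
to a power of `f` times a word of even length. The powers of `f` are independent over `k` and the
words over `K`, so their products are independent over `k`. -/
theorem isFreeGroupAlgebraOn_conj_cayley
    (hc : ∀ (a : K) (d : D), c * (a • d) = σ a • (c * d)) (h2 : (2 : K) ≠ 0)
    (hσ : ∀ r : k, σ (algebraMap k K r) = algebraMap k K r)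
    (hpow : LinearIndependent K fun i : ℕ => c ^ i)
    (hf : ∀ a : ℤ →₀ K, (∀ n, σ (a n) = a n) → ∀ p,
      (a.sum fun n x => x * f ^ n) = p + σ p → ∀ n ≠ 0, a n = 0) :
    IsFreeGroupAlgebraOn k (f • (1 : D)) ((cayley c)⁻¹ * (f • (1 : D)) * cayley c) := by
  have h0 : f ≠ 0 := by
    rintro rfl
    have h3 := hf (Finsupp.single 1 1) (fun n => by
      rw [Finsupp.single_apply]
      split_ifs <;> simp) 0 (by simp) 1 one_ne_zero
    simp at h3
  -- Constants are fixed by `σ`, so `hf` with `p = 0` leaves only the exponent 0 in a relation.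
  have hfpow : LinearIndependent k fun n : ℤ => f ^ n := by
    rw [linearIndependent_iff]
    intro a ha
    have h3 := hf (a.mapRange (algebraMap k K) (map_zero _)) (fun n => hσ _) 0 (by
      rw [Finsupp.sum_mapRange_index (by simp), map_zero, add_zero, ← ha,
        Finsupp.linearCombination_apply]
      simp only [Algebra.smul_def])
    have h4 : ∀ n ≠ 0, a n = 0 := fun n hn => by simpa using h3 n hn
    have h5 : a = Finsupp.single 0 (a 0) := by
      ext n
      by_cases hn : n = 0
      · rw [hn, Finsupp.single_eq_same]
      · rw [h4 n hn, Finsupp.single_eq_of_ne hn]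
    rw [h5, Finsupp.linearCombination_single] at ha
    have h6 : a 0 = 0 := by simpa using ha
    rw [h5, h6, Finsupp.single_zero]
  have hwords : LinearIndepOn K (cayleyWord c f) {l | IsReducedList l} := by
    rw [linearIndepOn_iff]
    intro a ha hlc
    rw [Finsupp.mem_supported] at ha
    -- The empty word contributes a constant, which is a polynomial in `c`; independence modulo such
    -- polynomials handles the other words.
    have h3 : Finsupp.linearCombination K (cayleyWord c f) (a.erase []) = -(a [] • (1 : D)) := by
      rw [eq_neg_iff_add_eq_zero, ← hlc, Finsupp.linearCombination_apply,
        Finsupp.linearCombination_apply, add_comm]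
      exact Finsupp.add_sum_erase' a [] (fun l x => x • cayleyWord c f l) (by simp)
    have h4 : a.erase [] = 0 := by
      apply eq_zero_of_linearCombination_cayleyWord_mem hc h2 hpow hf
      · intro l hl
        rw [Finsupp.support_erase, Finset.mem_erase] at hl
        exact ⟨hl.1, ha hl.2⟩
      · rw [h3]
        exact neg_mem (Submodule.smul_mem _ _ (by simpa using pow_mem_skewPolys (K := K) c 0))
    rw [h4, map_zero, eq_comm, neg_eq_zero] at h3
    have h5 := (smul_eq_zero.1 h3).resolve_right one_ne_zero
    ext l
    by_cases hl : l = []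
    · rw [hl, h5, Finsupp.zero_apply]
    · rw [← Finsupp.erase_ne hl, h4]
  have hall := linearIndependent_smul hfpow hwords
  have hf1 : f • (1 : D) ≠ 0 := by simpa using h0
  have hc1 : cayley c ≠ 0 := by
    have h3 := one_add_smul_ne_zero_of_linearIndependent hpow 1
    have h4 := one_add_smul_ne_zero_of_linearIndependent hpow (-1)
    rw [one_smul] at h3
    rw [neg_smul, one_smul, ← sub_eq_add_neg] at h4
    exact mul_ne_zero (inv_ne_zero h3) h4
  let a : Dˣ := Units.mk0 _ hf1
  let u : Dˣ := Units.mk0 _ hc1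
  let θ : FreeGroup (Fin 2) →* D :=
    (Units.coeHom D).comp (FreeGroup.lift ![a, u⁻¹ * a * u])
  have hpowf : ∀ (n : ℤ) (d : D), f ^ n • d = ((a ^ n : Dˣ) : D) * d := by
    intro n d
    have h3 := map_zpow₀ (RingHom.smulOneHom : K →+* D) f n
    simp only [RingHom.smulOneHom_apply] at h3
    rw [Units.val_zpow_eq_zpow_val, Units.val_mk0, ← h3, smul_one_mul]
  have hθ0 : ∀ n : ℤ, θ (FreeGroup.of 0 ^ n) = ((a ^ n : Dˣ) : D) := by
    intro n
    simp [θ]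
  have hθ1 : ∀ n : ℤ, θ (FreeGroup.of 1 ^ n) = ((u⁻¹ * a ^ n * u : Dˣ) : D) := by
    intro n
    have h3 : (u⁻¹ * a * u) ^ n = u⁻¹ * a ^ n * u := by
      simpa using conj_zpow (i := n) (a := u⁻¹) (b := a)
    simp only [θ, MonoidHom.comp_apply, map_zpow, FreeGroup.lift_apply_of]
    rw [← map_zpow, ← h3]
    rfl
  have hword : ∀ N, ∀ l : List ℤ, l.length ≤ N → Even l.length →
      θ (alternatingWord l) = cayleyWord c f l := by
    intro N
    induction N with
    | zero =>
      intro l hl _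
      rw [List.eq_nil_of_length_eq_zero (Nat.le_zero.1 hl)]
      exact map_one θ
    | succ N ih =>
      intro l hl he
      rcases l with _ | ⟨n, _ | ⟨m, l⟩⟩
      · exact map_one θ
      · simp at he
      · have he' : Even l.length := by simpa [Nat.even_add_one] using he
        -- The tail has even length, so the inner Cayley factor is `u` and the outer one is `cayley
        -- (-c) = u⁻¹`.
        have h3 : (-1 : K) ^ l.length = 1 := he'.neg_one_pow
        rw [alternatingWord, map_mul, map_mul, ih l (by simp at hl; omega) he', hθ0, hθ1,
          cayleyWord, cayleyWord, List.length_cons, pow_succ, h3, hpowf, hpowf, one_mul, one_smul,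
          neg_smul, one_smul, cayley_neg]
        push_cast
        simp only [u, Units.val_mk0, mul_assoc]
  choose i l hl he hg using exists_eq_mul_alternatingWord
  have hθ : θ = (fun p : ℤ × {l | IsReducedList l} => f ^ p.1 • cayleyWord c f p.2) ∘
      fun g => (i g, ⟨l g, hl g⟩) := by
    funext g
    conv_lhs => rw [hg g]
    rw [map_mul, hθ0, hword _ _ le_rfl (he g), ← hpowf]
    rfl
  refine isFreeGroupAlgebraOn_of_linearIndependent θ ?_ ?_ ?_
  · simpa [a] using hθ0 1
  · simpa [a, u] using hθ1 1
  · rw [hθ]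
    refine hall.comp _ fun g g' h => ?_
    have h3 : l g = l g' := congrArg Subtype.val (Prod.mk.inj h).2
    rw [hg g, hg g', (Prod.mk.inj h).1, h3]

end CayleyFree

end

noncomputable section

/-! ### Poles along an orbit and the equation `w = p + σ p` -/

section RegularPoints

variable {K : Type*} [Field K] {σ : K →+* K} {R : ℤ → Subring K}

/-- `R j` stands for regularity at the `j`-th point of an orbit. Far out, `p` is regular. From `p =
w - σ p` regularity passes from `j + 1` to `j` for `j ≥ 1`, and from `σ p = w - p` it passes from `j
- 1` to `j` for `j ≤ 0`. Thus `p` is regular along the whole orbit, and so is `w` at 0. -/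
lemma mem_zero_of_eq_add_map (hR : ∀ j g, g ∈ R (j + 1) ↔ σ g ∈ R j)
    (hfin : ∀ g, ∃ N : ℕ, ∀ j : ℤ, (N : ℤ) ≤ |j| → g ∈ R j) {p w : K} (h : w = p + σ p)
    (hw : ∀ j ≠ 0, w ∈ R j) : w ∈ R 0 := by
  obtain ⟨N, hN⟩ := hfin p
  have hpos : ∀ n : ℕ, ∀ j : ℤ, 1 ≤ j → (N : ℤ) ≤ j + n → p ∈ R j := by
    intro n
    induction n with
    | zero => intro j _ h2; exact hN j (by rw [abs_of_nonneg] <;> omega)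
    | succ n ih =>
      intro j h1 h2
      have h3 := (hR j p).1 (ih (j + 1) (by omega) (by push_cast at h2; omega))
      have h4 := sub_mem (hw j (by omega)) h3
      rwa [h, add_sub_cancel_right] at h4
  have hneg : ∀ n : ℕ, ∀ j : ℤ, j ≤ 0 → (N : ℤ) ≤ n - j → p ∈ R j := by
    intro n
    induction n with
    | zero => intro j _ h2; exact hN j (by rw [abs_of_nonpos] <;> omega)
    | succ n ih =>
      intro j h1 h2
      have h3 := ih (j - 1) (by omega) (by push_cast at h2; omega)
      have h4 := sub_mem (hw (j - 1) (by omega)) h3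
      rw [h, add_sub_cancel_left, ← hR, sub_add_cancel] at h4
      exact h4
  rw [h]
  exact add_mem (hneg N 0 le_rfl (by omega)) ((hR 0 p).1 (hpos N _ (by omega) (by omega)))

/-- If `f` has a pole at exactly one point of an orbit, which contains no zero of `f`, then a
combination of powers of `f` of the form `p + σ p` has no positive powers. -/
lemma eq_zero_of_pos_of_sum_eq (hR : ∀ j g, g ∈ R (j + 1) ↔ σ g ∈ R j)
    (hfin : ∀ g, ∃ N : ℕ, ∀ j : ℤ, (N : ℤ) ≤ |j| → g ∈ R j) {f : K}
    (hf : ∀ j ≠ 0, f ∈ R j) (hf' : ∀ j, f⁻¹ ∈ R j) (hf0 : f ∉ R 0)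
    {a : ℤ →₀ K} (ha : ∀ n, σ (a n) = a n) {p : K}
    (h : (a.sum fun n x => x * f ^ n) = p + σ p) (n : ℤ) (hn : 0 < n) : a n = 0 := by
  -- For a `σ`-fixed element regularity does not depend on `j`, and it holds far out on the orbit.
  have hfix : ∀ g, σ g = g → ∀ j, g ∈ R j := by
    intro g hg
    obtain ⟨N, hN⟩ := hfin g
    have hstep : ∀ j, g ∈ R (j + 1) ↔ g ∈ R j := fun j => by rw [hR, hg]
    have hN0 := hN N (by simp)
    intro j
    induction j using Int.inductionOn' (b := (N : ℤ)) with
    | zero => exact hN0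
    | succ j _ ih => exact (hstep j).2 ih
    | pred j _ ih => rw [← hstep, sub_add_cancel]; exact ih
  by_contra hcon
  have hs : a.support.Nonempty := ⟨n, Finsupp.mem_support_iff.2 hcon⟩
  obtain ⟨M, hM⟩ : ∃ M, M = a.support.max' hs := ⟨_, rfl⟩
  have hMpos : 0 < M := by
    rw [hM]
    exact hn.trans_le (Finset.le_max' _ _ (Finsupp.mem_support_iff.2 hcon))
  have haM : a M ≠ 0 := by
    rw [hM]
    exact Finsupp.mem_support_iff.1 (Finset.max'_mem _ hs)
  have hfne : f ≠ 0 := by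
    rintro rfl
    exact hf0 (zero_mem _)
  have hpow : ∀ j, ∀ n : ℤ, n ≤ 0 → f ^ n ∈ R j := by
    intro j n hn
    obtain ⟨m, rfl⟩ := Int.exists_eq_neg_ofNat hn
    rw [zpow_neg, zpow_natCast, ← inv_pow]
    exact pow_mem (hf' j) m
  have hpow' : ∀ j ≠ 0, ∀ n : ℤ, f ^ n ∈ R j := by
    intro j hj n
    rcases le_total n 0 with hn | hn
    · exact hpow j n hn
    · obtain ⟨m, rfl⟩ := Int.eq_ofNat_of_zero_le hn
      rw [zpow_natCast]
      exact pow_mem (hf j hj) m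
  have hw := mem_zero_of_eq_add_map hR hfin h fun j hj =>
    sum_mem fun n _ => mul_mem (hfix _ (ha n) j) (hpow' j hj n)
  -- Since `M ≥ 1` and `f⁻¹` is regular, so is `f ^ (1 - M)`. The product is `a M * f` plus terms
  -- with nonpositive powers of `f`, which are regular.
  have h1 : (a.sum fun n x => x * f ^ n) * f ^ (1 - M) ∈ R 0 :=
    mul_mem hw (hpow 0 _ (by omega))
  have h2 : a M * f ∈ R 0 := by
    rw [Finsupp.sum, ← Finset.add_sum_erase _ _ (Finsupp.mem_support_iff.2 haM), add_mul,
      mul_assoc, ← zpow_add₀ hfne, add_sub_cancel, zpow_one, Finset.sum_mul] at h1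
    refine (add_mem_cancel_right (sum_mem fun n hn => ?_)).1 h1
    rw [mul_assoc, ← zpow_add₀ hfne]
    refine mul_mem (hfix _ (ha n) 0) (hpow 0 _ ?_)
    have h3 := Finset.mem_erase.1 hn
    have h4 := Finset.le_max' _ _ h3.2
    rw [← hM] at h4
    have := h3.1
    omega
  apply hf0
  have h3 := mul_mem (hfix (a M)⁻¹ (by rw [map_inv₀, ha]) 0) h2
  rwa [inv_mul_cancel_left₀ haM] at h3

variable {A Ω : Type*} [CommRing A] [Algebra A K] [IsFractionRing A K] [Field Ω]

variable (K) in
/-- The fractions whose denominator does not vanish at a point. -/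
def regularSubring (e : A →+* Ω) : Subring K where
  carrier := {g | ∃ a b, e b ≠ 0 ∧ g * algebraMap A K b = algebraMap A K a}
  zero_mem' := ⟨0, 1, by simp, by simp⟩
  one_mem' := ⟨1, 1, by simp, by simp⟩
  add_mem' := by
    rintro g h ⟨a, b, hb, hg⟩ ⟨a', b', hb', hh⟩
    refine ⟨a * b' + a' * b, b * b', by rw [map_mul]; exact mul_ne_zero hb hb', ?_⟩
    simp only [map_add, map_mul, ← hg, ← hh]
    ring
  mul_mem' := by
    rintro g h ⟨a, b, hb, hg⟩ ⟨a', b', hb', hh⟩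
    refine ⟨a * a', b * b', by rw [map_mul]; exact mul_ne_zero hb hb', ?_⟩
    simp only [map_mul, ← hg, ← hh]
    ring
  neg_mem' := by
    rintro g ⟨a, b, hb, hg⟩
    exact ⟨-a, b, hb, by rw [neg_mul, hg, map_neg]⟩

omit [IsFractionRing A K] in
lemma div_mem_regularSubring (e : A →+* Ω) {q d : A} (hd : e d ≠ 0) (hd' : algebraMap A K d ≠ 0) :
    algebraMap A K q / algebraMap A K d ∈ regularSubring K e :=
  ⟨q, d, hd, div_mul_cancel₀ _ hd'⟩

lemma div_notMem_regularSubring (e : A →+* Ω) {q d : A} (hd : e d = 0) (hq : e q ≠ 0)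
    (hd' : algebraMap A K d ≠ 0) :
    algebraMap A K q / algebraMap A K d ∉ regularSubring K e := by
  rintro ⟨a, b, hb, h⟩
  rw [div_mul_eq_mul_div, div_eq_iff hd', ← map_mul, ← map_mul] at h
  have h1 := congrArg e (IsFractionRing.injective A K h)
  rw [map_mul, map_mul, hd, mul_zero] at h1
  exact mul_ne_zero hq hb h1

omit [IsFractionRing A K] in
lemma mem_regularSubring_comp_iff {τ : A ≃+* A}
    (hσ : ∀ a, σ (algebraMap A K a) = algebraMap A K (τ a)) {e e' : A →+* Ω}
    (he : ∀ a, e (τ a) = e' a) (g : K) :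
    g ∈ regularSubring K e' ↔ σ g ∈ regularSubring K e := by
  constructor
  · rintro ⟨a, b, hb, h⟩
    exact ⟨τ a, τ b, by rwa [he], by rw [← hσ, ← hσ, ← map_mul, h]⟩
  · rintro ⟨a, b, hb, h⟩
    obtain ⟨a, rfl⟩ := τ.surjective a
    obtain ⟨b, rfl⟩ := τ.surjective b
    refine ⟨a, b, by rwa [← he], σ.injective ?_⟩
    rw [map_mul, hσ, hσ, h]

lemma exists_forall_mem_regularSubring [IsDomain A] {e : ℤ → A →+* Ω}
    (he : ∀ b ≠ 0, {j | e j b = 0}.Finite) (g : K) :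
    ∃ N : ℕ, ∀ j : ℤ, (N : ℤ) ≤ |j| → g ∈ regularSubring K (e j) := by
  obtain ⟨a, b, hb, rfl⟩ := IsFractionRing.div_surjective (A := A) g
  have hb0 := nonZeroDivisors.ne_zero hb
  obtain ⟨N, hN⟩ := ((he b hb0).image Int.natAbs).bddAbove
  refine ⟨N + 1, fun j hj => div_mem_regularSubring _ (fun h => ?_)
    (IsFractionRing.to_map_ne_zero_of_mem_nonZeroDivisors hb)⟩
  have h1 : j.natAbs ≤ N := hN ⟨j, h, rfl⟩
  rw [Int.abs_eq_natAbs] at hj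
  omega

/-- A fraction `q / d` with a pole and a zero which are alone in their orbits. -/
theorem eq_zero_of_sum_zpow_eq_add_map [IsDomain A] {τ : A ≃+* A}
    (hσ : ∀ a, σ (algebraMap A K a) = algebraMap A K (τ a)) {e e' : ℤ → A →+* Ω}
    (he : ∀ j a, e j (τ a) = e (j + 1) a) (he' : ∀ j a, e' j (τ a) = e' (j + 1) a)
    (hfin : ∀ b ≠ 0, {j | e j b = 0}.Finite) (hfin' : ∀ b ≠ 0, {j | e' j b = 0}.Finite)
    {q d : A} (hq : ∀ j, e j q ≠ 0) (hd : ∀ j ≠ 0, e j d ≠ 0) (hd0 : e 0 d = 0)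
    (hd' : ∀ j, e' j d ≠ 0) (hq' : ∀ j ≠ 0, e' j q ≠ 0) (hq0 : e' 0 q = 0)
    {a : ℤ →₀ K} (ha : ∀ n, σ (a n) = a n) {p : K}
    (h : (a.sum fun n x => x * (algebraMap A K q / algebraMap A K d) ^ n) = p + σ p)
    (n : ℤ) (hn : n ≠ 0) : a n = 0 := by
  have hqK : algebraMap A K q ≠ 0 := by
    rw [Ne, FaithfulSMul.algebraMap_eq_zero_iff]
    rintro rfl
    exact hq 0 (map_zero _)
  have hdK : algebraMap A K d ≠ 0 := by
    rw [Ne, FaithfulSMul.algebraMap_eq_zero_iff]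
    rintro rfl
    exact hd' 0 (map_zero _)
  rcases hn.lt_or_gt with hn | hn
  -- Negative exponents become positive for `f⁻¹ = d / q`, whose pole lies on the orbit `e'`; the
  -- coefficients are reindexed by negation.
  · have h1 := eq_zero_of_pos_of_sum_eq (σ := σ) (R := fun j => regularSubring K (e' j))
      (f := algebraMap A K d / algebraMap A K q)
      (fun j => mem_regularSubring_comp_iff hσ (he' j))
      (exists_forall_mem_regularSubring hfin')
      (fun j hj => div_mem_regularSubring _ (hq' j hj) hqK)
      (fun j => by rw [inv_div]; exact div_mem_regularSubring _ (hd' j) hdK)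
      (div_notMem_regularSubring _ hq0 (hd' 0) hqK)
      (a := a.equivMapDomain (Equiv.neg ℤ)) (p := p)
      (fun n => by rw [Finsupp.equivMapDomain_apply, ha])
      (by
        rw [← h, Finsupp.equivMapDomain_eq_mapDomain, Finsupp.sum_mapDomain_index (by simp)
          (fun _ _ _ => add_mul _ _ _)]
        refine Finsupp.sum_congr fun n _ => ?_
        rw [Equiv.neg_apply, ← inv_div (algebraMap A K q), inv_zpow', neg_neg])
      (-n) (by omega)
    simpa [Finsupp.equivMapDomain_apply] using h1
  · exact eq_zero_of_pos_of_sum_eq (σ := σ) (R := fun j => regularSubring K (e j))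
      (fun j => mem_regularSubring_comp_iff hσ (he j))
      (exists_forall_mem_regularSubring hfin)
      (fun j hj => div_mem_regularSubring _ (hd j hj) hdK)
      (fun j => by rw [inv_div]; exact div_mem_regularSubring _ (hq j) hqK)
      (div_notMem_regularSubring _ hd0 (hq 0) hdK) ha h n hn

end RegularPoints

end

noncomputable section

/-! ### The shift on `k(z, t)` and the zeros and poles of the fractions used -/

section RationalFunctions

open Polynomial

variable {k : Type*} [Field k]

/-- The automorphism `t ↦ t + m` of `k[z][t]`. -/
def shiftEquiv (k : Type*) [Field k] (m : ℕ) : k[X][X] ≃+* k[X][X] :=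
  (algEquivAevalXAddC (m : k[X])).toRingEquiv

section Shift

variable (k) (K : Type*) [Field K] [Algebra k[X][X] K] [IsFractionRing k[X][X] K]

/-- The endomorphism `t ↦ t + m` of `k(z, t)`. -/
def shift (m : ℕ) : K →+* K :=
  (IsFractionRing.ringEquivOfRingEquiv (K := K) (L := K) (shiftEquiv k m) : K ≃+* K)

lemma shift_algebraMap (m : ℕ) (a : k[X][X]) :
    shift k K m (algebraMap _ K a) = algebraMap _ K (shiftEquiv k m a) :=
  IsFractionRing.ringEquivOfRingEquiv_algebraMap _ a

end Shift

lemma shiftEquiv_X (m : ℕ) : shiftEquiv k m X = X + (m : k[X][X]) := by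
  change aeval (X + C (m : k[X])) X = _
  simp

lemma shiftEquiv_C (m : ℕ) (p : k[X]) : shiftEquiv k m (C p) = C p := by
  change aeval (X + C (m : k[X])) (C p) = _
  simp

variable {Ω : Type*} [Field Ω] [Algebra k Ω]

/-- Evaluation at `z = ζ`, `t = α`. -/
def evalAt (k : Type*) [Field k] {Ω : Type*} [Field Ω] [Algebra k Ω] (ζ α : Ω) : k[X][X] →+* Ω :=
  eval₂RingHom (aeval ζ : k[X] →ₐ[k] Ω).toRingHom α

@[simp] lemma evalAt_X (ζ α : Ω) : evalAt k ζ α X = α := by simp [evalAt]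

@[simp] lemma evalAt_C (ζ α : Ω) (p : k[X]) : evalAt k ζ α (C p) = aeval ζ p := by
  simp [evalAt]

lemma evalAt_shiftEquiv (ζ α : Ω) (m : ℕ) (a : k[X][X]) :
    evalAt k ζ α (shiftEquiv k m a) = evalAt k ζ (α + m) a := by
  have : (evalAt k ζ α).comp (shiftEquiv k m : k[X][X] →+* k[X][X]) = evalAt k ζ (α + m) := by
    apply Polynomial.ringHom_ext
    · intro p
      simp [shiftEquiv_C]
    · simp [shiftEquiv_X]
  exact RingHom.congr_fun this a

lemma evalAt_shiftEquiv_orbit (ζ α : Ω) (m : ℕ) (j : ℤ) (a : k[X][X]) :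
    evalAt k ζ (α + m * j) (shiftEquiv k m a) = evalAt k ζ (α + m * (j + 1 : ℤ)) a := by
  rw [evalAt_shiftEquiv]
  congr 2
  push_cast
  ring

/-- Transcendence of `ζ` keeps `b` nonzero after the substitution `z = ζ`. It then has finitely many
roots in `t`, and distinct `j` give distinct points. -/
lemma finite_setOf_evalAt_eq_zero [CharZero Ω] {ζ : Ω} (hζ : Transcendental k ζ) (α : Ω) {m : ℕ}
    (hm : m ≠ 0) (b : k[X][X]) (hb : b ≠ 0) :
    {j : ℤ | evalAt k ζ (α + m * j) b = 0}.Finite := by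
  classical
  have hinj := transcendental_iff_injective.1 hζ
  have h0 : b.map (aeval ζ : k[X] →ₐ[k] Ω).toRingHom ≠ 0 :=
    (Polynomial.map_ne_zero_iff hinj).2 hb
  have h1 := (b.map (aeval ζ : k[X] →ₐ[k] Ω).toRingHom).roots.toFinset.finite_toSet
  refine (h1.preimage (f := fun j : ℤ => α + m * (j : Ω)) ?_).subset ?_
  · intro i _ j _ hij
    simpa [hm] using hij
  · intro j hj
    simp only [Set.mem_preimage, Finset.mem_coe, Multiset.mem_toFinset]
    rw [mem_roots h0, IsRoot, eval_map]
    exact hj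

variable (K : Type*) [Field K] [Algebra k[X][X] K]

variable (k) in
/-- The fraction `(t - 1/3) / (t + 1/3)`. -/
def fracS : K :=
  algebraMap k[X][X] _ (X - C (C (1 / 3))) / algebraMap k[X][X] _ (X + C (C (1 / 3)))

/-- For `P = 2 (9 t² + 1) / (9 t² - 1)`, the fraction `1 + (A / B) P ^ i`. -/
def fracP (A B : k[X]) (i : ℕ) : K :=
  algebraMap k[X][X] _ (C B * (9 * X ^ 2 - 1) ^ i + C A * (2 * (9 * X ^ 2 + 1)) ^ i) /
    algebraMap k[X][X] _ (C B * (9 * X ^ 2 - 1) ^ i)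

variable [CharZero k] {K} [IsFractionRing k[X][X] K]

/-- The only pole `-1/3` and the only zero `1/3` differ by `2/3`, which is not an integer, so they
lie on different orbits. -/
lemma sum_fracS_zpow_eq {m : ℕ} (hm : m ≠ 0) {a : ℤ →₀ K}
    (ha : ∀ n, shift k K m (a n) = a n) {p : K}
    (h : (a.sum fun n x => x * fracS k K ^ n) = p + shift k K m p) (n : ℤ) (hn : n ≠ 0) :
    a n = 0 := by
  have hζ : Transcendental k (RatFunc.X : RatFunc k) := RatFunc.transcendental_X
  have hchar : CharZero (RatFunc k) := charZero_of_injective_algebraMap (algebraMap k _).injective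
  have h3 : ∀ j : ℤ, (m : RatFunc k) * j ≠ 2 / 3 := by
    intro j hj
    rw [eq_div_iff (by norm_num)] at hj
    have : (m : ℤ) * j * 3 = 2 := by exact_mod_cast hj
    omega
  have h3' : ∀ j : ℤ, (m : RatFunc k) * j ≠ -(2 / 3) := by
    intro j hj
    refine h3 (-j) ?_
    push_cast
    linear_combination -hj
  have hmj : ∀ j : ℤ, j ≠ 0 → (m : RatFunc k) * j ≠ 0 := by
    intro j hj
    exact mul_ne_zero (by exact_mod_cast hm) (by exact_mod_cast hj)
  refine eq_zero_of_sum_zpow_eq_add_map (shift_algebraMap k K m)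
    (e := fun j => evalAt k (Ω := RatFunc k) RatFunc.X (-(1 / 3) + m * j))
    (e' := fun j => evalAt k (Ω := RatFunc k) RatFunc.X (1 / 3 + m * j))
    (fun j => evalAt_shiftEquiv_orbit _ _ m j) (fun j => evalAt_shiftEquiv_orbit _ _ m j)
    (finite_setOf_evalAt_eq_zero hζ _ hm) (finite_setOf_evalAt_eq_zero hζ _ hm)
    ?_ ?_ ?_ ?_ ?_ ?_ ha h n hn
  · intro j hj
    simp only [map_sub, map_div₀, map_one, map_ofNat, evalAt_X, evalAt_C,
      aeval_C] at hj
    exact h3 j (by linear_combination hj)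
  · intro j hj h0
    simp only [map_add, map_div₀, map_one, map_ofNat, evalAt_X, evalAt_C,
      aeval_C] at h0
    exact hmj j hj (by linear_combination h0)
  · simp only [map_add, map_div₀, map_one, map_ofNat, evalAt_X, evalAt_C,
      aeval_C]
    simp
  · intro j hj
    simp only [map_add, map_div₀, map_one, map_ofNat, evalAt_X, evalAt_C,
      aeval_C] at hj
    exact h3' j (by linear_combination hj)
  · intro j hj h0
    simp only [map_sub, map_div₀, map_one, map_ofNat, evalAt_X, evalAt_C,
      aeval_C] at h0
    exact hmj j hj (by linear_combination h0)
  · simp only [map_sub, map_div₀, map_one, map_ofNat, evalAt_X, evalAt_C,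
      aeval_C]
    simp

omit [CharZero k]

/-- With `x = m j`, the expression is `3 x (3 x + 2)`, and `3 x + 2` does not vanish for an integer
`x`. -/
lemma nine_mul_sq_sub_one_ne_zero [CharZero Ω] {m : ℕ} (hm : m ≠ 0) {j : ℤ} (hj : j ≠ 0) :
    9 * (1 / 3 + (m : Ω) * j) ^ 2 - 1 ≠ 0 := by
  intro h
  have h1 : ((m : Ω) * j) * (3 * (m * j) + 2) = 0 := by linear_combination h / 3
  have h2 := (mul_eq_zero.1 h1).resolve_left
    (mul_ne_zero (by exact_mod_cast hm) (by exact_mod_cast hj))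
  have h3 : 3 * ((m : ℤ) * j) + 2 = 0 := by exact_mod_cast h2
  omega

section AlgebraicPoints

variable [CharZero Ω] {a b : Ω}

/-- A zero at an algebraic point would make `a / b` algebraic. If `9 τ² + 1 = 0`, this division is
impossible, but then `9 τ² - 1 = -2`. -/
lemma add_ne_zero_of_mem_algebraicClosure (hb : b ≠ 0) (hab : a / b ∉ algebraicClosure k Ω)
    (i : ℕ) {τ : Ω} (hτ : τ ∈ algebraicClosure k Ω) :
    b * (9 * τ ^ 2 - 1) ^ i + a * (2 * (9 * τ ^ 2 + 1)) ^ i ≠ 0 := by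
  intro h
  by_cases hn : 2 * (9 * τ ^ 2 + 1) = 0
  · have hd : 9 * τ ^ 2 - 1 ≠ 0 := by
      intro hd
      have : (4 : Ω) = 0 := by linear_combination hn - 2 * hd
      norm_num at this
    rw [hn] at h
    rcases Nat.eq_zero_or_pos i with rfl | hi
    · apply hab
      have : a / b = -1 := by
        rw [div_eq_iff hb]; linear_combination h
      rw [this]
      exact neg_mem (one_mem _)
    · rw [zero_pow hi.ne', mul_zero, add_zero] at h
      exact mul_ne_zero hb (pow_ne_zero _ hd) h
  · apply hab
    have h1 : a / b = -((9 * τ ^ 2 - 1) ^ i / (2 * (9 * τ ^ 2 + 1)) ^ i) := by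
      rw [div_eq_iff hb, ← neg_div, div_mul_eq_mul_div, eq_div_iff (pow_ne_zero _ hn)]
      linear_combination h
    rw [h1]
    have h9 : 9 * τ ^ 2 ∈ algebraicClosure k Ω := mul_mem (ofNat_mem _ 9) (pow_mem hτ 2)
    exact neg_mem (div_mem (pow_mem (sub_mem h9 (one_mem _)) i)
      (pow_mem (mul_mem (ofNat_mem _ 2) (add_mem h9 (one_mem _))) i))

omit [CharZero Ω] in
lemma mem_algebraicClosure_of_sq_mem {τ : Ω} (h : τ ^ 2 ∈ algebraicClosure k Ω) :
    τ ∈ algebraicClosure k Ω :=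
  mem_algebraicClosure_iff.2 ((mem_algebraicClosure_iff.1 h).of_pow two_pos)

lemma sub_ne_zero_of_notMem_algebraicClosure {τ : Ω} (hτ : τ ∉ algebraicClosure k Ω) :
    9 * τ ^ 2 - 1 ≠ 0 := by
  intro h
  apply hτ
  apply mem_algebraicClosure_of_sq_mem
  have : τ ^ 2 = 1 / 9 := by
    rw [eq_div_iff (by norm_num)]; linear_combination h
  rw [this]
  exact div_mem (one_mem _) (ofNat_mem _ 9)

/-- Put `P(τ) = 2 (9 τ² + 1) / (9 τ² - 1)`. Two zeros `τ`, `τ'` satisfy `P(τ')^i = P(τ)^i`. Now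
`P(τ') = P(τ)` means `τ' = ±τ`, and `P(τ') = -P(τ)` means `9 τ τ' = ±1`. If `τ' - τ` is algebraic
and nonzero, each case makes `τ` algebraic. -/
lemma add_ne_zero_of_notMem_algebraicClosure (ha : a ≠ 0) (hb : b ≠ 0) {i : ℕ}
    (hi : i = 1 ∨ i = 2) {τ : Ω} (hτ : τ ∉ algebraicClosure k Ω)
    (h : b * (9 * τ ^ 2 - 1) ^ i + a * (2 * (9 * τ ^ 2 + 1)) ^ i = 0)
    {r : Ω} (hr : r ∈ algebraicClosure k Ω) (hr0 : r ≠ 0) :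
    b * (9 * (τ + r) ^ 2 - 1) ^ i + a * (2 * (9 * (τ + r) ^ 2 + 1)) ^ i ≠ 0 := by
  intro h'
  have h1 : a * b * (((9 * τ ^ 2 - 1) * (2 * (9 * (τ + r) ^ 2 + 1))) ^ i -
      ((9 * (τ + r) ^ 2 - 1) * (2 * (9 * τ ^ 2 + 1))) ^ i) = 0 := by
    generalize 9 * τ ^ 2 - 1 = x at *
    generalize 2 * (9 * τ ^ 2 + 1) = y at *
    generalize 9 * (τ + r) ^ 2 - 1 = x' at *
    generalize 2 * (9 * (τ + r) ^ 2 + 1) = y' at *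
    rw [mul_pow, mul_pow]
    linear_combination (a * y' ^ i) * h - (a * y ^ i) * h'
  have h2 := sub_eq_zero.1 ((mul_eq_zero.1 h1).resolve_left (mul_ne_zero ha hb))
  have h3 : (9 * τ ^ 2 - 1) * (2 * (9 * (τ + r) ^ 2 + 1)) =
        (9 * (τ + r) ^ 2 - 1) * (2 * (9 * τ ^ 2 + 1)) ∨
      (9 * τ ^ 2 - 1) * (2 * (9 * (τ + r) ^ 2 + 1)) =
        -((9 * (τ + r) ^ 2 - 1) * (2 * (9 * τ ^ 2 + 1))) := by
    rcases hi with rfl | rfl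
    · exact Or.inl (by simpa only [pow_one] using h2)
    · exact sq_eq_sq_iff_eq_or_eq_neg.1 h2
  have h2mem : (2 : Ω) ∈ algebraicClosure k Ω := ofNat_mem _ 2
  rcases h3 with h3 | h3
  · have h4 : r * (2 * τ + r) = 0 := by linear_combination (-1 / 36 : Ω) * h3
    have h5 := (mul_eq_zero.1 h4).resolve_left hr0
    apply hτ
    have h6 : τ = -r / 2 := by linear_combination h5 / 2
    rw [h6]
    exact div_mem (neg_mem hr) h2mem
  · have h4 : (9 * (τ * (τ + r)) - 1) * (9 * (τ * (τ + r)) + 1) = 0 := by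
      linear_combination (1 / 4 : Ω) * h3
    have h5 : τ * (τ + r) ∈ algebraicClosure k Ω := by
      rcases mul_eq_zero.1 h4 with h5 | h5
      · have h6 : τ * (τ + r) = 1 / 9 := by linear_combination h5 / 9
        rw [h6]
        exact div_mem (one_mem _) (ofNat_mem _ 9)
      · have h6 : τ * (τ + r) = -(1 / 9) := by linear_combination h5 / 9
        rw [h6]
        exact neg_mem (div_mem (one_mem _) (ofNat_mem _ 9))
    -- Completing the square in `τ (τ + r)`, which is algebraic.
    have h6 : (τ + r / 2) ^ 2 ∈ algebraicClosure k Ω := by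
      have : (τ + r / 2) ^ 2 = τ * (τ + r) + (r / 2) ^ 2 := by ring
      rw [this]
      exact add_mem h5 (pow_mem (div_mem hr h2mem) 2)
    apply hτ
    have h7 := sub_mem (mem_algebraicClosure_of_sq_mem h6) (div_mem hr h2mem)
    rwa [add_sub_cancel_right] at h7

/-- It suffices to solve `P(τ) = ρ` with `ρ ^ i = -b / a`. This equation is a Möbius one in `τ²`,
with solution `τ² = (ρ + 2) / (9 (ρ - 2))`. Since `a / b` is not algebraic, neither is `ρ`, so `ρ ≠
2` and `τ` is not algebraic. -/
lemma exists_notMem_algebraicClosure [IsAlgClosed Ω] (ha : a ≠ 0)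
    (hab : a / b ∉ algebraicClosure k Ω) {i : ℕ} (hi : 0 < i) :
    ∃ τ ∉ algebraicClosure k Ω, b * (9 * τ ^ 2 - 1) ^ i + a * (2 * (9 * τ ^ 2 + 1)) ^ i = 0 := by
  obtain ⟨ρ, hρ⟩ := IsAlgClosed.exists_pow_nat_eq (-(b / a)) hi
  have hρmem : ρ ∉ algebraicClosure k Ω := by
    intro h
    apply hab
    have h1 : a / b = -(ρ ^ i)⁻¹ := by rw [hρ, inv_neg, neg_neg, inv_div]
    rw [h1]
    exact neg_mem (inv_mem (pow_mem h i))
  have h2 : ρ - 2 ≠ 0 := by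
    intro h
    rw [sub_eq_zero.1 h] at hρmem
    exact hρmem (ofNat_mem _ 2)
  obtain ⟨τ, hτ⟩ := IsAlgClosed.exists_pow_nat_eq ((ρ + 2) / (9 * (ρ - 2))) two_pos
  have h3 : 9 * τ ^ 2 - 1 = 4 / (ρ - 2) := by rw [hτ]; field_simp; ring
  have h4 : 2 * (9 * τ ^ 2 + 1) = ρ * (4 / (ρ - 2)) := by rw [hτ]; field_simp; ring
  have h5 : 4 / (ρ - 2) ≠ 0 := div_ne_zero (by norm_num) h2
  refine ⟨τ, fun h => hρmem ?_, ?_⟩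
  · have h6 : ρ = 2 * (9 * τ ^ 2 + 1) / (9 * τ ^ 2 - 1) := by
      rw [h4, h3, mul_div_cancel_right₀ _ h5]
    have h9 : 9 * τ ^ 2 ∈ algebraicClosure k Ω := mul_mem (ofNat_mem _ 9) (pow_mem h 2)
    rw [h6]
    exact div_mem (mul_mem (ofNat_mem _ 2) (add_mem h9 (one_mem _))) (sub_mem h9 (one_mem _))
  · rw [h3, h4, mul_pow, hρ]
    have h6 : a * (b / a) = b := mul_div_cancel₀ b ha
    linear_combination -(4 / (ρ - 2)) ^ i * h6

end AlgebraicPoints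

/-- The pole is taken at `t = 1/3`, whose orbit is algebraic and so avoids all zeros. The zero is
taken at a transcendental `τ`, whose orbit avoids the algebraic poles `±1/3`. Finding `τ` requires
the algebraic closure of `k(z)`. -/
lemma sum_fracP_zpow_eq [CharZero k] {m : ℕ} (hm : m ≠ 0) {A B : k[X]} (hA : A ≠ 0) (hB : B ≠ 0)
    (hAB : Transcendental k (aeval (RatFunc.X : RatFunc k) A / aeval (RatFunc.X : RatFunc k) B))
    {i : ℕ} (hi : i = 1 ∨ i = 2)
    {a : ℤ →₀ K}
    (ha : ∀ n, shift k K m (a n) = a n) {p : K}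
    (h : (a.sum fun n x => x * fracP K A B i ^ n) = p + shift k K m p) (n : ℤ) (hn : n ≠ 0) :
    a n = 0 := by
  let Ω := AlgebraicClosure (RatFunc k)
  let ζ : Ω := algebraMap (RatFunc k) Ω RatFunc.X
  have hζ : Transcendental k ζ :=
    (transcendental_algebraMap_iff (algebraMap (RatFunc k) Ω).injective).2 RatFunc.transcendental_X
  have hchar : CharZero Ω := charZero_of_injective_algebraMap (algebraMap k _).injective
  have hinj := transcendental_iff_injective.1 hζ
  have hA' : aeval ζ A ≠ 0 := (map_ne_zero_iff _ hinj).2 hA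
  have hB' : aeval ζ B ≠ 0 := (map_ne_zero_iff _ hinj).2 hB
  have hab : aeval ζ A / aeval ζ B ∉ algebraicClosure k Ω := by
    rw [aeval_algebraMap_apply, aeval_algebraMap_apply, ← map_div₀, mem_algebraicClosure_iff]
    exact (transcendental_algebraMap_iff (algebraMap (RatFunc k) Ω).injective).2 hAB
  have hi0 : 0 < i := by omega
  obtain ⟨τ, hτ, hτ0⟩ := exists_notMem_algebraicClosure (k := k) hA' hab hi0
  have hmj : ∀ j : ℤ, (m : Ω) * j ∈ algebraicClosure k Ω :=
    fun j => mul_mem (natCast_mem _ m) (intCast_mem _ j)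
  have hmj0 : ∀ j : ℤ, j ≠ 0 → (m : Ω) * j ≠ 0 := by
    intro j hj
    exact mul_ne_zero (by exact_mod_cast hm) (by exact_mod_cast hj)
  have h13 : (1 / 3 : Ω) ∈ algebraicClosure k Ω := div_mem (one_mem _) (ofNat_mem _ 3)
  refine eq_zero_of_sum_zpow_eq_add_map (shift_algebraMap k K m)
    (e := fun j => evalAt k ζ (1 / 3 + m * j))
    (e' := fun j => evalAt k ζ (τ + m * j))
    (fun j => evalAt_shiftEquiv_orbit _ _ m j) (fun j => evalAt_shiftEquiv_orbit _ _ m j)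
    (finite_setOf_evalAt_eq_zero hζ _ hm) (finite_setOf_evalAt_eq_zero hζ _ hm)
    ?_ ?_ ?_ ?_ ?_ ?_ ha h n hn
  · intro j
    simp only [map_add, map_mul, map_pow, map_sub, map_one, map_ofNat, evalAt_X, evalAt_C]
    exact add_ne_zero_of_mem_algebraicClosure hB' hab i (add_mem h13 (hmj j))
  · intro j hj
    simp only [map_mul, map_pow, map_sub, map_one, map_ofNat, evalAt_X, evalAt_C]
    refine mul_ne_zero hB' (pow_ne_zero _ fun h0 => ?_)
    exact nine_mul_sq_sub_one_ne_zero hm hj h0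
  · simp only [map_mul, map_pow, map_sub, map_one, map_ofNat, evalAt_X, evalAt_C]
    have : (9 * (1 / 3 + (m : Ω) * ((0 : ℤ) : Ω)) ^ 2 - 1) = 0 := by norm_num
    rw [this, zero_pow hi0.ne', mul_zero]
  · intro j
    simp only [map_mul, map_pow, map_sub, map_one, map_ofNat, evalAt_X, evalAt_C]
    refine mul_ne_zero hB' (pow_ne_zero _ (sub_ne_zero_of_notMem_algebraicClosure (k := k) ?_))
    intro h0
    have := sub_mem h0 (hmj j)
    rw [add_sub_cancel_right] at this
    exact hτ this
  · intro j hj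
    simp only [map_add, map_mul, map_pow, map_sub, map_one, map_ofNat, evalAt_X, evalAt_C]
    exact add_ne_zero_of_notMem_algebraicClosure hA' hB' hi hτ hτ0 (hmj j) (hmj0 j hj)
  · simpa only [map_add, map_mul, map_pow, map_sub, map_one, map_ofNat, evalAt_X, evalAt_C,
      Int.cast_zero, mul_zero, add_zero] using hτ0

end RationalFunctions

end

noncomputable section

open Polynomial OreLocalization nonZeroDivisors

universe u

/-! ### The field `k(z, t)` inside the division ring -/

namespace DHeis

variable (k : Type u) [Field k] [CharZero k]

lemma y_mul_x : y k * x k = x k * y k + z k := by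
  have h := UHeis.z_eq k
  rw [eq_sub_iff_add_eq] at h
  have h1 := congrArg (numeratorRingHom (S := (UHeis k)⁰)) h
  rw [map_add, map_mul, map_mul] at h1
  exact h1.symm.trans (add_comm _ _)

lemma commute_z_x : Commute (z k) (x k) := (UHeis.comm_zx k).map numeratorRingHom

lemma commute_z_y : Commute (z k) (y k) := (UHeis.comm_zy k).map numeratorRingHom

lemma numeratorRingHom_injective :
    Function.Injective (numeratorRingHom : UHeis k →+* DHeis k) :=
  numeratorHom_inj (R := UHeis k) (S := (UHeis k)⁰) inf_le_left

lemma aeval_z_injective : Function.Injective (aeval (z k) : k[X] →ₐ[k] DHeis k) := by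
  have h : (aeval (z k) : k[X] →ₐ[k] DHeis k).toRingHom =
      numeratorRingHom.comp ((UHeis.poly k).comp C) := by
    apply Polynomial.ringHom_ext
    · intro r
      simp
      rfl
    · simp
      rfl
  intro p q hpq
  have h1 := RingHom.congr_fun h p
  have h2 := RingHom.congr_fun h q
  exact C_injective (UHeis.poly_injective k (numeratorRingHom_injective k
    (h1.symm.trans (hpq.trans h2))))

lemma z_ne_zero : z k ≠ 0 := by
  intro h
  refine X_ne_zero (R := k) (aeval_z_injective k ?_)
  rw [aeval_X, map_zero, h]

lemma y_ne_zero : y k ≠ 0 := by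
  intro h
  have h1 := y_mul_x k
  rw [h, zero_mul, mul_zero, zero_add] at h1
  exact z_ne_zero k h1.symm

/-- The element `V z⁻¹`, on which `y` acts by translation. -/
def t : DHeis k := V k * (z k)⁻¹

lemma t_mul_z : t k * z k = V k := by
  rw [t, inv_mul_cancel_right₀ (z_ne_zero k)]

lemma commute_z_V : Commute (z k) (V k) :=
  ((((commute_z_x k).mul_right (commute_z_y k)).add_right
    ((commute_z_y k).mul_right (commute_z_x k))).smul_right _)

lemma commute_z_t : Commute (z k) (t k) :=
  (commute_z_V k).mul_right (Commute.inv_right₀ (Commute.refl _))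

lemma y_mul_V : y k * V k = V k * y k + z k * y k := by
  have h : y k * (x k * y k + y k * x k) =
      (x k * y k + y k * x k) * y k + (2 : k) • (z k * y k) := by
    have h1 := y_mul_x k
    have h2 : y k * z k = z k * y k := (commute_z_y k).eq.symm
    rw [two_smul, h1, mul_add, mul_add, ← mul_assoc, h1, h2]
    noncomm_ring
  rw [V, mul_smul_comm, h, smul_add, smul_smul, smul_mul_assoc]
  norm_num

lemma semiconjBy_y_t : SemiconjBy (y k) (t k) (t k + 1) := by
  have h : (z k)⁻¹ * y k = y k * (z k)⁻¹ := (commute_z_y k).inv_left₀.eq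
  change y k * t k = _
  rw [t, ← mul_assoc, y_mul_V, add_mul, mul_assoc (V k), ← h, mul_assoc (z k), ← h,
    mul_inv_cancel_left₀ (z_ne_zero k), add_mul, one_mul, mul_assoc]

lemma semiconjBy_y_pow_t (m : ℕ) : SemiconjBy (y k ^ m) (t k) (t k + m) := by
  induction m with
  | zero => simp
  | succ m ih =>
    rw [pow_succ']
    have h := (semiconjBy_y_t k).add_right
      (show SemiconjBy (y k) (m : DHeis k) m from (Nat.cast_commute m (y k)).symm)
    rw [add_right_comm] at h
    rw [Nat.cast_succ, ← add_assoc]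
    exact h.mul_left ih

/-- Polynomials in the commuting elements `z` and `t`. -/
def polyHom : k[X][X] →+* DHeis k :=
  eval₂RingHom' (aeval (z k) : k[X] →ₐ[k] DHeis k).toRingHom (t k) (by
    intro q
    induction q using Polynomial.induction_on' with
    | add p q hp hq => simpa using hp.add_left hq
    | monomial n c =>
      simpa [aeval_monomial] using
        (Algebra.commute_algebraMap_left c (t k)).mul_left ((commute_z_t k).pow_left n))

@[simp] lemma polyHom_X : polyHom k X = t k := by simp [polyHom]

@[simp] lemma polyHom_C (p : k[X]) : polyHom k (C p) = aeval (z k) p := by simp [polyHom]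

variable {k} in
lemma semiconjBy_polyHom {m : ℕ} {c : DHeis k} (hz : Commute c (z k))
    (ht : SemiconjBy c (t k) (t k + m)) (p : k[X][X]) :
    SemiconjBy c (polyHom k p) (polyHom k (shiftEquiv k m p)) := by
  have hC : ∀ q : k[X], Commute c (aeval (z k) q) := by
    intro q
    induction q using Polynomial.induction_on' with
    | add p q hp hq => rw [map_add]; exact hp.add_right hq
    | monomial n r =>
      rw [aeval_monomial]
      exact (Algebra.commute_algebraMap_right r c).mul_right (hz.pow_right n)
  induction p using Polynomial.induction_on' with
  | add p q hp hq => simp only [map_add]; exact hp.add_right hq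
  | monomial n q =>
    rw [← C_mul_X_pow_eq_monomial]
    simp only [map_mul, map_pow, shiftEquiv_C, shiftEquiv_X, map_add, map_natCast, polyHom_X,
      polyHom_C]
    exact SemiconjBy.mul_right (hC q) (ht.pow_right n)

/-- Since `y` conjugates `t` to `t + 1`, the kernel is stable under the shift. For `p` in the
kernel, the difference of its shift and `p` has lower degree, so it vanishes by induction. A
shift-invariant polynomial is constant in characteristic zero, and `z` is transcendental. -/
lemma polyHom_injective : Function.Injective (polyHom k) := by
  rw [injective_iff_map_eq_zero]
  suffices key : ∀ n : ℕ, ∀ p : k[X][X], p.natDegree ≤ n → polyHom k p = 0 → p = 0 from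
    fun p => key _ p le_rfl
  have hconst : ∀ p : k[X][X], p.natDegree = 0 → polyHom k p = 0 → p = 0 := by
    intro p hp h
    rw [eq_C_of_natDegree_eq_zero hp, polyHom_C] at h
    rw [eq_C_of_natDegree_eq_zero hp, aeval_z_injective k (h.trans (map_zero _).symm), C_0]
  intro n
  induction n with
  | zero => exact fun p hp => hconst p (Nat.le_zero.1 hp)
  | succ n ih =>
    intro p hp h
    by_cases hp0 : p.natDegree = 0
    · exact hconst p hp0 h
    have hshift : shiftEquiv k 1 p = p.comp (X + C 1) := by
      change aeval (X + C ((1 : ℕ) : k[X])) p = _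
      rw [Nat.cast_one, aeval_def, comp, algebraMap_eq]
    have h1 : polyHom k (shiftEquiv k 1 p) = 0 := by
      have h2 := semiconjBy_polyHom (m := 1) (commute_z_y k).symm
        (by simpa using semiconjBy_y_t k) p
      rw [SemiconjBy, h, mul_zero, eq_comm] at h2
      exact (mul_eq_zero.1 h2).resolve_right (y_ne_zero k)
    have hpne : p ≠ 0 := by rintro rfl; simp at hp0
    have hdeg : (p.comp (X + C 1)).natDegree = p.natDegree := by
      rw [natDegree_comp, natDegree_X_add_C, mul_one]
    have hlc : (p.comp (X + C 1)).leadingCoeff = p.leadingCoeff := by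
      rw [leadingCoeff_comp (by rw [natDegree_X_add_C]; exact one_ne_zero), leadingCoeff_X_add_C,
        one_pow, mul_one]
    have hcompne : p.comp (X + C 1) ≠ 0 := by
      rw [← leadingCoeff_ne_zero, hlc, leadingCoeff_ne_zero]
      exact hpne
    have hlt := degree_sub_lt_left (by
      rw [degree_eq_natDegree hcompne, degree_eq_natDegree hpne, hdeg]) hcompne hlc
    have hr : p.comp (X + C 1) - p = 0 := by
      apply ih
      · rw [degree_eq_natDegree hcompne, hdeg] at hlt
        by_cases hr0 : p.comp (X + C 1) - p = 0
        · rw [hr0]; simp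
        · have := (natDegree_lt_iff_degree_lt hr0).2 hlt
          omega
      · rw [map_sub, ← hshift, h1, h, sub_zero]
    rw [sub_eq_zero] at hr
    have hev : ∀ n : ℕ, p.eval (n : k[X]) = p.eval 0 := by
      intro n
      induction n with
      | zero => simp
      | succ n ihn =>
        rw [← ihn]
        conv_rhs => rw [← hr]
        simp [eval_comp]
    have hpc : p = C (p.eval 0) := by
      refine eq_of_infinite_eval_eq _ _ ((Set.infinite_range_of_injective
        (Nat.cast_injective (R := k[X]))).mono ?_)
      rintro _ ⟨n, rfl⟩
      simpa using hev n
    exact absurd (by rw [hpc, natDegree_C]) hp0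

lemma polyHom_ne_zero (s : k[X][X]⁰) : polyHom k s ≠ 0 := by
  rw [Ne, map_eq_zero_iff _ (polyHom_injective k)]
  exact nonZeroDivisors.ne_zero s.2

/-- The invertible values of `polyHom`. -/
def polyHomUnits : k[X][X]⁰ →* (DHeis k)ˣ where
  toFun s := Units.mk0 _ (polyHom_ne_zero k s)
  map_one' := Units.ext (map_one (polyHom k))
  map_mul' a b := Units.ext (map_mul (polyHom k) (a : k[X][X]) b)

/-- The embedding of the field `k(z, t)`. -/
def fracHom : FractionRing k[X][X] →+* DHeis k :=
  universalHom (polyHom k) (polyHomUnits k) (fun _ => rfl)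

lemma fracHom_algebraMap (p : k[X][X]) : fracHom k (algebraMap _ _ p) = polyHom k p :=
  universalHom_commutes _ _ _

lemma fracHom_algebraMap_field (r : k) :
    fracHom k (algebraMap k (FractionRing k[X][X]) r) = algebraMap k (DHeis k) r := by
  rw [IsScalarTower.algebraMap_apply k k[X][X], fracHom_algebraMap]
  change polyHom k (C (C r)) = _
  rw [polyHom_C, aeval_C]

variable {k} in
lemma semiconjBy_fracHom {m : ℕ} {c : DHeis k} (hz : Commute c (z k))
    (ht : SemiconjBy c (t k) (t k + m)) (a : FractionRing k[X][X]) :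
    SemiconjBy c (fracHom k a) (fracHom k (shift k _ m a)) := by
  obtain ⟨p, q, hq, rfl⟩ := IsFractionRing.div_surjective (A := k[X][X]) a
  rw [div_eq_mul_inv, map_mul, map_mul, map_inv₀, map_inv₀, map_mul, map_inv₀, shift_algebraMap,
    shift_algebraMap]
  simp only [fracHom_algebraMap]
  exact (semiconjBy_polyHom hz ht p).mul_right (semiconjBy_polyHom hz ht q).inv_right₀

/-- The action of `k(z, t)` by left multiplication. -/
abbrev fracModule : Module (FractionRing k[X][X]) (DHeis k) := Module.compHom _ (fracHom k)

end DHeis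

end

noncomputable section

open Polynomial OreLocalization nonZeroDivisors

universe u

namespace DHeis

variable (k : Type u) [Field k] [CharZero k]

/-! ### Freeness for a fraction and its conjugate in the division ring -/

section Free

attribute [local instance] fracModule

instance : IsScalarTower (FractionRing k[X][X]) (DHeis k) (DHeis k) :=
  ⟨fun a d d' => mul_assoc (fracHom k a) d d'⟩

instance : IsScalarTower k (FractionRing k[X][X]) (DHeis k) :=
  ⟨fun r a d => by
    change fracHom k (r • a) * d = r • (fracHom k a * d)
    rw [Algebra.smul_def, map_mul, fracHom_algebraMap_field, Algebra.smul_def, mul_assoc]⟩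

variable {k} {m : ℕ} {Z : DHeis k}

/-- Only `y ^ m` moves `t`, as `Z` commutes with `z` and `t`. The sign of `c = -(Z⁻¹ y ^ m)` is the
one for which `cayley c` is `(Z - y ^ m)⁻¹ (Z + y ^ m)`. -/
lemma mul_smul_of_commute (hz : Commute Z (z k)) (ht : Commute Z (t k))
    (a : FractionRing k[X][X]) (d : DHeis k) :
    -(Z⁻¹ * y k ^ m) * (a • d) = shift k _ m a • (-(Z⁻¹ * y k ^ m) * d) := by
  have h1 : Commute (Z⁻¹ * y k ^ m) (z k) :=
    hz.inv_left₀.mul_left ((commute_z_y k).symm.pow_left m)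
  have h2 : SemiconjBy (Z⁻¹ * y k ^ m) (t k) (t k + m) :=
    (show SemiconjBy Z⁻¹ (t k + m) (t k + m) from
      ht.inv_left₀.add_right (Nat.cast_commute m _).symm).mul_left (semiconjBy_y_pow_t k m)
  change _ * (fracHom k a * d) = fracHom k (shift k _ m a) * _
  rw [neg_mul, neg_mul, mul_neg, ← mul_assoc, (semiconjBy_fracHom h1 h2 a).eq, mul_assoc]

lemma linearIndependent_pow_neg (hm : m ≠ 0) (hZ : Z ≠ 0) (hz : Commute Z (z k))
    (ht : Commute Z (t k)) :
    LinearIndependent (FractionRing k[X][X]) fun i : ℕ => (-(Z⁻¹ * y k ^ m)) ^ i := by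
  refine linearIndependent_pow_of_semilinear (mul_smul_of_commute hz ht)
    (neg_ne_zero.2 (mul_ne_zero (inv_ne_zero hZ) (pow_ne_zero _ (y_ne_zero k))))
    (t := algebraMap k[X][X] _ X) ?_
  have h : ∀ i : ℕ, (shift k (FractionRing k[X][X]) m)^[i] (algebraMap k[X][X] _ X) =
      algebraMap k[X][X] _ (X + ((i * m : ℕ) : k[X][X])) := by
    intro i
    induction i with
    | zero => simp
    | succ i ih =>
      rw [Function.iterate_succ_apply', ih, shift_algebraMap, map_add, shiftEquiv_X, map_natCast]
      congr 1
      push_cast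
      ring
  intro i j hij
  simp only [h] at hij
  have h1 := add_left_cancel (IsFractionRing.injective k[X][X] (FractionRing k[X][X]) hij)
  exact Nat.eq_of_mul_eq_mul_right (Nat.pos_of_ne_zero hm) (Nat.cast_injective h1)

lemma one_add_ne_zero_and_one_sub_ne_zero {K D : Type*} [Field K] [DivisionRing D] [Module K D]
    {c : D} (h : LinearIndependent K fun i : ℕ => c ^ i) : 1 + c ≠ 0 ∧ 1 - c ≠ 0 := by
  have h1 := one_add_smul_ne_zero_of_linearIndependent h 1
  have h2 := one_add_smul_ne_zero_of_linearIndependent h (-1)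
  rw [one_smul] at h1
  rw [neg_smul, one_smul, ← sub_eq_add_neg] at h2
  exact ⟨h1, h2⟩

lemma add_pow_ne_zero (hm : m ≠ 0) (hZ : Z ≠ 0) (hz : Commute Z (z k)) (ht : Commute Z (t k)) :
    Z + y k ^ m ≠ 0 := by
  have h1 := (one_add_ne_zero_and_one_sub_ne_zero (K := FractionRing k[X][X]) (D := DHeis k)
    (linearIndependent_pow_neg hm hZ hz ht)).2
  have h2 : Z + y k ^ m = Z * (1 - -(Z⁻¹ * y k ^ m)) := by
    rw [sub_neg_eq_add, mul_add, mul_one, mul_inv_cancel_left₀ hZ]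
  rw [h2]
  exact mul_ne_zero hZ h1

lemma sub_pow_ne_zero (hm : m ≠ 0) (hZ : Z ≠ 0) (hz : Commute Z (z k)) (ht : Commute Z (t k)) :
    Z - y k ^ m ≠ 0 := by
  have h1 := (one_add_ne_zero_and_one_sub_ne_zero (K := FractionRing k[X][X]) (D := DHeis k)
    (linearIndependent_pow_neg hm hZ hz ht)).1
  have h2 : Z - y k ^ m = Z * (1 + -(Z⁻¹ * y k ^ m)) := by
    rw [mul_add, mul_one, mul_neg, mul_inv_cancel_left₀ hZ, sub_eq_add_neg]
  rw [h2]
  exact mul_ne_zero hZ h1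

theorem isFreeGroupAlgebraOn_fracHom (hm : m ≠ 0) (hZ : Z ≠ 0) (hz : Commute Z (z k))
    (ht : Commute Z (t k)) (hy : Commute Z (y k)) {f : FractionRing k[X][X]}
    (hf : ∀ a : ℤ →₀ FractionRing k[X][X], (∀ n, shift k _ m (a n) = a n) → ∀ p,
      (a.sum fun n x => x * f ^ n) = p + shift k _ m p → ∀ n ≠ 0, a n = 0) :
    IsFreeGroupAlgebraOn k (fracHom k f) ((Z + y k ^ m)⁻¹ * (Z - y k ^ m) * fracHom k f *
      (Z + y k ^ m) * (Z - y k ^ m)⁻¹) := by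
  have h2 : (2 : FractionRing k[X][X]) ≠ 0 := by
    have : (2 : FractionRing k[X][X]) = algebraMap k _ 2 := (map_ofNat _ 2).symm
    rw [this, Ne, map_eq_zero]
    exact two_ne_zero
  have h := isFreeGroupAlgebraOn_conj_cayley (k := k) (mul_smul_of_commute hz ht) h2
    (fun r => by
      rw [IsScalarTower.algebraMap_apply k k[X][X], shift_algebraMap]
      congr 1
      exact shiftEquiv_C m (C r)) (linearIndependent_pow_neg hm hZ hz ht) hf
  have h1 : f • (1 : DHeis k) = fracHom k f := mul_one _
  have h3 : cayley (-(Z⁻¹ * y k ^ m)) = (Z - y k ^ m)⁻¹ * (Z + y k ^ m) := by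
    have h4 : 1 + -(Z⁻¹ * y k ^ m) = Z⁻¹ * (Z - y k ^ m) := by
      rw [mul_sub, inv_mul_cancel₀ hZ, sub_eq_add_neg]
    have h5 : 1 - -(Z⁻¹ * y k ^ m) = Z⁻¹ * (Z + y k ^ m) := by
      rw [mul_add, inv_mul_cancel₀ hZ, sub_neg_eq_add]
    rw [cayley, h4, h5, mul_inv_rev, inv_inv, mul_assoc, mul_inv_cancel_left₀ hZ]
  -- Needed to rewrite the right-hand factor `cayley c` as `(Z + y ^ m) (Z - y ^ m)⁻¹`.
  have h4 : Commute (Z - y k ^ m) (Z + y k ^ m) := by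
    have h5 := hy.pow_right m
    exact ((Commute.refl Z).add_right h5).sub_left (h5.symm.add_right (Commute.refl _))
  rw [h1, h3, mul_inv_rev, inv_inv, h4.inv_left₀.eq, ← mul_assoc] at h
  exact h

end Free

/-! ### The generators as fractions in `z` and `t` -/

section Fractions

variable (K : Type*) [Field K] [Algebra k[X][X] K]

/-- The element `z⁻¹ (S + S⁻¹) z⁻¹`. -/
def fracS₁ : K :=
  (algebraMap k[X][X] K (C X))⁻¹ * (fracS k K + (fracS k K)⁻¹) * (algebraMap k[X][X] K (C X))⁻¹

/-- The element `z (S + S⁻¹) z`. -/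
def fracS₂ : K :=
  algebraMap k[X][X] K (C X) * (fracS k K + (fracS k K)⁻¹) * algebraMap k[X][X] K (C X)

omit [CharZero k] in
lemma fracS_eq : fracS k K =
    (algebraMap k[X][X] K X - 1 / 3) / (algebraMap k[X][X] K X + 1 / 3) := by
  have h : algebraMap k[X][X] K (C (C (1 / 3))) = 1 / 3 := by
    change ((algebraMap k[X][X] K).comp (C.comp C)) (1 / 3) = _
    rw [map_div₀, map_one, map_ofNat]
  rw [fracS, map_sub, map_add, h]

variable [IsFractionRing k[X][X] K]

/-- The sum is `2 (t² + 1/9) / (t² - 1/9)`; the factor 9 clears the inner denominators. The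
nonvanishing is recorded for later simplifications. -/
lemma fracS_add_inv : fracS k K + (fracS k K)⁻¹ =
    2 * (9 * algebraMap k[X][X] K X ^ 2 + 1) / (9 * algebraMap k[X][X] K X ^ 2 - 1) ∧
    9 * algebraMap k[X][X] K X ^ 2 - 1 ≠ 0 := by
  have hinj := IsFractionRing.injective k[X][X] K
  have h : algebraMap k[X][X] K (C (C (1 / 3))) = 1 / 3 := by
    change ((algebraMap k[X][X] K).comp (C.comp C)) (1 / 3) = _
    rw [map_div₀, map_one, map_ofNat]
  have h3 : (3 : K) ≠ 0 := by
    have h4 : (3 : K) = ((algebraMap k[X][X] K).comp (C.comp C)) 3 := (map_ofNat _ 3).symm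
    rw [h4, Ne, map_eq_zero]
    exact three_ne_zero
  have h1 : algebraMap k[X][X] K X - 1 / 3 ≠ 0 := by
    rw [← h, ← map_sub, Ne, map_eq_zero_iff _ hinj]
    exact X_sub_C_ne_zero _
  have h2 : algebraMap k[X][X] K X + 1 / 3 ≠ 0 := by
    rw [← h, ← map_add, Ne, map_eq_zero_iff _ hinj]
    exact X_add_C_ne_zero _
  rw [fracS_eq]
  generalize algebraMap k[X][X] K X = t at *
  have h4 : 9 * t ^ 2 - 1 = 9 * ((t - 1 / 3) * (t + 1 / 3)) := by field_simp; ring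
  have h9 : (9 : K) ≠ 0 := by
    have : (9 : K) = 3 * 3 := by norm_num
    rw [this]
    exact mul_ne_zero h3 h3
  have h5 : 9 * t ^ 2 - 1 ≠ 0 := by
    rw [h4]
    exact mul_ne_zero h9 (mul_ne_zero h1 h2)
  refine ⟨?_, h5⟩
  rw [eq_div_iff h5, h4, inv_div, div_add_div _ _ h2 h1, div_mul_eq_mul_div,
    div_eq_iff (mul_ne_zero h2 h1)]
  field_simp
  ring

omit [CharZero k] in
lemma algebraMap_C_X_ne_zero : algebraMap k[X][X] K (C X) ≠ 0 := by
  rw [Ne, map_eq_zero_iff _ (IsFractionRing.injective k[X][X] K)]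
  exact C_ne_zero.2 X_ne_zero

/-- In the commutative field, `z⁻¹ P z⁻¹ = P / z²`, which gives `A = 1` and `B = z²`. Squaring gives
`B = z⁴`, and replacing `z⁻¹` by `z` moves the power of `z` to `A`. -/
lemma one_add_fracS₁ : 1 + fracS₁ k K = fracP K (1 : k[X]) (X ^ 2) 1 := by
  obtain ⟨h1, h2⟩ := fracS_add_inv k K
  have h3 := algebraMap_C_X_ne_zero k K
  simp only [fracS₁, fracP, h1, map_add, map_sub, map_mul, map_pow, map_one, map_ofNat, pow_one]
  field_simp

lemma one_add_fracS₁_sq : 1 + fracS₁ k K ^ 2 = fracP K (1 : k[X]) (X ^ 4) 2 := by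
  obtain ⟨h1, h2⟩ := fracS_add_inv k K
  have h3 := algebraMap_C_X_ne_zero k K
  simp only [fracS₁, fracP, h1, map_add, map_sub, map_mul, map_pow, map_one, map_ofNat]
  field_simp

lemma one_add_fracS₂_sq : 1 + fracS₂ k K ^ 2 = fracP K (X ^ 4 : k[X]) 1 2 := by
  obtain ⟨h1, h2⟩ := fracS_add_inv k K
  have h3 := algebraMap_C_X_ne_zero k K
  simp only [fracS₂, fracP, h1, map_add, map_sub, map_mul, map_pow, map_one, map_ofNat]
  field_simp

end Fractions

lemma fracHom_C_X : fracHom k (algebraMap k[X][X] _ (C X)) = z k := by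
  rw [fracHom_algebraMap, polyHom_C, aeval_X]

lemma Vm_eq : Vm k = polyHom k (X - C (C (1 / 3))) * z k := by
  rw [map_sub, polyHom_X, polyHom_C, aeval_C, sub_mul, t_mul_z, Vm, Algebra.smul_def]

lemma Vp_eq : Vp k = polyHom k (X + C (C (1 / 3))) * z k := by
  rw [map_add, polyHom_X, polyHom_C, aeval_C, add_mul, t_mul_z, Vp, Algebra.smul_def]

lemma Vm_ne_zero : Vm k ≠ 0 := by
  rw [Vm_eq]
  refine mul_ne_zero ?_ (z_ne_zero k)
  rw [Ne, map_eq_zero_iff _ (polyHom_injective k)]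
  exact X_sub_C_ne_zero _

lemma Vp_ne_zero : Vp k ≠ 0 := by
  rw [Vp_eq]
  refine mul_ne_zero ?_ (z_ne_zero k)
  rw [Ne, map_eq_zero_iff _ (polyHom_injective k)]
  exact X_add_C_ne_zero _

lemma fracHom_fracS : fracHom k (fracS k _) = S k := by
  rw [S, Vm_eq, Vp_eq, fracS, map_div₀, fracHom_algebraMap, fracHom_algebraMap, mul_inv_rev,
    mul_assoc, mul_inv_cancel_left₀ (z_ne_zero k), div_eq_mul_inv]

lemma commute_Vm_Vp : Commute (Vm k) (Vp k) :=
  (((Commute.refl _).add_right ((commute_z_V k).symm.smul_right _)).sub_left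
    (((commute_z_V k).add_right ((Commute.refl _).smul_right _)).smul_left _))

lemma fracHom_fracS_add_inv : fracHom k (fracS k _ + (fracS k _)⁻¹) =
    Vm k * (Vp k)⁻¹ + (Vm k)⁻¹ * Vp k := by
  rw [map_add, map_inv₀, fracHom_fracS, S, mul_inv_rev, inv_inv, (commute_Vm_Vp k).inv_left₀.eq]

lemma fracHom_fracS₁ : fracHom k (fracS₁ k _) = S₁ k := by
  rw [fracS₁, map_mul, map_mul, map_inv₀, fracHom_C_X, fracHom_fracS_add_inv, S₁]

lemma fracHom_fracS₂ : fracHom k (fracS₂ k _) = S₂ k := by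
  rw [fracS₂, map_mul, map_mul, fracHom_C_X, fracHom_fracS_add_inv, S₂]

end DHeis

end

noncomputable section

open Polynomial OreLocalization nonZeroDivisors

universe u

/-! ### Elements fixed by an involution -/

section Symmetric

variable {k D : Type*} [Field k] [DivisionRing D] [Algebra k D] (τ : AlgInvolution k D)

lemma AlgInvolution.map_inv (a : D) : τ a⁻¹ = (τ a)⁻¹ := by
  have h0 : τ 0 = 0 := map_zero τ.toLinearMap
  by_cases ha : a = 0
  · rw [ha, inv_zero, h0, inv_zero]
  · refine eq_inv_of_mul_eq_one_left ?_
    exact (τ.map_mul' a a⁻¹).symm.trans (by rw [mul_inv_cancel₀ ha]; exact τ.map_one')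

lemma AlgInvolution.map_mul (a b : D) : τ (a * b) = τ b * τ a := τ.map_mul' a b

lemma AlgInvolution.map_add (a b : D) : τ (a + b) = τ a + τ b := τ.map_add' a b

lemma AlgInvolution.map_sub (a b : D) : τ (a - b) = τ a - τ b := _root_.map_sub τ.toLinearMap a b

lemma AlgInvolution.map_smul (r : k) (a : D) : τ (r • a) = r • τ a := τ.map_smul' r a

variable {τ}

lemma AlgInvolution.IsSymmetric.sq {a : D} (h : τ.IsSymmetric a) : τ.IsSymmetric (a ^ 2) := by
  change τ a = a at h
  change τ (a ^ 2) = a ^ 2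
  rw [pow_two, τ.map_mul, h]

/-- `τ` exchanges `a` and `b`, up to a common sign. -/
def AlgInvolution.Swaps (τ : AlgInvolution k D) (a b : D) : Prop :=
  (τ a = b ∧ τ b = a) ∨ (τ a = -b ∧ τ b = -a)

/-- The image is `τ(b)⁻¹ τ(a) s τ(b) τ(a)⁻¹`, and exchanging `a` and `b` restores the original. A
common sign occurs four times and disappears. -/
lemma AlgInvolution.Swaps.isSymmetric_conj {a b s : D} (h : τ.Swaps a b) (hs : τ.IsSymmetric s) :
    τ.IsSymmetric (a⁻¹ * b * s * a * b⁻¹) := by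
  change τ s = s at hs
  change τ _ = _
  simp only [τ.map_mul, τ.map_inv, hs]
  rcases h with ⟨h1, h2⟩ | ⟨h1, h2⟩
  · simp only [h1, h2, mul_assoc]
  · simp only [h1, h2, mul_assoc, inv_neg, neg_mul, mul_neg, neg_neg]

/-- Reversal and exchange send `a b⁻¹` to `a⁻¹ b` and conversely, so the two summands are swapped.
-/
lemma AlgInvolution.Swaps.isSymmetric_add {a b : D} (h : τ.Swaps a b) :
    τ.IsSymmetric (a * b⁻¹ + a⁻¹ * b) := by
  change τ _ = _
  simp only [τ.map_add, τ.map_mul, τ.map_inv]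
  rcases h with ⟨h1, h2⟩ | ⟨h1, h2⟩
  · rw [h1, h2, add_comm]
  · rw [h1, h2, inv_neg, inv_neg, neg_mul_neg, neg_mul_neg, add_comm]

end Symmetric

/-! ### Action of the three involutions, and freeness for each fraction -/

namespace DHeis

variable {k : Type u} [Field k] [CharZero k]

lemma isSymmetric_S₁ {τ : AlgInvolution k (DHeis k)} (hz : τ (z k) = z k ∨ τ (z k) = -z k)
    (h : τ.Swaps (Vm k) (Vp k)) : τ.IsSymmetric (S₁ k) := by
  have h1 : τ _ = _ := h.isSymmetric_add
  change τ (S₁ k) = S₁ k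
  rw [S₁, τ.map_mul, τ.map_mul, h1, τ.map_inv]
  rcases hz with hz | hz
  · rw [hz, mul_assoc]
  · rw [hz, inv_neg, mul_neg, neg_mul, mul_neg, neg_neg, mul_assoc]

lemma isSymmetric_S₂ {τ : AlgInvolution k (DHeis k)} (hz : τ (z k) = z k ∨ τ (z k) = -z k)
    (h : τ.Swaps (Vm k) (Vp k)) : τ.IsSymmetric (S₂ k) := by
  have h1 : τ _ = _ := h.isSymmetric_add
  change τ (S₂ k) = S₂ k
  rw [S₂, τ.map_mul, τ.map_mul, h1]
  rcases hz with hz | hz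
  · rw [hz, mul_assoc]
  · rw [hz, mul_neg, neg_mul, mul_neg, neg_neg, mul_assoc]

lemma extend_numerator (η : LieInvolution k (Heis k)) (a : Heis k) :
    extend η (numeratorRingHom (UniversalEnvelopingAlgebra.ι k a)) =
      numeratorRingHom (UniversalEnvelopingAlgebra.ι k (η a)) := by
  rw [extend, AlgInvolution.toOre_numerator, LieInvolution.toEnveloping_ι]

lemma extend_involutionPosPos : extend (Heis.involutionPosPos k) (x k) = x k ∧
    extend (Heis.involutionPosPos k) (y k) = y k ∧
    extend (Heis.involutionPosPos k) (z k) = -z k := by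
  obtain ⟨hx, hy, hz⟩ := Heis.involutionPosPos_apply k
  exact ⟨(extend_numerator _ _).trans (by rw [hx]; rfl),
    (extend_numerator _ _).trans (by rw [hy]; rfl),
    (extend_numerator _ _).trans (by rw [hz, map_neg, map_neg]; rfl)⟩

lemma extend_involutionPosNeg : extend (Heis.involutionPosNeg k) (x k) = x k ∧
    extend (Heis.involutionPosNeg k) (y k) = -y k ∧
    extend (Heis.involutionPosNeg k) (z k) = z k := by
  obtain ⟨hx, hy, hz⟩ := Heis.involutionPosNeg_apply k
  exact ⟨(extend_numerator _ _).trans (by rw [hx]; rfl),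
    (extend_numerator _ _).trans (by rw [hy, map_neg, map_neg]; rfl),
    (extend_numerator _ _).trans (by rw [hz]; rfl)⟩

lemma extend_involutionNegNeg (a : Heis k) :
    extend (Heis.involutionNegNeg k) (numeratorRingHom (UniversalEnvelopingAlgebra.ι k a)) =
      -numeratorRingHom (UniversalEnvelopingAlgebra.ι k a) :=
  (extend_numerator _ _).trans (by
    change numeratorRingHom (UniversalEnvelopingAlgebra.ι k (-a)) = _
    rw [map_neg, map_neg])

lemma map_V {τ : AlgInvolution k (DHeis k)} {ε δ : k} (hx : τ (x k) = ε • x k)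
    (hy : τ (y k) = δ • y k) : τ (V k) = (ε * δ) • V k := by
  rw [V, τ.map_smul, τ.map_add, τ.map_mul, τ.map_mul, hx, hy, smul_comm]
  congr 1
  rw [smul_mul_smul_comm, smul_mul_smul_comm, smul_add, mul_comm δ, add_comm]

lemma swaps_Vm_Vp {τ : AlgInvolution k (DHeis k)}
    (h : (τ (V k) = V k ∧ τ (z k) = -z k) ∨ (τ (V k) = -V k ∧ τ (z k) = z k)) :
    τ.Swaps (Vm k) (Vp k) := by
  rcases h with ⟨h1, h2⟩ | ⟨h1, h2⟩
  · refine Or.inl ⟨?_, ?_⟩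
    · rw [Vm, τ.map_sub, τ.map_smul, h1, h2, smul_neg, sub_neg_eq_add, Vp]
    · rw [Vp, τ.map_add, τ.map_smul, h1, h2, smul_neg, ← sub_eq_add_neg, Vm]
  · refine Or.inr ⟨?_, ?_⟩
    · rw [Vm, τ.map_sub, τ.map_smul, h1, h2, Vp, neg_add, sub_eq_add_neg]
    · rw [Vp, τ.map_add, τ.map_smul, h1, h2, Vm, neg_sub, sub_eq_neg_add, add_comm, add_comm]

/-- Both involutions negate `z` and fix `V` and `y²`, so `z + y²` is sent to `-(z - y²)`. -/
lemma map_z_and_swaps_of_mem {η : LieInvolution k (Heis k)}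
    (hη : η ∈ ({Heis.involutionPosPos k, Heis.involutionNegNeg k} :
      Set (LieInvolution k (Heis k)))) :
    extend η (z k) = -z k ∧ (extend η).Swaps (Vm k) (Vp k) ∧
      (extend η).Swaps (z k + y k ^ 2) (z k - y k ^ 2) := by
  have key : ∀ τ : AlgInvolution k (DHeis k), τ (z k) = -z k → τ (V k) = V k →
      τ (y k * y k) = y k * y k → τ (z k) = -z k ∧ τ.Swaps (Vm k) (Vp k) ∧
        τ.Swaps (z k + y k ^ 2) (z k - y k ^ 2) := by
    intro τ hz hV hy
    refine ⟨hz, swaps_Vm_Vp (Or.inl ⟨hV, hz⟩), Or.inr ⟨?_, ?_⟩⟩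
    · rw [pow_two, τ.map_add, hz, hy]; abel
    · rw [pow_two, τ.map_sub, hz, hy]; abel
  rcases hη with rfl | rfl
  · obtain ⟨hx, hy, hz⟩ := extend_involutionPosPos (k := k)
    refine key _ hz ?_ ?_
    · simpa using map_V (ε := 1) (δ := 1) (hx.trans (one_smul _ _).symm)
        (hy.trans (one_smul _ _).symm)
    · rw [AlgInvolution.map_mul, hy]
  · have hx : extend (Heis.involutionNegNeg k) (x k) = -x k := extend_involutionNegNeg _
    have hy : extend (Heis.involutionNegNeg k) (y k) = -y k := extend_involutionNegNeg _
    refine key _ (extend_involutionNegNeg _) ?_ ?_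
    · simpa using map_V (ε := -1) (δ := -1) (hx.trans (by simp)) (hy.trans (by simp))
    · rw [AlgInvolution.map_mul, hy, neg_mul_neg]

/-- This involution fixes `z` and `y²`, hence `z ± y²` as well; an odd power of `y` is needed for an
exchange, whence `z² ± y³`. It negates `V`, so `V ± z/3` are exchanged up to sign. -/
lemma swaps_involutionPosNeg : (extend (Heis.involutionPosNeg k)).Swaps (Vm k) (Vp k) ∧
    (extend (Heis.involutionPosNeg k)).Swaps (z k ^ 2 + y k ^ 3) (z k ^ 2 - y k ^ 3) := by
  obtain ⟨hx, hy, hz⟩ := extend_involutionPosNeg (k := k)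
  generalize extend (Heis.involutionPosNeg k) = τ at *
  have hV : τ (V k) = -V k := by
    simpa using map_V (ε := 1) (δ := -1) (hx.trans (one_smul _ _).symm) (hy.trans (by simp))
  have hz2 : τ (z k ^ 2) = z k ^ 2 := by rw [pow_two, τ.map_mul, hz]
  have hy3 : τ (y k ^ 3) = -y k ^ 3 := by
    rw [pow_succ, pow_two, τ.map_mul, τ.map_mul, hy]
    noncomm_ring
  refine ⟨swaps_Vm_Vp (Or.inr ⟨hV, hz⟩), Or.inl ⟨?_, ?_⟩⟩
  · rw [τ.map_add, hz2, hy3, sub_eq_add_neg]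
  · rw [τ.map_sub, hz2, hy3, sub_neg_eq_add]

variable (k) in
/-- The group algebra generated by `f` and its conjugates, for both conjugating elements. -/
def FreeWithConjugates (f : FractionRing k[X][X]) : Prop :=
  IsFreeGroupAlgebraOn k (fracHom k f) ((z k + y k ^ 2)⁻¹ * (z k - y k ^ 2) * fracHom k f *
      (z k + y k ^ 2) * (z k - y k ^ 2)⁻¹) ∧
  IsFreeGroupAlgebraOn k (fracHom k f) ((z k ^ 2 + y k ^ 3)⁻¹ * (z k ^ 2 - y k ^ 3) *
    fracHom k f * (z k ^ 2 + y k ^ 3) * (z k ^ 2 - y k ^ 3)⁻¹)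

lemma freeWithConjugates {f : FractionRing k[X][X]}
    (hf : ∀ m : ℕ, m ≠ 0 → ∀ a : ℤ →₀ FractionRing k[X][X], (∀ n, shift k _ m (a n) = a n) → ∀ p,
      (a.sum fun n x => x * f ^ n) = p + shift k _ m p → ∀ n ≠ 0, a n = 0) :
    FreeWithConjugates k f :=
  ⟨isFreeGroupAlgebraOn_fracHom two_ne_zero (z_ne_zero k) (Commute.refl _) (commute_z_t k)
      (commute_z_y k) (hf 2 two_ne_zero),
    isFreeGroupAlgebraOn_fracHom three_ne_zero (pow_ne_zero 2 (z_ne_zero k))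
      ((Commute.refl _).pow_left 2) ((commute_z_t k).pow_left 2) ((commute_z_y k).pow_left 2)
      (hf 3 three_ne_zero)⟩

lemma freeWithConjugates_fracS : FreeWithConjugates k (fracS k _) :=
  freeWithConjugates fun _ hm _ ha _ h n hn => sum_fracS_zpow_eq hm ha h n hn

omit [CharZero k] in
lemma transcendental_X_pow {n : ℕ} (hn : 0 < n) :
    Transcendental k ((RatFunc.X : RatFunc k) ^ n) :=
  fun h => RatFunc.transcendental_X (h.of_pow hn)

lemma freeWithConjugates_one_add_fracS₁ : FreeWithConjugates k (1 + fracS₁ k _) := by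
  rw [one_add_fracS₁]
  refine freeWithConjugates fun _ hm _ ha _ h n hn =>
    sum_fracP_zpow_eq hm one_ne_zero (pow_ne_zero _ X_ne_zero) ?_ (Or.inl rfl) ha h n hn
  rw [map_one, map_pow, aeval_X, one_div]
  exact fun h => transcendental_X_pow two_pos (IsAlgebraic.inv_iff.1 h)

lemma freeWithConjugates_one_add_fracS₁_sq : FreeWithConjugates k (1 + fracS₁ k _ ^ 2) := by
  rw [one_add_fracS₁_sq]
  refine freeWithConjugates fun _ hm _ ha _ h n hn =>
    sum_fracP_zpow_eq hm one_ne_zero (pow_ne_zero _ X_ne_zero) ?_ (Or.inr rfl) ha h n hn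
  rw [map_one, map_pow, aeval_X, one_div]
  exact fun h => transcendental_X_pow four_pos (IsAlgebraic.inv_iff.1 h)

lemma freeWithConjugates_one_add_fracS₂_sq : FreeWithConjugates k (1 + fracS₂ k _ ^ 2) := by
  rw [one_add_fracS₂_sq]
  refine freeWithConjugates fun _ hm _ ha _ h n hn =>
    sum_fracP_zpow_eq hm (pow_ne_zero _ X_ne_zero) one_ne_zero ?_ (Or.inr rfl) ha h n hn
  rw [map_one, map_pow, aeval_X, div_one]
  exact transcendental_X_pow four_pos

end DHeis

/-! ### Compatibility of conjugation with `1 + s` and `s²` -/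

section Conjugation

variable {D : Type*} [DivisionRing D] {a b : D}

/-- As `a` and `b` commute, `a b⁻¹` is the inverse of `a⁻¹ b`, so this is a genuine conjugation,
hence a ring homomorphism. -/
lemma conj_one_add (ha : a ≠ 0) (hb : b ≠ 0) (s : D) (h : Commute a b) :
    a⁻¹ * b * (1 + s) * a * b⁻¹ = 1 + a⁻¹ * b * s * a * b⁻¹ := by
  have h1 : a⁻¹ * b * a * b⁻¹ = 1 := by
    rw [mul_assoc a⁻¹, ← h.eq, inv_mul_cancel_left₀ ha, mul_inv_cancel₀ hb]
  rw [mul_add, mul_one, add_mul, add_mul, h1]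

lemma conj_sq (ha : a ≠ 0) (hb : b ≠ 0) (s : D) (h : Commute a b) :
    a⁻¹ * b * s ^ 2 * a * b⁻¹ = (a⁻¹ * b * s * a * b⁻¹) ^ 2 := by
  have h1 : a * (b⁻¹ * (a⁻¹ * b)) = 1 := by
    have h2 : b * a⁻¹ = a⁻¹ * b := Commute.inv_right₀ (Commute.symm h)
    rw [← h2, inv_mul_cancel_left₀ hb, mul_inv_cancel₀ ha]
  have h2 (w : D) : a * (b⁻¹ * (a⁻¹ * (b * w))) = w := by
    simpa only [mul_assoc, one_mul] using congrArg (· * w) h1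
  simp only [pow_two, mul_assoc, h2]

end Conjugation

end

/-! ### The generating pairs of the theorem -/

namespace DHeis

section Generators

variable {k : Type*} [Field k] [CharZero k]

lemma nonvanishing : z k ≠ 0 ∧ Vm k ≠ 0 ∧ Vp k ≠ 0 ∧ z k + y k ^ 2 ≠ 0 ∧ z k - y k ^ 2 ≠ 0 ∧
    z k ^ 2 + y k ^ 3 ≠ 0 ∧ z k ^ 2 - y k ^ 3 ≠ 0 :=
  have hz := z_ne_zero k
  have hz2 : z k ^ 2 ≠ 0 := pow_ne_zero 2 hz
  have h2 : Commute (z k ^ 2) (z k) := (Commute.refl _).pow_left 2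
  have ht2 := (commute_z_t k).pow_left 2
  ⟨hz, Vm_ne_zero k, Vp_ne_zero k,
    add_pow_ne_zero two_ne_zero hz (Commute.refl _) (commute_z_t k),
    sub_pow_ne_zero two_ne_zero hz (Commute.refl _) (commute_z_t k),
    add_pow_ne_zero three_ne_zero hz2 h2 ht2, sub_pow_ne_zero three_ne_zero hz2 h2 ht2⟩

lemma commute_add_sub (n m : ℕ) :
    Commute (z k ^ n + y k ^ m) (z k ^ n - y k ^ m) := by
  have h := (commute_z_y k).pow_pow n m
  exact ((Commute.refl _).sub_right h).add_left (h.symm.sub_right (Commute.refl _))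

lemma isFreeGroupAlgebraOn_S_T : IsFreeGroupAlgebraOn k (S k) (T k) := by
  have h := (freeWithConjugates_fracS (k := k)).1
  rwa [fracHom_fracS] at h

lemma conj_two (s : DHeis k) :
    (z k + y k ^ 2)⁻¹ * (z k - y k ^ 2) * (1 + s) * (z k + y k ^ 2) * (z k - y k ^ 2)⁻¹ =
      1 + (z k + y k ^ 2)⁻¹ * (z k - y k ^ 2) * s * (z k + y k ^ 2) * (z k - y k ^ 2)⁻¹ ∧
    (z k + y k ^ 2)⁻¹ * (z k - y k ^ 2) * s ^ 2 * (z k + y k ^ 2) * (z k - y k ^ 2)⁻¹ =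
      ((z k + y k ^ 2)⁻¹ * (z k - y k ^ 2) * s * (z k + y k ^ 2) * (z k - y k ^ 2)⁻¹) ^ 2 := by
  obtain ⟨-, -, -, h1, h2, -⟩ := nonvanishing (k := k)
  have h : Commute (z k + y k ^ 2) (z k - y k ^ 2) := by simpa using commute_add_sub 1 2
  exact ⟨conj_one_add h1 h2 s h, conj_sq h1 h2 s h⟩

lemma conj_three (s : DHeis k) :
    (z k ^ 2 + y k ^ 3)⁻¹ * (z k ^ 2 - y k ^ 3) * (1 + s) * (z k ^ 2 + y k ^ 3) *
        (z k ^ 2 - y k ^ 3)⁻¹ =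
      1 + (z k ^ 2 + y k ^ 3)⁻¹ * (z k ^ 2 - y k ^ 3) * s * (z k ^ 2 + y k ^ 3) *
        (z k ^ 2 - y k ^ 3)⁻¹ ∧
    (z k ^ 2 + y k ^ 3)⁻¹ * (z k ^ 2 - y k ^ 3) * s ^ 2 * (z k ^ 2 + y k ^ 3) *
        (z k ^ 2 - y k ^ 3)⁻¹ =
      ((z k ^ 2 + y k ^ 3)⁻¹ * (z k ^ 2 - y k ^ 3) * s * (z k ^ 2 + y k ^ 3) *
        (z k ^ 2 - y k ^ 3)⁻¹) ^ 2 := by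
  obtain ⟨-, -, -, -, -, h1, h2⟩ := nonvanishing (k := k)
  have h : Commute (z k ^ 2 + y k ^ 3) (z k ^ 2 - y k ^ 3) := commute_add_sub 2 3
  exact ⟨conj_one_add h1 h2 s h, conj_sq h1 h2 s h⟩

lemma isFreeGroupAlgebraOn_one_add_S₁ :
    IsFreeGroupAlgebraOn k (1 + S₁ k) (1 + T₁ k) ∧
    IsFreeGroupAlgebraOn k (1 + S₁ k) (1 + T₂ k) := by
  have h := freeWithConjugates_one_add_fracS₁ (k := k)
  rwa [FreeWithConjugates, map_add, map_one, fracHom_fracS₁, (conj_two _).1,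
    (conj_three _).1] at h

lemma isFreeGroupAlgebraOn_one_add_S₁_sq :
    IsFreeGroupAlgebraOn k (1 + S₁ k ^ 2) (1 + T₁ k ^ 2) ∧
    IsFreeGroupAlgebraOn k (1 + S₁ k ^ 2) (1 + T₂ k ^ 2) := by
  have h := freeWithConjugates_one_add_fracS₁_sq (k := k)
  rwa [FreeWithConjugates, map_add, map_one, map_pow, fracHom_fracS₁, (conj_two _).1,
    (conj_two _).2, (conj_three _).1, (conj_three _).2] at h

lemma isFreeGroupAlgebraOn_one_add_S₂_sq :
    IsFreeGroupAlgebraOn k (1 + S₂ k ^ 2) (1 + T₃ k ^ 2) ∧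
    IsFreeGroupAlgebraOn k (1 + S₂ k ^ 2) (1 + T₄ k ^ 2) := by
  have h := freeWithConjugates_one_add_fracS₂_sq (k := k)
  rwa [FreeWithConjugates, map_add, map_one, map_pow, fracHom_fracS₂, (conj_two _).1,
    (conj_two _).2, (conj_three _).1, (conj_three _).2] at h

end Generators

end DHeis

theorem mainTheorem4 {k : Type*} [Field k] [CharZero k] :
    -- the denominators do not vanish
    (DHeis.z k ≠ 0 ∧ DHeis.Vm k ≠ 0 ∧ DHeis.Vp k ≠ 0 ∧
      DHeis.z k + DHeis.y k ^ 2 ≠ 0 ∧ DHeis.z k - DHeis.y k ^ 2 ≠ 0 ∧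
      DHeis.z k ^ 2 + DHeis.y k ^ 3 ≠ 0 ∧ DHeis.z k ^ 2 - DHeis.y k ^ 3 ≠ 0) ∧
    -- (1)
    IsFreeGroupAlgebraOn k (DHeis.S k) (DHeis.T k) ∧
    -- (2)
    ((∀ η ∈ ({Heis.involutionPosPos k, Heis.involutionNegNeg k} : Set (LieInvolution k (Heis k))),
        (DHeis.extend η).IsSymmetric (DHeis.S₁ k) ∧
        (DHeis.extend η).IsSymmetric (DHeis.S₁ k ^ 2) ∧
        (DHeis.extend η).IsSymmetric (DHeis.T₁ k) ∧
        (DHeis.extend η).IsSymmetric (DHeis.T₁ k ^ 2)) ∧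
      IsFreeAlgebraOn k (DHeis.S₁ k) (DHeis.T₁ k) ∧
      IsFreeGroupAlgebraOn k (1 + DHeis.S₁ k) (1 + DHeis.T₁ k) ∧
      IsFreeAlgebraOn k (DHeis.S₁ k ^ 2) (DHeis.T₁ k ^ 2) ∧
      IsFreeGroupAlgebraOn k (1 + DHeis.S₁ k ^ 2) (1 + DHeis.T₁ k ^ 2)) ∧
    -- (3)
    (((DHeis.extend (Heis.involutionPosNeg k)).IsSymmetric (DHeis.S₁ k) ∧
        (DHeis.extend (Heis.involutionPosNeg k)).IsSymmetric (DHeis.S₁ k ^ 2) ∧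
        (DHeis.extend (Heis.involutionPosNeg k)).IsSymmetric (DHeis.T₂ k) ∧
        (DHeis.extend (Heis.involutionPosNeg k)).IsSymmetric (DHeis.T₂ k ^ 2)) ∧
      IsFreeAlgebraOn k (DHeis.S₁ k) (DHeis.T₂ k) ∧
      IsFreeGroupAlgebraOn k (1 + DHeis.S₁ k) (1 + DHeis.T₂ k) ∧
      IsFreeAlgebraOn k (DHeis.S₁ k ^ 2) (DHeis.T₂ k ^ 2) ∧
      IsFreeGroupAlgebraOn k (1 + DHeis.S₁ k ^ 2) (1 + DHeis.T₂ k ^ 2)) ∧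
    -- (4)
    ((∀ η ∈ ({Heis.involutionPosPos k, Heis.involutionNegNeg k} : Set (LieInvolution k (Heis k))),
        (DHeis.extend η).IsSymmetric (DHeis.S₂ k) ∧
        (DHeis.extend η).IsSymmetric (DHeis.S₂ k ^ 2) ∧
        (DHeis.extend η).IsSymmetric (DHeis.T₃ k) ∧
        (DHeis.extend η).IsSymmetric (DHeis.T₃ k ^ 2)) ∧
      IsFreeAlgebraOn k (DHeis.S₂ k ^ 2) (DHeis.T₃ k ^ 2)) ∧
    -- (5)
    (((DHeis.extend (Heis.involutionPosNeg k)).IsSymmetric (DHeis.S₂ k) ∧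
        (DHeis.extend (Heis.involutionPosNeg k)).IsSymmetric (DHeis.S₂ k ^ 2) ∧
        (DHeis.extend (Heis.involutionPosNeg k)).IsSymmetric (DHeis.T₄ k) ∧
        (DHeis.extend (Heis.involutionPosNeg k)).IsSymmetric (DHeis.T₄ k ^ 2)) ∧
      IsFreeAlgebraOn k (DHeis.S₂ k ^ 2) (DHeis.T₄ k ^ 2)) :=  by
  have hS₁ := DHeis.isFreeGroupAlgebraOn_one_add_S₁ (k := k)
  have hS₁' := DHeis.isFreeGroupAlgebraOn_one_add_S₁_sq (k := k)
  have hS₂ := DHeis.isFreeGroupAlgebraOn_one_add_S₂_sq (k := k)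
  have hz := (DHeis.extend_involutionPosNeg (k := k)).2.2
  obtain ⟨hV, hy⟩ := DHeis.swaps_involutionPosNeg (k := k)
  have h₁ := DHeis.isSymmetric_S₁ (Or.inl hz) hV
  have h₂ := DHeis.isSymmetric_S₂ (Or.inl hz) hV
  refine ⟨DHeis.nonvanishing, DHeis.isFreeGroupAlgebraOn_S_T,
    ⟨fun η hη => ?_, hS₁.1.isFreeAlgebraOn, hS₁.1, hS₁'.1.isFreeAlgebraOn, hS₁'.1⟩,
    ⟨⟨h₁, h₁.sq, hy.isSymmetric_conj h₁, (hy.isSymmetric_conj h₁).sq⟩,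
      hS₁.2.isFreeAlgebraOn, hS₁.2, hS₁'.2.isFreeAlgebraOn, hS₁'.2⟩,
    ⟨fun η hη => ?_, hS₂.1.isFreeAlgebraOn⟩,
    ⟨h₂, h₂.sq, hy.isSymmetric_conj h₂, (hy.isSymmetric_conj h₂).sq⟩, hS₂.2.isFreeAlgebraOn⟩
  · obtain ⟨hz, hV, hy⟩ := DHeis.map_z_and_swaps_of_mem hη
    have h := DHeis.isSymmetric_S₁ (Or.inr hz) hV
    exact ⟨h, h.sq, hy.isSymmetric_conj h, (hy.isSymmetric_conj h).sq⟩
  · obtain ⟨hz, hV, hy⟩ := DHeis.map_z_and_swaps_of_mem hη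
    have h := DHeis.isSymmetric_S₂ (Or.inr hz) hV
    exact ⟨h, h.sq, hy.isSymmetric_conj h, (hy.isSymmetric_conj h).sq⟩
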